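/- Notation. Let $e(z)=e^{2\pi i z}$; let $\mathcal H_2$ be the Siegel upper half space of complex symmetric $2\times 2$ matrices $\Omega=\begin{pmatrix}\tau&z\\z&\omega\end{pmatrix}$ with positive definite imaginary part, and $\mathcal H_1$ the upper half plane. For $k\in\mathbb Z$, $\sigma=\begin{pmatrix}A&B\\C&D\end{pmatrix}\in \mathrm{Sp}_2(\mathbb R)$ (real symplectic $4\times4$ matrices) and $f:\mathcal H_2\to\mathbb C$ put $(f|_k\sigma)(\Omega)=\det(C\Omega+D)^{-k}f\big((A\Omega+B)(C\Omega+D)^{-1}\big)$. For $N\ge 1$ let $$K(N)=\begin{pmatrix} *&N*&*&*\\ *&*&*&*/N\\ *&N*&*&*\\ N*&N*&N*&*\end{pmatrix}\cap \mathrm{Sp}_2(\mathbb Q)\quad(*\in\mathbb Z),\qquad \mu_N=\begin{pmatrix}-F_N'&0\\0&F_N\end{pmatrix},\quad F_N=\frac1{\sqrt N}\begin{pmatrix}0&1\\-N&0\end{pmatrix},$$ where $F_N'$ is the transpose of $F_N$. Let $S_k(K(N))$ be the space of holomorphic $f:\mathcal H_2\to\mathbb C$ with $f|_k\sigma=f$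 for all $\sigma\in K(N)$ and $\lim_{\lambda\to+\infty}(f|_k\sigma)\begin{pmatrix}i\lambda&0\\0&\tau\end{pmatrix}=0$ for all $\sigma\in \mathrm{Sp}_2(\mathbb Z)$ and $\tau\in\mathcal H_1$. For $\epsilon\in\{1,-1\}$ let $S_k(K(N))^\epsilon=\{f\in S_k(K(N)): f|_k\mu_N=\epsilon f\}$. For integers $k,m\ge 0$ let $J_{k,m}^{\rm cusp}$ be the space of holomorphic $\phi:\mathcal H_1\times\mathbb C\to\mathbb C$ such that $\tilde\phi(\Omega)=\phi(\tau,z)e(m\omega)$ satisfies $\tilde\phi|_k\sigma=\tilde\phi$ for all $\sigma$ in $$\Gamma^J=\begin{pmatrix} *&0&*&*\\ *&*&*&*\\ *&0&*&*\\ 0&0&0&*\end{pmatrix}\cap \mathrm{Sp}_2(\mathbb Z),$$ and such that $\phi$ has a Fourier expansion $\phi(\tau,z)=\sum c(n,r)\,e(n\tau+rz)$ over integers $n,r$ with $n\ge0$ and $4mn>r^2$. Statement. Let $p$ be a prime, $k\ge 0$ an integer and $\epsilon\in\{1,-1\}$. Every $f\in S_k(K(p))^\epsilon$ has a unique Fourier–Jacobi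 expansion $f(\Omega)=\sum_{j\ge0}\phi_{pj}(\tau,z)\,e(pj\omega)$ on $\mathcal H_2$, its coefficients satisfy $\phi_{pj}\in J_{k,pj}^{\rm cusp}$, and they depend linearly on $f$. For every integer $J\ge0$ with $$J\ \ge\ \left\lfloor \frac{k}{10}\,\frac{p^2+1}{p+1}\right\rfloor$$ the map $$S_k(K(p))^\epsilon\to\prod_{j=1}^{J}J_{k,pj}^{\rm cusp},\qquad f\mapsto(\phi_{p},\phi_{2p},\dots,\phi_{Jp}),$$ is injective. -/

import Mathlib

open scoped UpperHalfPlane Matrix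

noncomputable section

namespace Paramodular

/-- `e(z) = exp(2πiz)`. -/
def e (z : ℂ) : ℂ := Complex.exp (2 * Real.pi * Complex.I * z)

/-- The Siegel upper half space of degree two: complex symmetric `2 × 2` matrices with positive
definite imaginary part. -/
def SiegelUpperHalf : Type :=
  {Ω : Matrix (Fin 2) (Fin 2) ℂ // Ωᵀ = Ω ∧ (Ω.map Complex.im).PosDef}

/-- `Sp₂(ℝ)`, the symplectic group of `4 × 4` real matrices. -/
abbrev Sp2R : Type := Matrix.symplecticGroup (Fin 2) ℝ

/-- The block `A` of `M = (A B; C D)`, as a complex matrix. -/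
def blockA (M : Sp2R) : Matrix (Fin 2) (Fin 2) ℂ := M.1.toBlocks₁₁.map Complex.ofReal
/-- The block `B` of `M = (A B; C D)`, as a complex matrix. -/
def blockB (M : Sp2R) : Matrix (Fin 2) (Fin 2) ℂ := M.1.toBlocks₁₂.map Complex.ofReal
/-- The block `C` of `M = (A B; C D)`, as a complex matrix. -/
def blockC (M : Sp2R) : Matrix (Fin 2) (Fin 2) ℂ := M.1.toBlocks₂₁.map Complex.ofReal
/-- The block `D` of `M = (A B; C D)`, as a complex matrix. -/
def blockD (M : Sp2R) : Matrix (Fin 2) (Fin 2) ℂ := M.1.toBlocks₂₂.map Complex.ofReal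

/-- `AΩ + B`. -/
def numer (M : Sp2R) (Ω : SiegelUpperHalf) : Matrix (Fin 2) (Fin 2) ℂ :=
  blockA M * Ω.1 + blockB M

/-- `CΩ + D`. -/
def denom (M : Sp2R) (Ω : SiegelUpperHalf) : Matrix (Fin 2) (Fin 2) ℂ :=
  blockC M * Ω.1 + blockD M

theorem block_relations (M : Sp2R) :
    (blockA M)ᵀ * blockC M = (blockC M)ᵀ * blockA M ∧
    (blockB M)ᵀ * blockD M = (blockD M)ᵀ * blockB M ∧
    (blockA M)ᵀ * blockD M - (blockC M)ᵀ * blockB M = 1 := by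
  have h := SymplecticGroup.map_mem M.2 Complex.ofRealHom
  rw [← Matrix.fromBlocks_toBlocks M.1, Matrix.fromBlocks_map,
    SymplecticGroup.fromBlocks_mem_iff] at h
  exact h

theorem numer_transpose_mul_denom (M : Sp2R) (Ω : SiegelUpperHalf) :
    (numer M Ω)ᵀ * denom M Ω = (denom M Ω)ᵀ * numer M Ω := by
  obtain ⟨h1, h2, h3⟩ := block_relations M
  have h4 : (blockD M)ᵀ * blockA M - (blockB M)ᵀ * blockC M = 1 := by
    simpa using congrArg Matrix.transpose h3
  simp only [numer, denom, Matrix.transpose_add, Matrix.transpose_mul, Ω.2.1]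
  have e1 : Ω.1 * (blockA M)ᵀ * (blockC M * Ω.1) = Ω.1 * (blockC M)ᵀ * (blockA M * Ω.1) := by
    rw [Matrix.mul_assoc, ← Matrix.mul_assoc _ (blockC M), h1]; simp only [Matrix.mul_assoc]
  have e2 : Ω.1 * (blockA M)ᵀ * blockD M = Ω.1 * (blockC M)ᵀ * blockB M + Ω.1 := by
    rw [Matrix.mul_assoc, eq_add_of_sub_eq h3, Matrix.mul_add, Matrix.mul_one, Matrix.mul_assoc,
      add_comm]
  have e3 : (blockD M)ᵀ * (blockA M * Ω.1) = (blockB M)ᵀ * (blockC M * Ω.1) + Ω.1 := by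
    rw [← Matrix.mul_assoc, eq_add_of_sub_eq h4, Matrix.add_mul, Matrix.one_mul, Matrix.mul_assoc,
      add_comm]
  simp only [Matrix.mul_add, Matrix.add_mul, e1, e2, e3, h2]
  abel

theorem block_conjTranspose (M : Sp2R) :
    (blockA M)ᴴ = (blockA M)ᵀ ∧ (blockB M)ᴴ = (blockB M)ᵀ ∧
    (blockC M)ᴴ = (blockC M)ᵀ ∧ (blockD M)ᴴ = (blockD M)ᵀ := by
  refine ⟨?_, ?_, ?_, ?_⟩ <;> ext i j <;>
    simp [blockA, blockB, blockC, blockD, Matrix.conjTranspose_apply]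

theorem denom_conjTranspose_mul_numer (M : Sp2R) (Ω : SiegelUpperHalf) :
    (denom M Ω)ᴴ * numer M Ω - (numer M Ω)ᴴ * denom M Ω = Ω.1 - Ω.1ᴴ := by
  obtain ⟨h1, h2, h3⟩ := block_relations M
  obtain ⟨c1, c2, c3, c4⟩ := block_conjTranspose M
  have h4 : (blockD M)ᵀ * blockA M - (blockB M)ᵀ * blockC M = 1 := by
    simpa using congrArg Matrix.transpose h3
  simp only [numer, denom, Matrix.conjTranspose_add, Matrix.conjTranspose_mul, c1, c2, c3, c4]
  have e1 : Ω.1ᴴ * (blockA M)ᵀ * (blockC M * Ω.1) = Ω.1ᴴ * (blockC M)ᵀ * (blockA M * Ω.1) := by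
    rw [Matrix.mul_assoc, ← Matrix.mul_assoc _ (blockC M), h1]; simp only [Matrix.mul_assoc]
  have e2 : Ω.1ᴴ * (blockA M)ᵀ * blockD M = Ω.1ᴴ * (blockC M)ᵀ * blockB M + Ω.1ᴴ := by
    rw [Matrix.mul_assoc, eq_add_of_sub_eq h3, Matrix.mul_add, Matrix.mul_one, Matrix.mul_assoc,
      add_comm]
  have e3 : (blockD M)ᵀ * (blockA M * Ω.1) = (blockB M)ᵀ * (blockC M * Ω.1) + Ω.1 := by
    rw [← Matrix.mul_assoc, eq_add_of_sub_eq h4, Matrix.add_mul, Matrix.one_mul, Matrix.mul_assoc,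
      add_comm]
  simp only [Matrix.mul_add, Matrix.add_mul, e1, e2, e3, h2]
  abel

theorem sub_conjTranspose_of_symm (X : Matrix (Fin 2) (Fin 2) ℂ) (hX : Xᵀ = X) :
    X - Xᴴ = (2 * Complex.I) • (X.map Complex.im).map Complex.ofReal := by
  have : Xᴴ = X.map star := by rw [Matrix.conjTranspose, hX]
  rw [this]
  ext i j
  simp [Complex.ext_iff]
  ring

section ComplexOrder

open scoped ComplexOrder

theorem quadForm_ofReal (Y : Matrix (Fin 2) (Fin 2) ℝ) (hY : Yᵀ = Y) (x : Fin 2 → ℂ) :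
    star x ⬝ᵥ (Y.map Complex.ofReal *ᵥ x) =
      (((fun i => (x i).re) ⬝ᵥ (Y *ᵥ fun i => (x i).re) +
        (fun i => (x i).im) ⬝ᵥ (Y *ᵥ fun i => (x i).im) : ℝ) : ℂ) := by
  have h : Y 1 0 = Y 0 1 := congrFun (congrFun hY 0) 1
  apply Complex.ext <;>
    simp [dotProduct, Matrix.mulVec, Fin.sum_univ_two, h] <;> ring

theorem posDef_map_ofReal_iff (Y : Matrix (Fin 2) (Fin 2) ℝ) :
    (Y.map Complex.ofReal).PosDef ↔ Y.PosDef := by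
  constructor
  · intro h
    have hY : Yᵀ = Y := by
      ext i j
      have := congrFun (congrFun h.isHermitian i) j
      simpa [Matrix.conjTranspose_apply] using this
    refine Matrix.PosDef.of_dotProduct_mulVec_pos (by simpa [Matrix.IsHermitian] using hY) ?_
    intro x hx
    have hx' : (fun i => (x i : ℂ)) ≠ 0 := by
      intro h0
      exact hx (funext fun i => by simpa using congrFun h0 i)
    have := h.dotProduct_mulVec_pos hx'
    rw [quadForm_ofReal Y hY, Complex.zero_lt_real] at this
    simpa [dotProduct, Matrix.mulVec] using this
  · intro h
    have hY : Yᵀ = Y := by simpa [Matrix.IsHermitian] using h.isHermitian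
    refine Matrix.PosDef.of_dotProduct_mulVec_pos ?_ ?_
    · ext i j
      have := congrFun (congrFun hY i) j
      simpa [Matrix.conjTranspose_apply] using this
    intro x hx
    rw [quadForm_ofReal Y hY, Complex.zero_lt_real]
    have hr := h.posSemidef.dotProduct_mulVec_nonneg fun i => (x i).re
    have hi := h.posSemidef.dotProduct_mulVec_nonneg fun i => (x i).im
    simp only [star_trivial] at hr hi
    by_cases h0 : (fun i => (x i).re) = 0
    · have h1 : (fun i => (x i).im) ≠ 0 := fun h1 => hx (funext fun i =>
        Complex.ext (congrFun h0 i) (congrFun h1 i))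
      have := h.dotProduct_mulVec_pos h1
      simp only [star_trivial] at this
      linarith
    · have := h.dotProduct_mulVec_pos h0
      simp only [star_trivial] at this
      linarith

theorem im_posDef_complex (Ω : SiegelUpperHalf) :
    ((Ω.1.map Complex.im).map Complex.ofReal).PosDef :=
  (posDef_map_ofReal_iff _).2 Ω.2.2

theorem denom_det_ne_zero (M : Sp2R) (Ω : SiegelUpperHalf) : (denom M Ω).det ≠ 0 := by
  intro h0
  obtain ⟨v, hv, hv0⟩ := Matrix.exists_mulVec_eq_zero_iff.2 h0
  have h := denom_conjTranspose_mul_numer M Ω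
  rw [sub_conjTranspose_of_symm _ Ω.2.1] at h
  have h1 := congrArg (fun X : Matrix (Fin 2) (Fin 2) ℂ => star v ⬝ᵥ (X *ᵥ v)) h
  have h2 : star v ᵥ* (denom M Ω)ᴴ = 0 := by
    rw [← Matrix.star_mulVec, hv0, star_zero]
  simp only [Matrix.sub_mulVec, ← Matrix.mulVec_mulVec, hv0, Matrix.mulVec_zero, sub_zero,
    Matrix.dotProduct_mulVec (star v) ((denom M Ω)ᴴ), h2, zero_dotProduct,
    Matrix.smul_mulVec, dotProduct_smul] at h1
  have h3 := (im_posDef_complex Ω).dotProduct_mulVec_pos hv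
  have h4 : (2 * Complex.I) ≠ 0 := by simp
  exact h3.ne' ((smul_eq_zero.1 h1.symm).resolve_left h4)

theorem smul_mem (M : Sp2R) (Ω : SiegelUpperHalf) :
    (numer M Ω * (denom M Ω)⁻¹)ᵀ = numer M Ω * (denom M Ω)⁻¹ ∧
      ((numer M Ω * (denom M Ω)⁻¹).map Complex.im).PosDef := by
  have hu : IsUnit (denom M Ω).det := isUnit_iff_ne_zero.2 (denom_det_ne_zero M Ω)
  set P := numer M Ω with hP
  set Q := denom M Ω with hQ
  have hut : IsUnit (Qᵀ).det := by rwa [Matrix.det_transpose]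
  have huc : IsUnit (Qᴴ).det := by rw [Matrix.det_conjTranspose]; exact hu.star
  have hs : (P * Q⁻¹)ᵀ = P * Q⁻¹ := by
    have h := numer_transpose_mul_denom M Ω
    rw [← hP, ← hQ] at h
    rw [Matrix.transpose_mul, Matrix.transpose_nonsing_inv]
    calc (Qᵀ)⁻¹ * Pᵀ = (Qᵀ)⁻¹ * (Pᵀ * Q) * Q⁻¹ := by
          rw [Matrix.mul_assoc, Matrix.mul_nonsing_inv_cancel_right _ _ hu]
      _ = P * Q⁻¹ := by rw [h, Matrix.nonsing_inv_mul_cancel_left _ _ hut]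
  refine ⟨hs, ?_⟩
  rw [← posDef_map_ofReal_iff]
  have h := denom_conjTranspose_mul_numer M Ω
  rw [sub_conjTranspose_of_symm _ Ω.2.1, ← hP, ← hQ] at h
  have h1 : P * Q⁻¹ - (P * Q⁻¹)ᴴ = (Q⁻¹)ᴴ * (Qᴴ * P - Pᴴ * Q) * Q⁻¹ := by
    rw [Matrix.conjTranspose_mul, Matrix.mul_sub, Matrix.sub_mul, Matrix.conjTranspose_nonsing_inv,
      Matrix.nonsing_inv_mul_cancel_left _ _ huc, ← Matrix.mul_assoc, Matrix.mul_assoc _ Q,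
      Matrix.mul_nonsing_inv _ hu, Matrix.mul_one]
  rw [h, sub_conjTranspose_of_symm _ hs, Matrix.mul_smul, Matrix.smul_mul] at h1
  have h4 : (2 * Complex.I) ≠ 0 := by simp
  rw [smul_right_injective _ h4 h1]
  refine (im_posDef_complex Ω).conjTranspose_mul_mul_same ?_
  refine Matrix.mulVec_injective_of_isUnit ?_
  exact (Matrix.isUnit_nonsing_inv_iff).2 ((Matrix.isUnit_iff_isUnit_det _).2 hu)

end ComplexOrder

/-- The action `Ω ↦ (AΩ + B)(CΩ + D)⁻¹` of `Sp₂(ℝ)` on the Siegel upper half space. -/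
def act (M : Sp2R) (Ω : SiegelUpperHalf) : SiegelUpperHalf :=
  ⟨numer M Ω * (denom M Ω)⁻¹, smul_mem M Ω⟩

/-- The weight `k` slash action, `(f|ₖM)(Ω) = det(CΩ + D)⁻ᵏ f((AΩ + B)(CΩ + D)⁻¹)`. -/
def slash (k : ℤ) (f : SiegelUpperHalf → ℂ) (M : Sp2R) (Ω : SiegelUpperHalf) : ℂ :=
  (denom M Ω).det ^ (-k) * f (act M Ω)

theorem slash_add (k : ℤ) (f g : SiegelUpperHalf → ℂ) (M : Sp2R) :
    slash k (f + g) M = slash k f M + slash k g M := by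
  funext Ω; simp [slash, mul_add]

theorem slash_smul (k : ℤ) (c : ℂ) (f : SiegelUpperHalf → ℂ) (M : Sp2R) :
    slash k (c • f) M = c • slash k f M := by
  funext Ω; simp [slash, mul_left_comm]

theorem slash_zero (k : ℤ) (M : Sp2R) : slash k 0 M = 0 := by
  funext Ω; simp [slash]

/-- The symplectic matrices whose `(i, j)` entry is an integer multiple of `P i j`. -/
def matricesOfShape (P : Matrix (Fin 4) (Fin 4) ℝ) : Set Sp2R :=
  {M | ∀ i j, ∃ a : ℤ, M.1 i j = a * P (finSumFinEquiv i) (finSumFinEquiv j)}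

/-- `Sp₂(ℤ)`. -/
def Sp2Z : Set Sp2R :=
  matricesOfShape !![1, 1, 1, 1; 1, 1, 1, 1; 1, 1, 1, 1; 1, 1, 1, 1]

/-- The paramodular group `K(N)` (for `N ≥ 1`). -/
def paramodularGroup (N : ℕ) : Set Sp2R :=
  matricesOfShape !![1, (N : ℝ), 1, 1;
                     1, 1, 1, 1 / (N : ℝ);
                     1, (N : ℝ), 1, 1;
                     (N : ℝ), (N : ℝ), (N : ℝ), 1]

/-- The Jacobi group `Γ^J`. -/
def jacobiGroup : Set Sp2R :=
  matricesOfShape !![1, 0, 1, 1; 1, 1, 1, 1; 1, 0, 1, 1; 0, 0, 0, 1]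

/-- The Fricke matrix `F_N = N^(-1/2) (0 1; -N 0)`. -/
def frickeF (N : ℕ) : Matrix (Fin 2) (Fin 2) ℝ :=
  (Real.sqrt N)⁻¹ • !![0, 1; -(N : ℝ), 0]

/-- The normalizer `μ_N = (-F_N' 0; 0 F_N)` of `K(N)`. -/
def mu (N : ℕ) [NeZero N] : Sp2R :=
  ⟨Matrix.fromBlocks (-(frickeF N)ᵀ) 0 0 (frickeF N), by
    rw [SymplecticGroup.fromBlocks_mem_iff]
    refine ⟨by simp, by simp, ?_⟩
    have h0 : (N : ℝ) ≠ 0 := Nat.cast_ne_zero.2 (NeZero.ne N)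
    have h1 : (Real.sqrt N)⁻¹ * (N : ℝ) * (Real.sqrt N)⁻¹ = 1 := by
      rw [mul_right_comm, ← mul_inv, Real.mul_self_sqrt (Nat.cast_nonneg N), inv_mul_cancel₀ h0]
    have h2 : (Real.sqrt N)⁻¹ * (Real.sqrt N)⁻¹ * (N : ℝ) = 1 := by
      rw [mul_right_comm, h1]
    ext i j
    fin_cases i <;> fin_cases j <;> simp [frickeF, ← mul_assoc, h1, h2]⟩

/-- Holomorphy on the Siegel upper half space, in the coordinates `Ω = (τ z; z ω)`. -/
def IsHolomorphic (f : SiegelUpperHalf → ℂ) : Prop :=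
  ∃ F : ℂ × ℂ × ℂ → ℂ,
    DifferentiableOn ℂ F {v | (!![v.1.im, v.2.1.im; v.2.1.im, v.2.2.im]).PosDef} ∧
    ∀ Ω : SiegelUpperHalf, f Ω = F (Ω.1 0 0, Ω.1 0 1, Ω.1 1 1)

/-- `M_k(K(N))`: the paramodular forms of degree two, weight `k` and level `N`. -/
def paramodularForms (N : ℕ) (k : ℤ) : Submodule ℂ (SiegelUpperHalf → ℂ) where
  carrier := {f | IsHolomorphic f ∧ ∀ σ ∈ paramodularGroup N, slash k f σ = f}
  add_mem' := by
    rintro f g ⟨⟨F, hF, hf⟩, hfs⟩ ⟨⟨G, hG, hg⟩, hgs⟩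
    refine ⟨⟨F + G, hF.add hG, fun Ω => by simp [hf, hg]⟩, fun σ hσ => ?_⟩
    rw [slash_add, hfs σ hσ, hgs σ hσ]
  zero_mem' := ⟨⟨0, differentiableOn_const 0, fun _ => rfl⟩, fun σ _ => slash_zero k σ⟩
  smul_mem' := by
    rintro c f ⟨⟨F, hF, hf⟩, hfs⟩
    refine ⟨⟨c • F, hF.const_smul c, fun Ω => by simp [hf]⟩, fun σ hσ => ?_⟩
    rw [slash_smul, hfs σ hσ]

/-- The diagonal matrix `(τ₁ 0; 0 τ₂)` as a point of the Siegel upper half space. -/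
def diagPoint (τ₁ τ₂ : ℍ) : SiegelUpperHalf :=
  ⟨Matrix.diagonal ![(τ₁ : ℂ), (τ₂ : ℂ)], by simp, by
    have : (Matrix.diagonal ![(τ₁ : ℂ), (τ₂ : ℂ)]).map Complex.im =
        Matrix.diagonal ![τ₁.im, τ₂.im] := by
      ext i j; fin_cases i <;> fin_cases j <;> simp
    rw [this, Matrix.posDef_diagonal_iff]
    intro i; fin_cases i
    · exact τ₁.im_pos
    · exact τ₂.im_pos⟩

/-- The point `iλ` of the upper half plane, for `λ > 0`. -/
def imagPoint (t : Set.Ioi (0 : ℝ)) : ℍ := ⟨Complex.I * (t : ℝ), by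
    have := t.2
    simpa using Set.mem_Ioi.1 this⟩

/-- `Φ(f) = 0`, where `(Φf)(τ) = lim_{λ → +∞} f (iλ 0; 0 τ)`. -/
def SiegelPhiVanishes (f : SiegelUpperHalf → ℂ) : Prop :=
  ∀ τ : ℍ, Filter.Tendsto (fun t : Set.Ioi (0 : ℝ) => f (diagPoint (imagPoint t) τ))
    Filter.atTop (nhds 0)

/-- `S_k(K(N))`: the paramodular cusp forms. -/
def paramodularCuspForms (N : ℕ) (k : ℤ) : Submodule ℂ (SiegelUpperHalf → ℂ) where
  carrier := {f | f ∈ paramodularForms N k ∧ ∀ σ ∈ Sp2Z, SiegelPhiVanishes (slash k f σ)}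
  add_mem' := by
    rintro f g ⟨hf, hf0⟩ ⟨hg, hg0⟩
    refine ⟨add_mem hf hg, fun σ hσ τ => ?_⟩
    rw [slash_add]
    simpa using (hf0 σ hσ τ).add (hg0 σ hσ τ)
  zero_mem' := ⟨zero_mem _, fun σ _ τ => by rw [slash_zero]; exact tendsto_const_nhds⟩
  smul_mem' := by
    rintro c f ⟨hf, hf0⟩
    refine ⟨Submodule.smul_mem _ c hf, fun σ hσ τ => ?_⟩
    rw [slash_smul]
    simpa using (hf0 σ hσ τ).const_mul c

/-- `S_k(K(N))^ε = {f ∈ S_k(K(N)) : f|ₖμ_N = ε f}`, for `ε ∈ {1, -1}`. -/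
def paramodularCuspEigenspace (N : ℕ) [NeZero N] (k : ℤ) (ε : ℤˣ) :
    Submodule ℂ (SiegelUpperHalf → ℂ) where
  carrier := {f | f ∈ paramodularCuspForms N k ∧ slash k f (mu N) = ((ε : ℤ) : ℂ) • f}
  add_mem' := by
    rintro f g ⟨hf, hf0⟩ ⟨hg, hg0⟩
    refine ⟨add_mem hf hg, ?_⟩
    rw [slash_add, hf0, hg0, smul_add]
  zero_mem' := ⟨zero_mem _, by rw [slash_zero, smul_zero]⟩
  smul_mem' := by
    rintro c f ⟨hf, hf0⟩
    refine ⟨Submodule.smul_mem _ c hf, ?_⟩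
    rw [slash_smul, hf0, smul_comm]

/-- The entry `τ` of `Ω = (τ z; z ω)`. -/
def tau (Ω : SiegelUpperHalf) : ℍ := ⟨Ω.1 0 0, by simpa using Ω.2.2.diag_pos (i := 0)⟩

/-- The function `φ̃(τ z; z ω) = φ(τ, z) e(mω)` on the Siegel upper half space. -/
def tilde (m : ℕ) (φ : ℍ × ℂ → ℂ) (Ω : SiegelUpperHalf) : ℂ :=
  φ (tau Ω, Ω.1 0 1) * e (m * Ω.1 1 1)

/-- `J_{k,m}^cusp`: the Jacobi cusp forms of weight `k` and index `m`. -/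
def jacobiCuspForms (k : ℤ) (m : ℕ) : Submodule ℂ (ℍ × ℂ → ℂ) where
  carrier := {φ |
    (∃ F : ℂ × ℂ → ℂ, DifferentiableOn ℂ F {q | 0 < q.1.im} ∧
      ∀ (τ : ℍ) (z : ℂ), φ (τ, z) = F (τ, z)) ∧
    (∀ σ ∈ jacobiGroup, slash k (tilde m φ) σ = tilde m φ) ∧
    ∃ c : ℤ × ℤ → ℂ,
      (∀ n r : ℤ, c (n, r) ≠ 0 → 0 ≤ n ∧ r ^ 2 < 4 * m * n) ∧
      ∀ (τ : ℍ) (z : ℂ), HasSum (fun x : ℤ × ℤ => c x * e (x.1 * τ + x.2 * z)) (φ (τ, z))}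
  add_mem' := by
    rintro φ ψ ⟨⟨F, hF, hφ⟩, hφs, c, hc, hcs⟩ ⟨⟨G, hG, hψ⟩, hψs, d, hd, hds⟩
    refine ⟨⟨F + G, hF.add hG, fun τ z => by simp [hφ, hψ]⟩, fun σ hσ => ?_,
      c + d, fun n r h => ?_, fun τ z => ?_⟩
    · have : tilde m (φ + ψ) = tilde m φ + tilde m ψ := by funext Ω; simp [tilde, add_mul]
      rw [this, slash_add, hφs σ hσ, hψs σ hσ]
    · by_cases h1 : c (n, r) = 0
      · exact hd n r fun h2 => h (by simp [h1, h2])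
      · exact hc n r h1
    · simpa [add_mul] using (hcs τ z).add (hds τ z)
  zero_mem' := by
    refine ⟨⟨0, differentiableOn_const 0, fun _ _ => rfl⟩, fun σ _ => ?_, 0,
      fun _ _ h => absurd rfl h, fun _ _ => by simp [hasSum_zero]⟩
    have : tilde m 0 = 0 := by funext Ω; simp [tilde]
    rw [this, slash_zero]
  smul_mem' := by
    rintro a φ ⟨⟨F, hF, hφ⟩, hφs, c, hc, hcs⟩
    refine ⟨⟨a • F, hF.const_smul a, fun τ z => by simp [hφ]⟩, fun σ hσ => ?_,
      a • c, fun n r h => hc n r fun h1 => h (by simp [h1]), fun τ z => ?_⟩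
    · have : tilde m (a • φ) = a • tilde m φ := by funext Ω; simp [tilde, mul_assoc]
      rw [this, slash_smul, hφs σ hσ]
    · simpa [mul_assoc] using (hcs τ z).mul_left a

/-- `f(τ z; z ω) = ∑_{j ≥ 0} φ_j(τ, z) e(Njω)`: the functions `φ_j` are the Fourier-Jacobi
coefficients of `f` of index `Nj`. -/
def HasFourierJacobiExpansion (N : ℕ) (f : SiegelUpperHalf → ℂ) (φ : ℕ → ℍ × ℂ → ℂ) : Prop :=
  ∀ Ω : SiegelUpperHalf, HasSum (fun j : ℕ => tilde (N * j) (φ j) Ω) (f Ω)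

end Paramodular

end

noncomputable section

namespace Paramodular

/-! ### Fourier series of periodic holomorphic functions on a strip -/

section

open Complex Set Filter Topology

/-! Write Y for the imaginary part of Ω. The form f has an absolutely convergent Fourier series
indexed by binary quadratic forms T = (n, r, M). Invariance under the Levi maps Ω ↦ UΩU' makes the
support semidefinite (the Koecher principle), and the cusp condition makes it definite
(`IsParamodularCusp.coeff_posDef`). The period 1/p in ω leaves only indices M divisible by p, so
grouping terms by M yields the Fourier–Jacobi expansion. Its coefficients inherit invariance under
the Jacobi group because that group commutes with real translations of ω
(`HasFourierJacobiExpansion.slash_tilde`). Uniqueness of Fourier series gives uniqueness of the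
expansion and its linearity in f.

Injectivity is a Sturm-type argument with the function |f|² det(Y)^k. It is invariant under the
paramodular maps used and under the Fricke involution, the sign ε being lost in the absolute value.
It is bounded (`IsParamodularCusp.exists_petersson_le`); let S be its supremum. The height w =
det(Y) / Im τ is the distance from Im ω to the boundary of the domain with τ and z fixed. If the
coefficients of index below c vanish, f / e(cω) is holomorphic in e(ω), and the maximum principle
(`IsParamodularCusp.exists_norm_mul_exp_le`) says that lowering Im ω by λw gains a factor e^{2πcλw}
in |f|, at the price of a factor 1 - λ in det(Y). So a point of height w has value at most S
e^{-4πcλw} (1 - λ)^{-k}. If every orbit reaches height c₀ and 4πc c₀ > k, a suitable λ gives S ≤ κS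
with κ < 1, hence f = 0.

The arithmetic input is `IsInvariant.exists_heightBound_le`, which gives c₀ = `heightBound p` / p.
With z = uτ + s, an integer vector (c, d, e), (c, d) ≠ 0, at which the ternary form p(e - du + cs)²
+ pw|cτ + d|² / Im τ is at most 0.99 leads to an orbit point of height at least w / 0.99. Such a
vector exists while pw < `heightBound p`: by Minkowski's theorem for p ≥ 5, by explicit vectors for
p = 2 and 3. Taking c = p(J + 1), the condition 4πc c₀ > k follows from k(p² + 1) < 10(p + 1)(J +
1), which is what the floor hypothesis provides. -/

theorem e_add (z w : ℂ) : e (z + w) = e z * e w := by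
  simp only [e, mul_add, Complex.exp_add]

theorem e_zero : e 0 = 1 := by simp [e]

theorem e_ne_zero (z : ℂ) : e z ≠ 0 := Complex.exp_ne_zero _

theorem norm_e (z : ℂ) : ‖e z‖ = Real.exp (-(2 * Real.pi * z.im)) := by
  rw [e, Complex.norm_exp]
  congr 1
  simp

theorem e_intCast (n : ℤ) : e n = 1 := by
  rw [e, Complex.exp_eq_one_iff]
  exact ⟨n, by ring⟩

theorem e_int_mul_add_one (n : ℤ) (z : ℂ) : e (n * (z + 1)) = e (n * z) := by
  rw [mul_add, mul_one, e_add, e_intCast, mul_one]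

theorem differentiable_e : Differentiable ℂ e := by
  unfold e; fun_prop

theorem e_nat_mul (n : ℕ) (z : ℂ) : e (n * z) = e z ^ n := by
  rw [e, e, ← Complex.exp_nat_mul]; congr 1; ring

/-- The Fourier coefficient `∫₀¹ g(x + iy) e(-n(x + iy)) dx`. -/
def stripCoeff (g : ℂ → ℂ) (n : ℤ) (y : ℝ) : ℂ :=
  ∫ x in (0 : ℝ)..1, g (x + y * I) * e (-(n * (x + y * I)))

theorem norm_stripCoeff_le (g : ℂ → ℂ) (n : ℤ) (y C : ℝ) (hC : ∀ x : ℝ, ‖g (x + y * I)‖ ≤ C) :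
    ‖stripCoeff g n y‖ ≤ C * Real.exp (2 * Real.pi * (n * y)) := by
  have := intervalIntegral.norm_integral_le_of_norm_le_const
    (f := fun x : ℝ => g (x + y * I) * e (-(n * (x + y * I)))) (a := 0) (b := 1)
    (C := C * Real.exp (2 * Real.pi * (n * y))) (fun x _ => by
      rw [norm_mul, norm_e]
      have : (-((n : ℂ) * (x + y * I))).im = -(n * y) := by simp
      rw [this, mul_neg, neg_neg]
      exact mul_le_mul_of_nonneg_right (hC x) (Real.exp_nonneg _))
  simpa [stripCoeff] using this

/-- Cauchy's theorem on a rectangle of width one: the integrand has period one, so the two vertical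
sides cancel. -/
theorem stripCoeff_eq (g : ℂ → ℂ) (hper : ∀ ζ, g (ζ + 1) = g ζ) (n : ℤ) (y₁ y₂ : ℝ)
    (hg : ∀ ζ : ℂ, ζ.im ∈ uIcc y₁ y₂ → DifferentiableAt ℂ g ζ) :
    stripCoeff g n y₁ = stripCoeff g n y₂ := by
  set f : ℂ → ℂ := fun ζ => g ζ * e (-(n * ζ)) with hf
  have hfper : ∀ ζ, f (ζ + 1) = f ζ := fun ζ => by
    simp only [hf, hper]
    have : -((n : ℂ) * (ζ + 1)) = ((-n : ℤ) : ℂ) * (ζ + 1) := by push_cast; ring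
    rw [this, e_int_mul_add_one]
    congr 2
    push_cast; ring
  have hd : DifferentiableOn ℂ f (uIcc (y₁ * I : ℂ).re (1 + y₂ * I : ℂ).re ×ℂ
      uIcc (y₁ * I : ℂ).im (1 + y₂ * I : ℂ).im) := by
    intro ζ hζ
    have h2 : ζ.im ∈ uIcc y₁ y₂ := by simpa using hζ.2
    refine ((hg ζ h2).mul ?_).differentiableWithinAt
    exact (differentiable_e _).comp ζ (by fun_prop)
  have h := integral_boundary_rect_eq_zero_of_differentiableOn f _ _ hd
  simp only [mul_re, ofReal_re, I_re, mul_zero, ofReal_im, I_im, mul_one, sub_self, add_re, one_re,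
    add_zero, mul_im, zero_add, add_im, one_im, ofReal_one, ofReal_zero] at h
  have h1 : ∀ y : ℝ, f (1 + y * I) = f (y * I) := fun y => by rw [add_comm, hfper]
  simp only [h1, add_sub_cancel_right] at h
  exact sub_eq_zero.1 h

theorem summable_exp_neg_abs {δ : ℝ} (hδ : 0 < δ) :
    Summable fun n : ℤ => Real.exp (-(δ * |(n : ℝ)|)) := by
  have h : Summable fun n : ℕ => Real.exp (-(δ * n)) := by
    have := summable_geometric_of_lt_one (Real.exp_nonneg (-δ)) (by simpa using hδ)
    refine this.congr fun n => ?_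
    rw [← Real.exp_nat_mul]; congr 1; ring
  refine Summable.of_nat_of_neg ?_ ?_
  · exact h.congr fun n => by simp
  · exact h.congr fun n => by simp

theorem stripCoeff_eq_fourierCoeff (g : ℂ → ℂ) (G : C(UnitAddCircle, ℂ)) (y : ℝ)
    (hG : ∀ x : ℝ, G x = g (x + y * I)) (n : ℤ) :
    stripCoeff g n y = fourierCoeff G n * e (-(n * (y * I))) := by
  rw [fourierCoeff_eq_intervalIntegral (T := 1) G n 0, stripCoeff]
  simp only [zero_add, div_one, one_smul, smul_eq_mul]
  rw [← intervalIntegral.integral_mul_const]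
  refine intervalIntegral.integral_congr fun x _ => ?_
  simp only [hG, mul_add, neg_add, e_add, fourier_coe_apply]
  have : e (-(n * (x : ℂ))) = Complex.exp (2 * Real.pi * I * ((-n : ℤ) : ℂ) * x / (1 : ℝ)) := by
    rw [e]; congr 1; push_cast; ring
  rw [this]
  ring

/-- Shifting the contour by δ, down for n ≥ 0 and up for n ≤ 0, gains e^{-2πδ|n|}. The Fourier
coefficients are therefore summable, which gives pointwise convergence. -/
theorem hasSum_stripCoeff (g : ℂ → ℂ) (hper : ∀ ζ, g (ζ + 1) = g ζ) (ζ : ℂ) (δ : ℝ) (hδ : 0 < δ)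
    (hg : ∀ w : ℂ, |w.im - ζ.im| ≤ δ → DifferentiableAt ℂ g w) :
    HasSum (fun n : ℤ => stripCoeff g n ζ.im * e (n * ζ)) (g ζ) := by
  have hcont : ∀ y : ℝ, |y - ζ.im| ≤ δ → Continuous fun x : ℝ => g (x + y * I) := by
    intro y hy
    refine continuous_iff_continuousAt.2 fun x => ?_
    have := (hg (x + y * I) (by simpa using hy)).continuousAt
    exact ContinuousAt.comp (f := fun x : ℝ => (x + y * I : ℂ)) this (by fun_prop)
  have hperR : ∀ y : ℝ, Function.Periodic (fun x : ℝ => g (x + y * I)) 1 := by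
    intro y x
    show g (((x + 1 : ℝ) : ℂ) + y * I) = g (x + y * I)
    rw [← hper (x + y * I)]
    congr 1; push_cast; ring
  have hb : ∀ y : ℝ, |y - ζ.im| ≤ δ → ∃ C, ∀ x : ℝ, ‖g (x + y * I)‖ ≤ C := by
    intro y hy
    obtain ⟨C, hC⟩ := (isCompact_Icc (a := (0 : ℝ)) (b := 1)).exists_bound_of_continuousOn
      (hcont y hy).continuousOn
    refine ⟨C, fun x => ?_⟩
    obtain ⟨x', hx', hxx⟩ := (hperR y).exists_mem_Ico₀ one_pos x
    exact hxx ▸ hC x' ⟨hx'.1, hx'.2.le⟩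
  obtain ⟨C₁, hC₁⟩ := hb (ζ.im - δ) (by simp [abs_of_pos hδ])
  obtain ⟨C₂, hC₂⟩ := hb (ζ.im + δ) (by simp [abs_of_pos hδ])
  have key : ∀ n : ℤ, ‖stripCoeff g n ζ.im * e (n * ζ)‖ ≤
      max C₁ C₂ * Real.exp (-(2 * Real.pi * δ * |(n : ℝ)|)) := by
    intro n
    rw [norm_mul, norm_e]
    have him : ((n : ℂ) * ζ).im = n * ζ.im := by simp
    rw [him]
    have aux : ∀ (s C : ℝ), (|s| = δ) → (n * s = -(δ * |(n : ℝ)|)) →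
        (∀ x : ℝ, ‖g (x + (ζ.im + s : ℝ) * I)‖ ≤ C) → C ≤ max C₁ C₂ →
        ‖stripCoeff g n ζ.im‖ * Real.exp (-(2 * Real.pi * (n * ζ.im))) ≤
        max C₁ C₂ * Real.exp (-(2 * Real.pi * δ * |(n : ℝ)|)) := by
      intro s C hs hns hC hCm
      rw [stripCoeff_eq g hper n ζ.im (ζ.im + s) ?_]
      · have := norm_stripCoeff_le g n (ζ.im + s) C hC
        calc _ ≤ C * Real.exp (2 * Real.pi * (n * (ζ.im + s))) *
              Real.exp (-(2 * Real.pi * (n * ζ.im))) :=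
              mul_le_mul_of_nonneg_right this (Real.exp_nonneg _)
          _ = C * Real.exp (-(2 * Real.pi * δ * |(n : ℝ)|)) := by
              rw [mul_assoc, ← Real.exp_add]; congr 2; linear_combination 2 * Real.pi * hns
          _ ≤ _ := mul_le_mul_of_nonneg_right hCm (Real.exp_nonneg _)
      · intro w hw
        apply hg
        rw [← hs]
        simpa using abs_sub_left_of_mem_uIcc hw
    rcases le_total 0 n with hn | hn
    · refine aux (-δ) C₁ (by simp [abs_of_pos hδ]) ?_ ?_ (le_max_left _ _)
      · rw [abs_of_nonneg (by exact_mod_cast hn)]; ring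
      · simpa [sub_eq_add_neg] using hC₁
    · refine aux δ C₂ (by simp [abs_of_pos hδ]) ?_ ?_ (le_max_right _ _)
      · rw [abs_of_nonpos (by exact_mod_cast hn)]; ring
      · simpa using hC₂
  let G : C(UnitAddCircle, ℂ) :=
    ⟨(hperR ζ.im).lift, continuous_coinduced_dom.2 (hcont ζ.im (by simpa using hδ.le))⟩
  have hG : ∀ x : ℝ, G x = g (x + ζ.im * I) := fun x => (hperR ζ.im).lift_coe x
  have hre : ∀ n : ℤ, stripCoeff g n ζ.im * e (n * ζ) = fourierCoeff G n * fourier n (ζ.re : UnitAddCircle) := by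
    intro n
    have h1 : -((n : ℂ) * (ζ.im * I)) + n * ζ = n * ζ.re := by
      conv_lhs => enter [2]; rw [← re_add_im ζ]
      ring
    rw [stripCoeff_eq_fourierCoeff g G ζ.im hG, mul_assoc, ← e_add, fourier_coe_apply, h1, e]
    congr 2
    push_cast
    ring
  have hsum : Summable (fourierCoeff G) := by
    refine Summable.of_norm ?_
    have h0 : Summable fun n : ℤ => ‖stripCoeff g n ζ.im * e (n * ζ)‖ :=
      Summable.of_nonneg_of_le (fun _ => norm_nonneg _) key
        ((summable_exp_neg_abs (by positivity)).mul_left _)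
    refine h0.congr fun n => ?_
    rw [hre, norm_mul, fourier_apply, Circle.norm_coe, mul_one]
  have := has_pointwise_sum_fourier_series_of_summable hsum (ζ.re : UnitAddCircle)
  rw [hG, re_add_im] at this
  refine this.congr_fun fun n => ?_
  rw [hre, smul_eq_mul]

/-- Cauchy's estimate for the Fréchet derivative. -/
theorem norm_fderiv_le_of_ball {E : Type*} [NormedAddCommGroup E] [NormedSpace ℂ E]
    {F : E → ℂ} {v : E} {r C : ℝ} (hr : 0 < r) (hF : ∀ w ∈ Metric.closedBall v r, DifferentiableAt ℂ F w)
    (hC : ∀ w ∈ Metric.closedBall v r, ‖F w‖ ≤ C) : ‖fderiv ℂ F v‖ ≤ C / r := by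
  have hC0 : 0 ≤ C := (norm_nonneg _).trans (hC v (by simp [hr.le]))
  refine ContinuousLinearMap.opNorm_le_bound _ (by positivity) fun w => ?_
  rcases eq_or_ne w 0 with rfl | hw
  · simp
  have hw' : 0 < ‖w‖ := norm_pos_iff.2 hw
  have hmem : ∀ t ∈ Metric.closedBall (0 : ℂ) (r / ‖w‖), v + t • w ∈ Metric.closedBall v r := by
    intro t ht
    rw [mem_closedBall_zero_iff, le_div_iff₀ hw'] at ht
    simpa [norm_smul] using ht
  have hd : ∀ t ∈ Metric.closedBall (0 : ℂ) (r / ‖w‖),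
      DifferentiableAt ℂ (fun t : ℂ => F (v + t • w)) t := fun t ht =>
    DifferentiableAt.comp (f := fun t : ℂ => v + t • w) t (hF _ (hmem t ht)) (by fun_prop)
  have h := norm_deriv_le_of_forall_mem_sphere_norm_le (f := fun t : ℂ => F (v + t • w)) (c := 0)
    (R := r / ‖w‖) (C := C) (by positivity)
    (DifferentiableOn.diffContOnCl (by
      rw [closure_ball _ (by positivity)]
      exact fun t ht => (hd t ht).differentiableWithinAt))
    (fun t ht => hC _ (hmem t (Metric.sphere_subset_closedBall ht)))
  have h2 : HasDerivAt (fun t : ℂ => F (v + t • w)) (fderiv ℂ F v w) 0 := by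
    have h3 : HasFDerivAt F (fderiv ℂ F v) (v + (0 : ℂ) • w) := by
      simpa using (hF v (by simp [hr.le])).hasFDerivAt
    have h4 : HasDerivAt (fun t : ℂ => v + t • w) w 0 := by
      simpa using ((hasDerivAt_id (0 : ℂ)).smul_const w).const_add v
    exact h3.comp_hasDerivAt 0 h4
  rw [h2.deriv] at h
  rwa [div_div_eq_mul_div, mul_div_right_comm] at h

/-- Differentiation under the integral sign: F is bounded on a compact thickening of the segment,
and Cauchy's estimate on balls of half the radius turns this into a uniform bound for the
derivative. -/
theorem differentiableAt_integral_segment {E : Type*} [NormedAddCommGroup E] [NormedSpace ℂ E]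
    [FiniteDimensional ℂ E] [MeasurableSpace E] [BorelSpace E]
    {F : E × ℂ → ℂ} {V : Set (E × ℂ)} (hV : IsOpen V) (hF : DifferentiableOn ℂ F V) (e₀ : E) (y : ℝ)
    (hmem : ∀ x : ℝ, (e₀, (x + y * I : ℂ)) ∈ V) :
    DifferentiableAt ℂ (fun p : E => ∫ x in (0 : ℝ)..1, F (p, x + y * I)) e₀ := by
  have : ProperSpace E := FiniteDimensional.proper ℂ E
  set K : Set (E × ℂ) := (fun x : ℝ => (e₀, (x + y * I : ℂ))) '' Icc 0 1 with hK
  have hKc : IsCompact K := isCompact_Icc.image (by fun_prop)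
  obtain ⟨δ, hδ, hδV⟩ := hKc.exists_cthickening_subset_open hV (by
    rintro _ ⟨x, -, rfl⟩; exact hmem x)
  obtain ⟨C, hC⟩ := (hKc.cthickening (r := δ)).exists_bound_of_continuousOn
    (hF.continuousOn.mono hδV)
  have hin : ∀ p ∈ Metric.ball e₀ (δ / 2), ∀ x ∈ Icc (0 : ℝ) 1,
      Metric.closedBall (p, (x + y * I : ℂ)) (δ / 2) ⊆ Metric.cthickening δ K := by
    intro p hp x hx w hw
    refine Metric.mem_cthickening_of_dist_le w (e₀, (x + y * I : ℂ)) δ K ⟨x, hx, rfl⟩ ?_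
    have h1 : dist (p, (x + y * I : ℂ)) (e₀, (x + y * I : ℂ)) < δ / 2 := by
      rw [dist_prod_same_right]; exact hp
    have := dist_triangle w (p, (x + y * I : ℂ)) (e₀, (x + y * I : ℂ))
    rw [Metric.mem_closedBall] at hw
    linarith
  have hdiff : ∀ w ∈ Metric.cthickening δ K, DifferentiableAt ℂ F w := fun w hw =>
    (hF w (hδV hw)).differentiableAt (hV.mem_nhds (hδV hw))
  have hself : ∀ w : E × ℂ, w ∈ Metric.closedBall w (δ / 2) := fun w =>
    Metric.mem_closedBall_self (by positivity)
  have hcont : ∀ p ∈ Metric.ball e₀ (δ / 2), ContinuousOn (fun x : ℝ => F (p, x + y * I)) (Icc 0 1) := by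
    intro p hp x hx
    refine ContinuousAt.continuousWithinAt ?_
    exact ContinuousAt.comp (f := fun x : ℝ => (p, (x + y * I : ℂ)))
      (hdiff _ (hin p hp x hx (hself _))).continuousAt (by fun_prop)
  have h01 : uIoc (0 : ℝ) 1 = Ioc 0 1 := uIoc_of_le zero_le_one
  have he₀ : e₀ ∈ Metric.ball e₀ (δ / 2) := Metric.mem_ball_self (by positivity)
  have hnb : Metric.ball e₀ (δ / 2) ∈ 𝓝 e₀ := Metric.ball_mem_nhds _ (by positivity)
  let F' : E → ℝ → E →L[ℂ] ℂ := fun p x =>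
    (fderiv ℂ F (p, (x + y * I : ℂ))).comp (ContinuousLinearMap.inl ℂ E ℂ)
  refine (intervalIntegral.hasFDerivAt_integral_of_dominated_of_fderiv_le (𝕜 := ℂ)
    (F := fun p (x : ℝ) => F (p, x + y * I)) (F' := F') (bound := fun _ => C / (δ / 2)) hnb ?_ ?_ ?_ ?_ ?_
    ?_).differentiableAt
  · filter_upwards [hnb] with p hp
    rw [h01]
    exact ((hcont p hp).mono Ioc_subset_Icc_self).aestronglyMeasurable measurableSet_Ioc
  · exact ContinuousOn.intervalIntegrable (by rw [uIcc_of_le zero_le_one]; exact hcont e₀ he₀)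
  · have : Measurable fun x : ℝ => F' e₀ x := by
      have h1 : Measurable (fderiv ℂ F) := measurable_fderiv ℂ F
      have h2 : Measurable fun x : ℝ => fderiv ℂ F (e₀, (x + y * I : ℂ)) :=
        h1.comp (Continuous.measurable (by fun_prop))
      exact ((ContinuousLinearMap.compL ℂ E (E × ℂ) ℂ).flip
        (ContinuousLinearMap.inl ℂ E ℂ)).continuous.measurable.comp h2
    exact this.aestronglyMeasurable
  · refine Eventually.of_forall fun x hx p hp => ?_
    rw [h01] at hx
    have hx' := Ioc_subset_Icc_self hx
    refine (ContinuousLinearMap.opNorm_comp_le _ _).trans ?_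
    have h1 := norm_fderiv_le_of_ball (F := F) (v := (p, (x + y * I : ℂ))) (r := δ / 2) (C := C)
      (by positivity) (fun w hw => hdiff w (hin p hp x hx' hw))
      (fun w hw => hC w (hin p hp x hx' hw))
    refine (mul_le_of_le_one_right (norm_nonneg _) ?_).trans h1
    exact ContinuousLinearMap.opNorm_le_bound _ zero_le_one fun w => by simp [Prod.norm_def]
  · exact intervalIntegrable_const
  · refine Eventually.of_forall fun x hx p hp => ?_
    rw [h01] at hx
    have h1 := (hdiff _ (hin p hp x (Ioc_subset_Icc_self hx) (hself _))).hasFDerivAt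
    exact h1.comp p (hasFDerivAt_prodMk_left p (x + y * I : ℂ))

end

/-! ### Fourier expansion on the Siegel upper half space -/

section

open Complex Set Filter Topology

/-- The Siegel upper half space of degree two in the coordinates `(τ, z, ω)`. -/
def siegelDomain : Set (ℂ × ℂ × ℂ) :=
  {v | 0 < v.1.im ∧ v.2.1.im ^ 2 < v.1.im * v.2.2.im}

theorem mem_siegelDomain {τ z ω : ℂ} :
    (τ, z, ω) ∈ siegelDomain ↔ 0 < τ.im ∧ z.im ^ 2 < τ.im * ω.im := Iff.rfl

theorem isOpen_siegelDomain : IsOpen siegelDomain := by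
  refine IsOpen.inter (s := {v : ℂ × ℂ × ℂ | 0 < v.1.im})
    (t := {v : ℂ × ℂ × ℂ | v.2.1.im ^ 2 < v.1.im * v.2.2.im}) ?_ ?_
  · exact isOpen_lt continuous_const (by fun_prop)
  · exact isOpen_lt (by fun_prop) (by fun_prop)

theorem im_pos_of_mem {τ z ω : ℂ} (h : (τ, z, ω) ∈ siegelDomain) : 0 < ω.im := by
  obtain ⟨h1, h2⟩ := h
  simp only at h1 h2
  by_contra h3
  nlinarith [sq_nonneg z.im]

/-- Holomorphic functions on the Siegel upper half space with period one in each variable. -/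
structure IsPeriodicHolomorphic (F : ℂ × ℂ × ℂ → ℂ) : Prop where
  diff : DifferentiableOn ℂ F siegelDomain
  per₁ : ∀ τ z ω, F (τ + 1, z, ω) = F (τ, z, ω)
  per₂ : ∀ τ z ω, F (τ, z + 1, ω) = F (τ, z, ω)
  per₃ : ∀ τ z ω, F (τ, z, ω + 1) = F (τ, z, ω)

/-- The Fourier-Jacobi coefficient of index `M`. -/
def jacobiCoeff (F : ℂ × ℂ × ℂ → ℂ) (M : ℤ) (q : ℂ × ℂ) : ℂ :=
  stripCoeff (fun ω => F (q.1, q.2, ω)) M (q.2.im ^ 2 / q.1.im + 1)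

/-- The Fourier coefficient in `τ, z, ω` as a function of `τ`. -/
def thetaCoeff (F : ℂ × ℂ × ℂ → ℂ) (r M : ℤ) (τ : ℂ) : ℂ :=
  stripCoeff (fun z => jacobiCoeff F M (τ, z)) r 0

/-- The Fourier coefficient of `e(nτ + rz + Mω)`. -/
def coeff (F : ℂ × ℂ × ℂ → ℂ) (n r M : ℤ) : ℂ :=
  stripCoeff (thetaCoeff F r M) n 1

namespace IsPeriodicHolomorphic

variable {F : ℂ × ℂ × ℂ → ℂ}

theorem differentiableAt (hF : IsPeriodicHolomorphic F) {v : ℂ × ℂ × ℂ} (hv : v ∈ siegelDomain) :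
    DifferentiableAt ℂ F v :=
  (hF.diff v hv).differentiableAt (isOpen_siegelDomain.mem_nhds hv)

/-- The contour in `jacobiCoeff` lies one unit above the boundary Im ω = (Im z)² / Im τ, a height
that does not vary holomorphically with (τ, z). Since any admissible height gives the same value,
one height can be fixed near a given point, and holomorphy follows. -/
theorem jacobiCoeff_eq (hF : IsPeriodicHolomorphic F) (M : ℤ) {τ z : ℂ} {y : ℝ} (hτ : 0 < τ.im)
    (hy : z.im ^ 2 < τ.im * y) :
    jacobiCoeff F M (τ, z) = stripCoeff (fun ω => F (τ, z, ω)) M y := by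
  refine stripCoeff_eq _ (fun ζ => hF.per₃ τ z ζ) M _ _ fun ζ hζ => ?_
  have hmem : (τ, z, ζ) ∈ siegelDomain := by
    refine ⟨hτ, ?_⟩
    have h1 : z.im ^ 2 / τ.im < y := by rwa [div_lt_iff₀' hτ]
    have h2 : z.im ^ 2 / τ.im < ζ.im := by
      rcases mem_uIcc.1 hζ with h | h
      · linarith [h.1]
      · linarith [h.1]
    simpa using (div_lt_iff₀' hτ).1 h2
  exact DifferentiableAt.comp (f := fun ω : ℂ => (τ, z, ω)) ζ (hF.differentiableAt hmem) (by fun_prop)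

theorem differentiableAt_jacobiCoeff (hF : IsPeriodicHolomorphic F) (M : ℤ) {q : ℂ × ℂ}
    (hq : 0 < q.1.im) : DifferentiableAt ℂ (jacobiCoeff F M) q := by
  obtain ⟨τ, z⟩ := q
  simp only at hq
  set y : ℝ := z.im ^ 2 / τ.im + 1 with hy
  have hlt : z.im ^ 2 < τ.im * y := by rw [← div_lt_iff₀' hq]; linarith
  let G : (ℂ × ℂ) × ℂ → ℂ := fun w => F (w.1.1, w.1.2, w.2) * e (-(M * w.2))
  let V : Set ((ℂ × ℂ) × ℂ) := {w | (w.1.1, w.1.2, w.2) ∈ siegelDomain}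
  have hVo : IsOpen V := isOpen_siegelDomain.preimage (by fun_prop)
  have hG : DifferentiableOn ℂ G V := by
    intro w hw
    refine DifferentiableAt.differentiableWithinAt (DifferentiableAt.mul ?_ ?_)
    · exact DifferentiableAt.comp (f := fun w : (ℂ × ℂ) × ℂ => (w.1.1, w.1.2, w.2)) w
        (hF.differentiableAt hw) (by fun_prop)
    · exact (differentiable_e _).comp w (by fun_prop)
  have h := differentiableAt_integral_segment hVo hG (τ, z) y fun x => by
    simpa [V, mem_siegelDomain] using ⟨hq, hlt⟩
  refine h.congr_of_eventuallyEq ?_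
  have h1 : ∀ᶠ p : ℂ × ℂ in 𝓝 (τ, z), 0 < p.1.im :=
    (isOpen_lt continuous_const (by fun_prop)).mem_nhds hq
  have h2 : ∀ᶠ p : ℂ × ℂ in 𝓝 (τ, z), p.2.im ^ 2 < p.1.im * y :=
    (isOpen_lt (f := fun p : ℂ × ℂ => p.2.im ^ 2) (g := fun p : ℂ × ℂ => p.1.im * y)
      (by fun_prop) (by fun_prop)).mem_nhds hlt
  filter_upwards [h1, h2] with p hp1 hp2
  exact hF.jacobiCoeff_eq M (τ := p.1) (z := p.2) hp1 hp2

theorem thetaCoeff_eq (hF : IsPeriodicHolomorphic F) (r M : ℤ) {τ : ℂ} (hτ : 0 < τ.im) (y : ℝ) :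
    thetaCoeff F r M τ = stripCoeff (fun z => jacobiCoeff F M (τ, z)) r y := by
  refine stripCoeff_eq _ (fun ζ => ?_) r _ _ fun ζ _ => ?_
  · simp only [jacobiCoeff, hF.per₂, add_im, one_im, add_zero]
  · exact DifferentiableAt.comp (f := fun z : ℂ => (τ, z)) ζ
      (hF.differentiableAt_jacobiCoeff M hτ) (by fun_prop)

theorem differentiableAt_thetaCoeff (hF : IsPeriodicHolomorphic F) (r M : ℤ) {τ : ℂ}
    (hτ : 0 < τ.im) : DifferentiableAt ℂ (thetaCoeff F r M) τ := by
  let G : ℂ × ℂ → ℂ := fun w => jacobiCoeff F M w * e (-(r * w.2))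
  have hVo : IsOpen {w : ℂ × ℂ | 0 < w.1.im} := isOpen_lt continuous_const (by fun_prop)
  have hG : DifferentiableOn ℂ G {w : ℂ × ℂ | 0 < w.1.im} := by
    intro w hw
    refine DifferentiableAt.differentiableWithinAt (DifferentiableAt.mul ?_ ?_)
    · exact hF.differentiableAt_jacobiCoeff M hw
    · exact (differentiable_e _).comp w (by fun_prop)
  exact differentiableAt_integral_segment hVo hG τ 0 fun x => hτ

theorem thetaCoeff_add_one (hF : IsPeriodicHolomorphic F) (r M : ℤ) (τ : ℂ) :
    thetaCoeff F r M (τ + 1) = thetaCoeff F r M τ := by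
  simp only [thetaCoeff, jacobiCoeff, hF.per₁, add_im, one_im, add_zero]

theorem coeff_eq (hF : IsPeriodicHolomorphic F) (n r M : ℤ) {y : ℝ} (hy : 0 < y) :
    coeff F n r M = stripCoeff (thetaCoeff F r M) n y := by
  refine stripCoeff_eq _ (hF.thetaCoeff_add_one r M) n _ _ fun ζ hζ => ?_
  refine hF.differentiableAt_thetaCoeff r M ?_
  rcases mem_uIcc.1 hζ with h | h
  · linarith [h.1]
  · linarith [h.1]

/-- Three nested strip estimates, each contour moved to the prescribed height. The freedom to choose
Y = (y₁, v; v, y₂) is what yields both absolute convergence and the Koecher principle. -/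
theorem norm_coeff_le (hF : IsPeriodicHolomorphic F) (n r M : ℤ) {y₁ v y₂ C : ℝ} (hy : 0 < y₁)
    (hv : v ^ 2 < y₁ * y₂)
    (hC : ∀ x₁ x₂ x₃ : ℝ, ‖F (x₁ + y₁ * I, x₂ + v * I, x₃ + y₂ * I)‖ ≤ C) :
    ‖coeff F n r M‖ ≤ C * Real.exp (2 * Real.pi * (n * y₁ + r * v + M * y₂)) := by
  rw [hF.coeff_eq n r M hy]
  refine (norm_stripCoeff_le _ n y₁ (C * Real.exp (2 * Real.pi * (r * v + M * y₂)))
    fun x₁ => ?_).trans_eq ?_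
  · rw [hF.thetaCoeff_eq r M (by simpa using hy) v]
    refine (norm_stripCoeff_le _ r v (C * Real.exp (2 * Real.pi * (M * y₂)))
      fun x₂ => ?_).trans_eq ?_
    · rw [hF.jacobiCoeff_eq M (y := y₂) (by simpa using hy) (by simpa using hv)]
      exact norm_stripCoeff_le _ M y₂ C fun x₃ => hC x₁ x₂ x₃
    · rw [mul_assoc, ← Real.exp_add]; congr 2; ring
  · rw [mul_assoc, ← Real.exp_add]; congr 2; ring

theorem hasSum_jacobiCoeff (hF : IsPeriodicHolomorphic F) {τ z ω : ℂ}
    (h : (τ, z, ω) ∈ siegelDomain) :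
    HasSum (fun M : ℤ => jacobiCoeff F M (τ, z) * e (M * ω)) (F (τ, z, ω)) := by
  obtain ⟨h1, h2⟩ := mem_siegelDomain.1 h
  have h3 : z.im ^ 2 / τ.im < ω.im := by rwa [div_lt_iff₀' h1]
  refine (hasSum_stripCoeff (fun ω => F (τ, z, ω)) (hF.per₃ τ z) ω ((ω.im - z.im ^ 2 / τ.im) / 2)
    (by linarith) fun w hw => ?_).congr_fun fun M => ?_
  · have h4 : z.im ^ 2 / τ.im < w.im := by linarith [(abs_le.1 hw).1]
    exact DifferentiableAt.comp (f := fun ω : ℂ => (τ, z, ω)) w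
      (hF.differentiableAt ⟨h1, (div_lt_iff₀' h1).1 h4⟩) (by fun_prop)
  · rw [hF.jacobiCoeff_eq M h1 h2]

theorem hasSum_thetaCoeff (hF : IsPeriodicHolomorphic F) (M : ℤ) {τ : ℂ} (hτ : 0 < τ.im) (z : ℂ) :
    HasSum (fun r : ℤ => thetaCoeff F r M τ * e (r * z)) (jacobiCoeff F M (τ, z)) := by
  refine (hasSum_stripCoeff (fun z => jacobiCoeff F M (τ, z)) (fun ζ => ?_) z 1 one_pos
    fun w _ => ?_).congr_fun fun r => ?_
  · simp only [jacobiCoeff, hF.per₂, add_im, one_im, add_zero]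
  · exact DifferentiableAt.comp (f := fun z : ℂ => (τ, z)) w
      (hF.differentiableAt_jacobiCoeff M hτ) (by fun_prop)
  · rw [hF.thetaCoeff_eq r M hτ]

theorem hasSum_coeff (hF : IsPeriodicHolomorphic F) (r M : ℤ) {τ : ℂ} (hτ : 0 < τ.im) :
    HasSum (fun n : ℤ => coeff F n r M * e (n * τ)) (thetaCoeff F r M τ) := by
  refine (hasSum_stripCoeff (thetaCoeff F r M) (hF.thetaCoeff_add_one r M) τ (τ.im / 2)
    (by linarith) fun w hw => ?_).congr_fun fun n => ?_
  · exact hF.differentiableAt_thetaCoeff r M (by linarith [(abs_le.1 hw).1])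
  · rw [hF.coeff_eq n r M hτ]

theorem exists_bound (hF : IsPeriodicHolomorphic F) {y₁ v y₂ δ : ℝ}
    (hδ : ∀ s₁ s₂ s₃ : ℝ, |s₁| ≤ δ → |s₂| ≤ δ → |s₃| ≤ δ →
      0 < y₁ + s₁ ∧ (v + s₂) ^ 2 < (y₁ + s₁) * (y₂ + s₃)) :
    ∃ C, ∀ s₁ s₂ s₃ : ℝ, |s₁| ≤ δ → |s₂| ≤ δ → |s₃| ≤ δ → ∀ x₁ x₂ x₃ : ℝ,
      ‖F (x₁ + (y₁ + s₁ : ℝ) * I, x₂ + (v + s₂ : ℝ) * I, x₃ + (y₂ + s₃ : ℝ) * I)‖ ≤ C := by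
  let B : ℝ → Set ℂ := fun y => Icc (0 : ℝ) 1 ×ℂ Icc (y - δ) (y + δ)
  have hB : ∀ y, IsCompact (B y) := fun y => isCompact_Icc.reProdIm isCompact_Icc
  have hmem : ∀ y s x : ℝ, |s| ≤ δ → x ∈ Icc (0 : ℝ) 1 → (x + (y + s : ℝ) * I : ℂ) ∈ B y := by
    intro y s x hs hx
    rw [abs_le] at hs
    refine mem_reProdIm.2 ⟨by simpa using hx, ?_⟩
    constructor <;> simp <;> linarith
  have hsub : B y₁ ×ˢ B v ×ˢ B y₂ ⊆ siegelDomain := by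
    rintro ⟨τ, z, ω⟩ ⟨h1, h2, h3⟩
    have h1 := (mem_reProdIm.1 h1).2
    have h2 := (mem_reProdIm.1 h2).2
    have h3 := (mem_reProdIm.1 h3).2
    have := hδ (τ.im - y₁) (z.im - v) (ω.im - y₂) (abs_le.2 ⟨by linarith [h1.1], by linarith [h1.2]⟩)
      (abs_le.2 ⟨by linarith [h2.1], by linarith [h2.2]⟩)
      (abs_le.2 ⟨by linarith [h3.1], by linarith [h3.2]⟩)
    simpa [mem_siegelDomain] using this
  obtain ⟨C, hC⟩ := ((hB y₁).prod ((hB v).prod (hB y₂))).exists_bound_of_continuousOn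
    (hF.diff.continuousOn.mono hsub)
  refine ⟨C, fun s₁ s₂ s₃ hs₁ hs₂ hs₃ x₁ x₂ x₃ => ?_⟩
  have red : ∀ (G : ℝ → ℂ), (∀ x, G (x + 1) = G x) → ∀ x, ∃ x' ∈ Icc (0 : ℝ) 1, G x = G x' := by
    intro G hG x
    obtain ⟨x', hx', h⟩ := Function.Periodic.exists_mem_Ico₀ (f := G) hG one_pos x
    exact ⟨x', ⟨hx'.1, hx'.2.le⟩, h⟩
  have shift : ∀ (x y : ℝ), (((x + 1 : ℝ) : ℂ) + y * I) = x + y * I + 1 := fun x y => by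
    push_cast; ring
  obtain ⟨x₁', hx₁, h1⟩ := red
    (fun x => F (x + (y₁ + s₁ : ℝ) * I, x₂ + (v + s₂ : ℝ) * I, x₃ + (y₂ + s₃ : ℝ) * I))
    (fun x => by simp only [shift, hF.per₁]) x₁
  obtain ⟨x₂', hx₂, h2⟩ := red
    (fun x => F (x₁' + (y₁ + s₁ : ℝ) * I, x + (v + s₂ : ℝ) * I, x₃ + (y₂ + s₃ : ℝ) * I))
    (fun x => by simp only [shift, hF.per₂]) x₂
  obtain ⟨x₃', hx₃, h3⟩ := red
    (fun x => F (x₁' + (y₁ + s₁ : ℝ) * I, x₂' + (v + s₂ : ℝ) * I, x + (y₂ + s₃ : ℝ) * I))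
    (fun x => by simp only [shift, hF.per₃]) x₃
  refine (congrArg norm (h1.trans (h2.trans h3))).trans_le ?_
  exact hC _ ⟨hmem _ _ _ hs₁ hx₁, hmem _ _ _ hs₂ hx₂, hmem _ _ _ hs₃ hx₃⟩

theorem exists_cone_margin {y₁ v y₂ : ℝ} (hy : 0 < y₁) (hv : v ^ 2 < y₁ * y₂) :
    ∃ δ > 0, ∀ s₁ s₂ s₃ : ℝ, |s₁| ≤ δ → |s₂| ≤ δ → |s₃| ≤ δ →
      0 < y₁ + s₁ ∧ (v + s₂) ^ 2 < (y₁ + s₁) * (y₂ + s₃) := by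
  let U : Set (ℝ × ℝ × ℝ) := {q | 0 < y₁ + q.1} ∩
    {q | (v + q.2.1) ^ 2 < (y₁ + q.1) * (y₂ + q.2.2)}
  have hU : IsOpen U := (isOpen_lt continuous_const (by fun_prop)).inter
    (isOpen_lt (by fun_prop) (by fun_prop))
  have h0 : (0 : ℝ × ℝ × ℝ) ∈ U := by
    constructor <;> simp [hy, hv]
  obtain ⟨δ, hδ, h⟩ := Metric.nhds_basis_closedBall.mem_iff.1 (hU.mem_nhds h0)
  refine ⟨δ, hδ, fun s₁ s₂ s₃ h1 h2 h3 => ?_⟩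
  have : (s₁, s₂, s₃) ∈ U := h (by
    rw [mem_closedBall_zero_iff]
    simp [Prod.norm_def, h1, h2, h3])
  exact this

/-- The exponents are indexed by `(M, r, n)`. -/
theorem summable_norm_coeff (hF : IsPeriodicHolomorphic F) {y₁ v y₂ : ℝ} (hy : 0 < y₁)
    (hv : v ^ 2 < y₁ * y₂) :
    Summable fun T : ℤ × ℤ × ℤ => ‖coeff F T.2.2 T.2.1 T.1‖ *
      Real.exp (-(2 * Real.pi * (T.2.2 * y₁ + T.2.1 * v + T.1 * y₂))) := by
  obtain ⟨δ, hδ, hcone⟩ := exists_cone_margin hy hv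
  obtain ⟨C, hC⟩ := hF.exists_bound hcone
  have hs := summable_exp_neg_abs (δ := 2 * Real.pi * δ) (by positivity)
  have hs3 := (hs.mul_of_nonneg (hs.mul_of_nonneg hs (fun _ => Real.exp_nonneg _)
    (fun _ => Real.exp_nonneg _)) (fun _ => Real.exp_nonneg _)
    (fun _ => mul_nonneg (Real.exp_nonneg _) (Real.exp_nonneg _))).mul_left C
  refine Summable.of_nonneg_of_le (fun _ => by positivity) (fun T => ?_) hs3
  obtain ⟨M, r, n⟩ := T
  -- Each of the three coordinates of Y is moved by δ against the sign of its exponent, which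
  -- produces exponential decay in all directions at once.
  have hsgn : ∀ m : ℤ, ∃ s : ℝ, |s| ≤ δ ∧ m * s = -(δ * |(m : ℝ)|) := by
    intro m
    rcases le_total 0 (m : ℝ) with h | h
    · exact ⟨-δ, by simp [abs_of_pos hδ], by rw [abs_of_nonneg h]; ring⟩
    · exact ⟨δ, by simp [abs_of_pos hδ], by rw [abs_of_nonpos h]; ring⟩
  obtain ⟨s₁, h1, h1'⟩ := hsgn n
  obtain ⟨s₂, h2, h2'⟩ := hsgn r
  obtain ⟨s₃, h3, h3'⟩ := hsgn M
  have hc := hcone s₁ s₂ s₃ h1 h2 h3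
  have := hF.norm_coeff_le n r M hc.1 hc.2 (hC s₁ s₂ s₃ h1 h2 h3)
  refine (mul_le_mul_of_nonneg_right this (Real.exp_nonneg _)).trans_eq ?_
  simp only
  rw [mul_assoc, ← Real.exp_add, ← Real.exp_add, ← Real.exp_add]
  congr 2
  linear_combination 2 * Real.pi * (h1' + h2' + h3')

theorem norm_term (a τ z ω : ℂ) (n r M : ℤ) :
    ‖a * e (n * τ + r * z + M * ω)‖ =
      ‖a‖ * Real.exp (-(2 * Real.pi * (n * τ.im + r * z.im + M * ω.im))) := by
  rw [norm_mul, norm_e]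
  congr 4
  simp

theorem summable_term (hF : IsPeriodicHolomorphic F) {τ z ω : ℂ} (h : (τ, z, ω) ∈ siegelDomain) :
    Summable fun T : ℤ × ℤ × ℤ =>
      coeff F T.2.2 T.2.1 T.1 * e (T.2.2 * τ + T.2.1 * z + T.1 * ω) := by
  refine Summable.of_norm ((hF.summable_norm_coeff h.1 h.2).congr fun T => ?_)
  rw [norm_term]

/-- Joint summability is inherited from the triple series at an auxiliary ω by fixing M and removing
the factor e(Mω). The iterated sums then identify the value. -/
theorem hasSum_jacobiCoeff_eq (hF : IsPeriodicHolomorphic F) (M : ℤ) {τ : ℂ} (hτ : 0 < τ.im)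
    (z : ℂ) :
    HasSum (fun q : ℤ × ℤ => coeff F q.2 q.1 M * e (q.2 * τ + q.1 * z))
      (jacobiCoeff F M (τ, z)) := by
  have hmem : (τ, z, ((z.im ^ 2 / τ.im + 1 : ℝ) * I : ℂ)) ∈ siegelDomain := by
    refine ⟨hτ, ?_⟩
    rw [← div_lt_iff₀' hτ]
    simp only [im_ofReal_mul, I_im, mul_one]
    linarith
  have hs : Summable fun q : ℤ × ℤ => coeff F q.2 q.1 M * e (q.2 * τ + q.1 * z) := by
    have h1 := ((hF.summable_term hmem).comp_injective (i := fun q : ℤ × ℤ => (M, q))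
      (fun _ _ h => (Prod.mk.inj h).2)).mul_right (e (-(M * ((z.im ^ 2 / τ.im + 1 : ℝ) * I : ℂ))))
    refine h1.congr fun q => ?_
    simp only [Function.comp]
    rw [mul_assoc, ← e_add]
    congr 2
    ring
  have hfib : ∀ r : ℤ, HasSum (fun n : ℤ => coeff F n r M * e (n * τ + r * z))
      (thetaCoeff F r M τ * e (r * z)) := fun r =>
    ((hF.hasSum_coeff r M hτ).mul_right (e (r * z))).congr_fun fun n => by rw [e_add, mul_assoc]
  have h2 := hs.hasSum.prod_fiberwise hfib
  rw [(hF.hasSum_thetaCoeff M hτ z).unique h2]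
  exact hs.hasSum

theorem hasSum_term (hF : IsPeriodicHolomorphic F) {τ z ω : ℂ} (h : (τ, z, ω) ∈ siegelDomain) :
    HasSum (fun T : ℤ × ℤ × ℤ =>
      coeff F T.2.2 T.2.1 T.1 * e (T.2.2 * τ + T.2.1 * z + T.1 * ω)) (F (τ, z, ω)) := by
  have hs := hF.summable_term h
  have hfib : ∀ M : ℤ, HasSum (fun q : ℤ × ℤ => coeff F q.2 q.1 M * e (q.2 * τ + q.1 * z + M * ω))
      (jacobiCoeff F M (τ, z) * e (M * ω)) := fun M =>
    ((hF.hasSum_jacobiCoeff_eq M h.1 z).mul_right (e (M * ω))).congr_fun fun q => by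
      rw [e_add _ ((M : ℂ) * ω), mul_assoc]
  rw [(hF.hasSum_jacobiCoeff h).unique (hs.hasSum.prod_fiberwise hfib)]
  exact hs.hasSum

end IsPeriodicHolomorphic

end

/-! ### Uniqueness of Fourier series, Koecher principle, and support on definite forms -/

section

open Complex Set Filter Topology

theorem integral_e_int_mul (n : ℤ) : ∫ x in (0 : ℝ)..1, e (n * x) = if n = 0 then 1 else 0 := by
  split_ifs with h
  · simp [h, e_zero]
  · have hc : 2 * Real.pi * I * n ≠ (0 : ℂ) := by
      simp [Real.pi_ne_zero, h]
    have h1 : ∀ x : ℝ, e (n * x) = Complex.exp (2 * Real.pi * I * n * x) := fun x => by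
      rw [e]; congr 1; ring
    have h2 : Complex.exp (2 * Real.pi * I * n * (1 : ℝ)) = 1 := by
      rw [← h1]; simpa using e_intCast n
    simp only [h1]
    rw [integral_exp_mul_complex hc, h2]
    simp

/-- Uniqueness of Fourier series: the coefficients are determined by the values on a horizontal
line. -/
theorem eq_zero_of_hasSum_e {ι : Type*} [Countable ι] (b : ι → ℂ) (m : ι → ℤ) (y : ℝ)
    (h : ∀ x : ℝ, HasSum (fun i => b i * e (m i * (x + y * I))) 0)
    (hinj : ∀ i j, b i ≠ 0 → b j ≠ 0 → m i = m j → i = j) (i₀ : ι) : b i₀ = 0 := by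
  by_contra h0
  let f : ι → C(ℝ, ℂ) := fun i =>
    ⟨fun x => b i * e (m i * (x + y * I)) * e (-(m i₀ * (x + y * I))),
      by have := differentiable_e.continuous; fun_prop⟩
  have hnorm : ∀ i x, ‖f i x‖ = ‖b i * e (m i * ((0 : ℝ) + y * I))‖ *
      Real.exp (2 * Real.pi * (m i₀ * y)) := by
    intro i x
    simp [f, norm_e]
  have hsum : Summable fun i => ‖(f i).restrict (⟨uIcc 0 1, isCompact_uIcc⟩ :
      TopologicalSpace.Compacts ℝ)‖ := by
    refine Summable.of_nonneg_of_le (fun _ => norm_nonneg _) (fun i => ?_)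
      ((h 0).summable.norm.mul_right (Real.exp (2 * Real.pi * (m i₀ * y))))
    refine (ContinuousMap.norm_le _ (by positivity)).2 fun x => ?_
    exact (hnorm i x).le
  have h1 := intervalIntegral.hasSum_intervalIntegral_of_summable_norm hsum
  have h2 : ∀ x : ℝ, ∑' i, f i x = 0 := fun x => by
    have := ((h x).mul_right (e (-(m i₀ * (x + y * I))))).tsum_eq
    rwa [zero_mul] at this
  simp only [h2, intervalIntegral.integral_zero] at h1
  have h3 : ∀ i, ∫ x in (0 : ℝ)..1, f i x =
      b i * e ((m i - m i₀) * (y * I)) * if m i - m i₀ = 0 then 1 else 0 := by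
    intro i
    rw [← integral_e_int_mul, ← intervalIntegral.integral_const_mul]
    refine intervalIntegral.integral_congr fun x _ => ?_
    simp only [f, ContinuousMap.coe_mk]
    rw [mul_assoc, mul_assoc, ← e_add, ← e_add]
    congr 2
    push_cast
    ring
  have h4 : HasSum (fun i => ∫ x in (0 : ℝ)..1, f i x) (b i₀) := by
    -- After multiplication by e(-m i₀ ·) and integration only the term i₀ survives. The frequencies
    -- need to be distinct only where the coefficients are nonzero.
    classical
    have := hasSum_ite_eq i₀ (b i₀)
    refine this.congr_fun fun i => ?_
    rw [h3]
    by_cases hb : b i = 0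
    · have : i ≠ i₀ := fun h => h0 (h ▸ hb)
      simp [hb, this]
    · by_cases hi : i = i₀
      · subst hi; simp [e_zero]
      · have : m i - m i₀ ≠ 0 := fun h => hi (hinj i i₀ hb h0 (by linarith))
        simp [hi, this]
  exact h0 (h4.unique h1)

/-- Translating the integral by 1/N multiplies it by e(-M/N), which equals 1 only if N divides M. -/
theorem stripCoeff_eq_zero_of_period {N : ℕ} (hN : 0 < N) (g : ℂ → ℂ)
    (hper : ∀ ζ, g (ζ + 1 / N) = g ζ) {M : ℤ} (hM : ¬ (N : ℤ) ∣ M) (y : ℝ) :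
    stripCoeff g M y = 0 := by
  have hN0 : (N : ℂ) ≠ 0 := by exact_mod_cast hN.ne'
  have hper1 : ∀ ζ, g (ζ + 1) = g ζ := by
    have : ∀ (j : ℕ) ζ, g (ζ + j * (1 / N)) = g ζ := by
      intro j
      induction j with
      | zero => simp
      | succ j ih =>
        intro ζ
        rw [Nat.cast_succ, add_mul, one_mul, ← add_assoc, hper, ih]
    intro ζ
    have h := this N ζ
    rwa [mul_one_div_cancel hN0] at h
  set h : ℝ → ℂ := fun x => g (x + y * I) * e (-(M * (x + y * I))) with hh
  have hp : Function.Periodic h 1 := by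
    intro x
    simp only [hh]
    have h1 : (((x + 1 : ℝ) : ℂ) + y * I) = x + y * I + 1 := by push_cast; ring
    have h2 : ∀ w : ℂ, -(M * w) = ((-M : ℤ) : ℂ) * w := fun w => by push_cast; ring
    rw [h1, hper1, h2, h2, e_int_mul_add_one]
  have hs : ∀ x, h (x + 1 / N) = e (-(M / N)) * h x := by
    intro x
    simp only [hh]
    have h1 : (((x + 1 / N : ℝ) : ℂ) + y * I) = x + y * I + 1 / N := by push_cast; ring
    rw [h1, hper, mul_left_comm, ← e_add]
    congr 2
    ring
  have key : stripCoeff g M y = e (-(M / N)) * stripCoeff g M y := by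
    calc stripCoeff g M y = ∫ x in (0 : ℝ)..(0 + 1), h x := by rw [zero_add]; rfl
      _ = ∫ x in (1 / N : ℝ)..(1 / N + 1), h x := (hp.intervalIntegral_add_eq _ _)
      _ = ∫ x in (0 : ℝ)..1, h (x + 1 / N) := by
          rw [intervalIntegral.integral_comp_add_right]; congr 1 <;> ring
      _ = _ := by
          simp only [hs]
          rw [intervalIntegral.integral_const_mul]; rfl
  by_contra h0
  have h1 : e (-(M / N)) = 1 := by
    have : (e (-(M / N)) - 1) * stripCoeff g M y = 0 := by rw [sub_mul, one_mul, ← key, sub_self]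
    exact sub_eq_zero.1 ((mul_eq_zero.1 this).resolve_right h0)
  rw [e, Complex.exp_eq_one_iff] at h1
  obtain ⟨n, hn⟩ := h1
  apply hM
  refine ⟨-n, ?_⟩
  have hpi : (2 * Real.pi * I : ℂ) ≠ 0 := by simp [Real.pi_ne_zero]
  have h2 : -((M : ℂ) / N) = n := by
    apply mul_left_cancel₀ hpi
    rw [hn]; ring
  have h3 : (M : ℂ) = N * (-n : ℤ) := by
    push_cast
    rw [← h2]; field_simp
  exact_mod_cast h3

/-- The action `Ω ↦ U Ω Uᵀ` of `U = (a b; c d)` in the coordinates `(τ, z, ω)`. -/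
def symConj (a b c d : ℤ) (v : ℂ × ℂ × ℂ) : ℂ × ℂ × ℂ :=
  (a ^ 2 * v.1 + 2 * a * b * v.2.1 + b ^ 2 * v.2.2,
    a * c * v.1 + (a * d + b * c) * v.2.1 + b * d * v.2.2,
    c ^ 2 * v.1 + 2 * c * d * v.2.1 + d ^ 2 * v.2.2)

/-- Paramodular cusp forms of level `p` and weight `k` in the coordinates `(τ, z, ω)`. -/
structure IsParamodularCusp (p k : ℕ) (F : ℂ × ℂ × ℂ → ℂ) : Prop extends
    IsPeriodicHolomorphic F where
  per : ∀ τ z ω, F (τ, z, ω + 1 / p) = F (τ, z, ω)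
  lin : ∀ a b c d : ℤ, (p : ℤ) ∣ b → a * d - b * c = 1 → ∀ v ∈ siegelDomain,
    F (symConj a b c d v) = F v
  sl2 : ∀ a b c d : ℤ, a * d - b * c = 1 → ∀ τ z ω, (τ, z, ω) ∈ siegelDomain →
    F ((a * τ + b) / (c * τ + d), z / (c * τ + d), ω - c * z ^ 2 / (c * τ + d)) =
      (c * τ + d) ^ k * F (τ, z, ω)
  fricke : ∀ τ z ω, (τ, z, ω) ∈ siegelDomain → ‖F (p * ω, -z, τ / p)‖ = ‖F (τ, z, ω)‖
  cusp : ∀ a b c d : ℤ, a * d - b * c = 1 → ∀ τ : ℂ, 0 < τ.im →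
    Tendsto (fun t : ℝ => F (symConj a b c d (t * I, 0, τ))) atTop (𝓝 0)

/-- The `3 × 3` system expressing a binary quadratic form in a unimodular basis. -/
theorem binary_eq_zero {N R M a b c d : ℤ} (hdet : a * d - b * c = 1)
    (h1 : 2 * N * a + R * c = 0) (h2 : R * a + 2 * M * c = 0)
    (h3 : N * b ^ 2 + R * b * d + M * d ^ 2 = 0) : N = 0 ∧ R = 0 ∧ M = 0 := by
  have e1 : N * a ^ 2 + R * a * c + M * c ^ 2 = 0 := by
    have : 2 * (N * a ^ 2 + R * a * c + M * c ^ 2) = 0 := by linear_combination a * h1 + c * h2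
    omega
  have e2 : 2 * N * a * b + R * (a * d + b * c) + 2 * M * c * d = 0 := by
    linear_combination b * h1 + d * h2
  have hd2 : (a * d - b * c) ^ 2 = 1 := by rw [hdet]; norm_num
  refine ⟨?_, ?_, ?_⟩
  · linear_combination d ^ 2 * e1 - d * c * e2 + c ^ 2 * h3 - N * hd2
  · linear_combination (-2 * b * d) * e1 + (a * d + b * c) * e2 - 2 * a * c * h3 - R * hd2
  · linear_combination b ^ 2 * e1 - a * b * e2 + a ^ 2 * h3 - M * hd2

theorem tendsto_exp_quadratic (A B D : ℝ) (hA : A < 0) :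
    Tendsto (fun l : ℕ => Real.exp (A * l ^ 2 + B * l + D)) atTop (𝓝 0) := by
  refine Real.tendsto_exp_atBot.comp ?_
  have h1 : Tendsto (fun l : ℕ => A * (l : ℝ) + B) atTop atBot :=
    tendsto_atBot_add_const_right _ _
      ((tendsto_natCast_atTop_atTop (R := ℝ)).const_mul_atTop_of_neg hA)
  have h2 : Tendsto (fun l : ℕ => (A * (l : ℝ) + B) * l) atTop atBot :=
    h1.atBot_mul_atTop₀ tendsto_natCast_atTop_atTop
  refine (tendsto_atBot_add_const_right _ D h2).congr fun l => ?_
  ring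

namespace IsParamodularCusp

variable {p k : ℕ} {F : ℂ × ℂ × ℂ → ℂ}

theorem jacobiCoeff_eq_zero (hF : IsParamodularCusp p k F) (hp : 0 < p) {M : ℤ}
    (hM : ¬ (p : ℤ) ∣ M) (q : ℂ × ℂ) : jacobiCoeff F M q = 0 :=
  stripCoeff_eq_zero_of_period hp _ (fun ζ => hF.per q.1 q.2 ζ) hM _

/-- F is bounded on the points with imaginary part UU', where U has first column (a, c) and second
column (b, d), so the coefficient of T is bounded by C e^{2π(T[a, c] + T[b, d])}. Adding multiples
of the first column to the second makes the exponent tend to -∞ if T[a, c] < 0. -/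
theorem coeff_form_nonneg (hF : IsParamodularCusp p k F) (hp : 0 < p) {n r M : ℤ} (h : coeff F n r M ≠ 0)
    (a c : ℤ) (hac : IsCoprime a (p * c)) : 0 ≤ n * a ^ 2 + r * a * c + M * c ^ 2 := by
  by_contra! hneg
  obtain ⟨d₀, b₀, hbd⟩ := hac
  obtain ⟨C, hC⟩ := hF.exists_bound (y₁ := 1) (v := 0) (y₂ := 1) (δ := 0) (by
    intro s₁ s₂ s₃ h1 h2 h3
    simp [abs_nonpos_iff.1 h1, abs_nonpos_iff.1 h2, abs_nonpos_iff.1 h3])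
  have hC : ∀ x₁ x₂ x₃ : ℝ, ‖F (x₁ + I, x₂, x₃ + I)‖ ≤ C := fun x₁ x₂ x₃ => by
    simpa using hC 0 0 0 (by simp) (by simp) (by simp) x₁ x₂ x₃
  have hmemI : ∀ x₁ x₂ x₃ : ℝ, ((x₁ + I, x₂, x₃ + I) : ℂ × ℂ × ℂ) ∈ siegelDomain :=
    fun x₁ x₂ x₃ => by rw [mem_siegelDomain]; simp
  have hb : ∀ l : ℕ, ‖coeff F n r M‖ ≤ C * Real.exp (2 * Real.pi *
      (((n * a ^ 2 + r * a * c + M * c ^ 2 : ℤ) : ℝ) * p ^ 2 * l ^ 2 +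
      (2 * n * a * (-(p * b₀)) + r * (a * d₀ + (-(p * b₀)) * c) + 2 * M * c * d₀) * p * l +
      (n * a ^ 2 + r * a * c + M * c ^ 2 + (n * (p * b₀) ^ 2 - r * (p * b₀) * d₀ + M * d₀ ^ 2)))) := by
    intro l
    -- The multiple of the first column is pl rather than l, so that p still divides b. The exponent
    -- becomes quadratic in l with leading coefficient p² T[a, c], up to the factor 2π.
    set b : ℤ := -(p * b₀) + p * l * a with hbdef
    set d : ℤ := d₀ + p * l * c with hddef
    have hdet : a * d - b * c = 1 := by rw [hbdef, hddef]; linear_combination hbd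
    have hdetR : (a * d - b * c : ℝ) = 1 := by exact_mod_cast hdet
    have hpb : (p : ℤ) ∣ b := ⟨-b₀ + l * a, by rw [hbdef]; ring⟩
    have hpos : (0 : ℝ) < a ^ 2 + b ^ 2 := by
      rcases eq_or_ne a 0 with ha | ha
      · have : b ≠ 0 := by rintro h0; simp [ha, h0] at hdet
        positivity
      · positivity
    have hbound : ∀ x₁ x₂ x₃ : ℝ, ‖F (x₁ + (a ^ 2 + b ^ 2 : ℝ) * I,
        x₂ + (a * c + b * d : ℝ) * I, x₃ + (c ^ 2 + d ^ 2 : ℝ) * I)‖ ≤ C := by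
      intro x₁ x₂ x₃
      have h1 := hF.lin a b c d hpb hdet
        (((d ^ 2 * x₁ - 2 * d * b * x₂ + b ^ 2 * x₃ : ℝ) : ℂ) + I,
          ((-(d * c) * x₁ + (a * d + b * c) * x₂ - a * b * x₃ : ℝ) : ℂ),
          ((c ^ 2 * x₁ - 2 * a * c * x₂ + a ^ 2 * x₃ : ℝ) : ℂ) + I)
        (hmemI _ _ _)
      have h2 := hC (d ^ 2 * x₁ - 2 * d * b * x₂ + b ^ 2 * x₃)
        (-(d * c) * x₁ + (a * d + b * c) * x₂ - a * b * x₃)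
        (c ^ 2 * x₁ - 2 * a * c * x₂ + a ^ 2 * x₃)
      rw [← h1] at h2
      convert h2 using 3
      have hdetC : (a * d - b * c : ℂ) ^ 2 = 1 := by
        have : (a * d - b * c : ℂ) = 1 := by exact_mod_cast hdet
        rw [this]; norm_num
      simp only [symConj, Prod.mk.injEq]
      push_cast
      refine ⟨?_, ?_, ?_⟩
      · linear_combination (-x₁ : ℂ) * hdetC
      · linear_combination (-x₂ : ℂ) * hdetC
      · linear_combination (-x₃ : ℂ) * hdetC
    have h3 := hF.norm_coeff_le n r M (y₁ := a ^ 2 + b ^ 2) (v := a * c + b * d)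
      (y₂ := c ^ 2 + d ^ 2) hpos (by nlinarith) hbound
    refine h3.trans_eq ?_
    congr 3
    rw [hbdef, hddef]
    push_cast
    ring
  have hA : 2 * Real.pi * (((n * a ^ 2 + r * a * c + M * c ^ 2 : ℤ) : ℝ) * p ^ 2) < 0 := by
    have h1 : ((n * a ^ 2 + r * a * c + M * c ^ 2 : ℤ) : ℝ) < 0 := by exact_mod_cast hneg
    have h2 : (p : ℝ) ≠ 0 := by exact_mod_cast hp.ne'
    have : 0 < (p : ℝ) ^ 2 := by positivity
    exact mul_neg_of_pos_of_neg (by positivity) (mul_neg_of_neg_of_pos h1 this)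
  have hlim := (tendsto_exp_quadratic _ (2 * Real.pi * ((2 * n * a * (-(p * b₀)) +
    r * (a * d₀ + (-(p * b₀)) * c) + 2 * M * c * d₀) * p)) (2 * Real.pi * (n * a ^ 2 + r * a * c +
    M * c ^ 2 + (n * (p * b₀) ^ 2 - r * (p * b₀) * d₀ + M * d₀ ^ 2))) hA).const_mul C
  rw [mul_zero] at hlim
  have : ‖coeff F n r M‖ ≤ 0 := by
    refine ge_of_tendsto' hlim fun l => (hb l).trans_eq ?_
    congr 2
    ring
  exact h (norm_le_zero_iff.1 this)

/-- The integral vectors available are those with a prime to pc. The fractions a / p^K with p not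
dividing a are dense in ℝ, which suffices by continuity. -/
theorem coeff_form_nonneg_real (hF : IsParamodularCusp p k F) (hp : p.Prime) {n r M : ℤ}
    (h : coeff F n r M ≠ 0) (ξ : ℝ) : 0 ≤ n * (ξ * ξ) + r * ξ + M := by
  by_contra! hneg
  have hopen : IsOpen {x : ℝ | n * (x * x) + r * x + M < 0} :=
    isOpen_lt (by fun_prop) continuous_const
  obtain ⟨δ, hδ, hball⟩ := Metric.isOpen_iff.1 hopen ξ hneg
  obtain ⟨K, hK⟩ := exists_pow_lt_of_lt_one hδ (y := (p : ℝ)⁻¹)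
    (inv_lt_one_of_one_lt₀ (by exact_mod_cast hp.one_lt))
  have hpK : (0 : ℝ) < (p : ℝ) ^ K := pow_pos (by exact_mod_cast hp.pos) K
  rw [inv_pow] at hK
  -- Of the two integers around ξp^K at least one is prime to p.
  obtain ⟨a, hap, ha⟩ : ∃ a : ℤ, ¬ (p : ℤ) ∣ a ∧ |(a : ℝ) - ξ * p ^ K| ≤ 1 := by
    by_cases hd : (p : ℤ) ∣ ⌊ξ * p ^ K⌋
    · refine ⟨⌊ξ * p ^ K⌋ + 1, fun h1 => ?_, ?_⟩
      · have h2 : (p : ℤ) ∣ 1 := (Int.dvd_add_right hd).1 h1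
        exact hp.one_lt.ne' (by exact_mod_cast Int.eq_one_of_dvd_one (by positivity) h2)
      · rw [abs_le]; push_cast
        constructor <;> linarith [Int.floor_le (ξ * (p : ℝ) ^ K), Int.lt_floor_add_one (ξ * (p : ℝ) ^ K)]
    · refine ⟨⌊ξ * p ^ K⌋, hd, ?_⟩
      rw [abs_le]
      constructor <;> linarith [Int.floor_le (ξ * (p : ℝ) ^ K), Int.lt_floor_add_one (ξ * (p : ℝ) ^ K)]
  have hmem : (a : ℝ) / p ^ K ∈ Metric.ball ξ δ := by
    rw [Metric.mem_ball, Real.dist_eq]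
    have h1 : (a : ℝ) / p ^ K - ξ = (a - ξ * p ^ K) / p ^ K := by field_simp
    rw [h1, abs_div, abs_of_pos hpK]
    refine lt_of_le_of_lt ?_ hK
    rw [inv_eq_one_div]
    gcongr
  have hlt : (n * ((a : ℝ) / p ^ K * (a / p ^ K)) + r * (a / p ^ K) + M) < 0 := hball hmem
  have hcop : IsCoprime a (p * (p : ℤ) ^ K) := by
    rw [← pow_succ']
    refine IsCoprime.pow_right ?_
    exact ((Nat.prime_iff_prime_int.1 hp).coprime_iff_not_dvd.2 hap).symm
  have h0 := hF.coeff_form_nonneg hp.pos h a ((p : ℤ) ^ K) hcop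
  have h1 : (0 : ℝ) ≤ n * a ^ 2 + r * a * p ^ K + M * (p ^ K) ^ 2 := by exact_mod_cast h0
  have h2 : (n * ((a : ℝ) / p ^ K * (a / p ^ K)) + r * (a / p ^ K) + M) =
      (n * a ^ 2 + r * a * p ^ K + M * (p ^ K) ^ 2) / (p ^ K) ^ 2 := by field_simp
  rw [h2] at hlt
  exact absurd hlt (not_lt.2 (div_nonneg h1 (by positivity)))

/-- The Koecher principle. -/
theorem coeff_posSemidef (hF : IsParamodularCusp p k F) (hp : p.Prime) {n r M : ℤ}
    (h : coeff F n r M ≠ 0) : 0 ≤ n ∧ 0 ≤ M ∧ r ^ 2 ≤ 4 * n * M := by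
  refine ⟨?_, ?_, ?_⟩
  · simpa using hF.coeff_form_nonneg hp.pos h 1 0 (by simpa using isCoprime_zero_right.2 isUnit_one)
  · exact_mod_cast (by simpa using hF.coeff_form_nonneg_real hp h 0 : (0 : ℝ) ≤ M)
  · have h1 := discrim_le_zero (hF.coeff_form_nonneg_real hp h)
    rw [discrim] at h1
    have h2 : (r : ℝ) ^ 2 ≤ 4 * n * M := by linarith
    exact_mod_cast h2

/-- The vector (-r, 2n) is isotropic for a degenerate form; dividing by the gcd makes it primitive.
If it is zero, (1, 0) serves. -/
theorem exists_isotropic {n r M : ℤ} (h : r ^ 2 = 4 * n * M) :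
    ∃ a c : ℤ, IsCoprime a c ∧ n * a ^ 2 + r * a * c + M * c ^ 2 = 0 := by
  by_cases h0 : r = 0 ∧ n = 0
  · exact ⟨1, 0, isCoprime_one_left, by simp [h0]⟩
  · have hg : 0 < Int.gcd (-r) (2 * n) := by
      rw [Int.gcd_pos_iff]
      rcases not_and_or.1 h0 with h1 | h1
      · left; simpa using h1
      · right; simpa using h1
    obtain ⟨a, c, hac, ha, hc⟩ := Int.exists_gcd_one hg
    set g : ℤ := (Int.gcd (-r) (2 * n) : ℤ) with hgd
    have hg0 : g ≠ 0 := by rw [hgd]; exact_mod_cast hg.ne'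
    refine ⟨a, c, Int.isCoprime_iff_gcd_eq_one.2 hac, ?_⟩
    have : g ^ 2 * (n * a ^ 2 + r * a * c + M * c ^ 2) = 0 := by
      have h1 : g ^ 2 * (n * a ^ 2 + r * a * c + M * c ^ 2) =
          n * (a * g) ^ 2 + r * (a * g) * (c * g) + M * (c * g) ^ 2 := by ring
      rw [h1, ← ha, ← hc]
      linear_combination (-n) * h
    exact (mul_eq_zero.1 this).resolve_left (by positivity)

/-- An isotropic vector of a semidefinite form lies in its kernel, as one sees by completing the
square. -/
theorem isotropic_kernel {n r M a c : ℤ} (hr : r ^ 2 ≤ 4 * n * M)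
    (h : n * a ^ 2 + r * a * c + M * c ^ 2 = 0) :
    2 * n * a + r * c = 0 ∧ r * a + 2 * M * c = 0 := by
  constructor
  · have : (2 * n * a + r * c) ^ 2 = (r ^ 2 - 4 * n * M) * c ^ 2 := by
      linear_combination 4 * n * h
    have h2 : (2 * n * a + r * c) ^ 2 ≤ 0 := by
      rw [this]; exact mul_nonpos_of_nonpos_of_nonneg (by linarith) (sq_nonneg c)
    exact pow_eq_zero_iff two_ne_zero |>.1 (le_antisymm h2 (sq_nonneg _))
  · have : (r * a + 2 * M * c) ^ 2 = (r ^ 2 - 4 * n * M) * a ^ 2 := by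
      linear_combination 4 * M * h
    have h2 : (r * a + 2 * M * c) ^ 2 ≤ 0 := by
      rw [this]; exact mul_nonpos_of_nonpos_of_nonneg (by linarith) (sq_nonneg a)
    exact pow_eq_zero_iff two_ne_zero |>.1 (le_antisymm h2 (sq_nonneg _))

theorem form_nonneg {n r M : ℤ} (hn : 0 ≤ n) (hM : 0 ≤ M) (hr : r ^ 2 ≤ 4 * n * M) (a c : ℤ) :
    0 ≤ n * a ^ 2 + r * a * c + M * c ^ 2 := by
  rcases hn.eq_or_lt with rfl | hn
  · have : r = 0 := by nlinarith
    subst this; simp; positivity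
  · have h1 : 4 * n * (n * a ^ 2 + r * a * c + M * c ^ 2) =
        (2 * n * a + r * c) ^ 2 + (4 * n * M - r ^ 2) * c ^ 2 := by ring
    have h2 : 0 ≤ 4 * n * (n * a ^ 2 + r * a * c + M * c ^ 2) := by
      rw [h1]; have := sub_nonneg.2 hr; positivity
    exact nonneg_of_mul_nonneg_right h2 (by positivity)

theorem symConj_im (a b c d : ℤ) (τ z ω : ℂ) :
    (symConj a b c d (τ, z, ω)).1.im = a ^ 2 * τ.im + 2 * a * b * z.im + b ^ 2 * ω.im ∧
    (symConj a b c d (τ, z, ω)).2.1.im = a * c * τ.im + (a * d + b * c) * z.im + b * d * ω.im ∧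
    (symConj a b c d (τ, z, ω)).2.2.im = c ^ 2 * τ.im + 2 * c * d * z.im + d ^ 2 * ω.im := by
  have e1 : (symConj a b c d (τ, z, ω)).1 =
      ((a ^ 2 : ℝ) : ℂ) * τ + ((2 * a * b : ℝ) : ℂ) * z + ((b ^ 2 : ℝ) : ℂ) * ω := by simp [symConj]
  have e2 : (symConj a b c d (τ, z, ω)).2.1 =
      ((a * c : ℝ) : ℂ) * τ + ((a * d + b * c : ℝ) : ℂ) * z + ((b * d : ℝ) : ℂ) * ω := by
    simp [symConj]
  have e3 : (symConj a b c d (τ, z, ω)).2.2 =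
      ((c ^ 2 : ℝ) : ℂ) * τ + ((2 * c * d : ℝ) : ℂ) * z + ((d ^ 2 : ℝ) : ℂ) * ω := by simp [symConj]
  rw [e1, e2, e3]
  simp only [add_im, im_ofReal_mul, and_self]

theorem symConj_mem (a b c d : ℤ) (hdet : a * d - b * c = 1) {v : ℂ × ℂ × ℂ}
    (hv : v ∈ siegelDomain) : symConj a b c d v ∈ siegelDomain := by
  obtain ⟨τ, z, ω⟩ := v
  have hω := im_pos_of_mem hv
  obtain ⟨h1, h2⟩ := mem_siegelDomain.1 hv
  have hd : ((a : ℝ) * d - b * c) = 1 := by exact_mod_cast hdet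
  obtain ⟨e1, e2, e3⟩ := symConj_im a b c d τ z ω
  refine ⟨?_, ?_⟩
  · rw [e1]
    have h3 : τ.im * (a ^ 2 * τ.im + 2 * a * b * z.im + b ^ 2 * ω.im) =
        (a * τ.im + b * z.im) ^ 2 + b ^ 2 * (τ.im * ω.im - z.im ^ 2) := by ring
    have h4 : 0 < τ.im * (a ^ 2 * τ.im + 2 * a * b * z.im + b ^ 2 * ω.im) := by
      rw [h3]
      have h5 := sub_pos.2 h2
      rcases eq_or_ne (b : ℝ) 0 with hb | hb
      · have ha : (a : ℝ) ≠ 0 := by rintro h0; simp [hb, h0] at hd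
        rw [hb]; simp; positivity
      · positivity
    exact pos_of_mul_pos_right h4 h1.le
  · rw [e1, e2, e3]
    have h3 : (a ^ 2 * τ.im + 2 * a * b * z.im + b ^ 2 * ω.im) *
        (c ^ 2 * τ.im + 2 * c * d * z.im + d ^ 2 * ω.im) -
        (a * c * τ.im + (a * d + b * c) * z.im + b * d * ω.im) ^ 2 =
        (a * d - b * c) ^ 2 * (τ.im * ω.im - z.im ^ 2) := by ring
    rw [hd] at h3
    linarith

/-- Fourier coefficients of cusp forms are supported on positive definite forms. -/
theorem coeff_posDef (hF : IsParamodularCusp p k F) (hp : p.Prime) {n r M : ℤ}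
    (h : coeff F n r M ≠ 0) : 0 < n ∧ 0 < M ∧ r ^ 2 < 4 * n * M := by
  obtain ⟨hn, hM, hr⟩ := hF.coeff_posSemidef hp h
  suffices hlt : r ^ 2 < 4 * n * M by
    have : 0 < n * M := by nlinarith [sq_nonneg r]
    exact ⟨lt_of_le_of_ne hn (by rintro rfl; simp at this),
      lt_of_le_of_ne hM (by rintro rfl; simp at this), hlt⟩
  refine lt_of_le_of_ne hr fun hreq => h ?_
  -- The primitive isotropic vector becomes the first column of U in SL₂(ℤ). Here p need not divide
  -- b, so U need not preserve F; the cusp condition at U is what is used.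
  obtain ⟨a, c, ⟨d, b', hbd⟩, hiso⟩ := exists_isotropic hreq
  obtain ⟨b, rfl⟩ : ∃ b, b' = -b := ⟨-b', by ring⟩
  have hdet : a * d - b * c = 1 := by linear_combination hbd
  -- The values of T at the two columns of U. At U diag(it, τ) U' the term of T decays like
  -- e^{-2πρt}, so as t → ∞ only the terms with ρ = 0 remain, and their sum vanishes by the cusp
  -- condition.
  let ρ : ℤ × ℤ × ℤ → ℤ := fun T => T.2.2 * a ^ 2 + T.2.1 * a * c + T.1 * c ^ 2
  let ℓ : ℤ × ℤ × ℤ → ℤ := fun T => T.2.2 * b ^ 2 + T.2.1 * b * d + T.1 * d ^ 2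
  let A : ℤ × ℤ × ℤ → ℂ := fun T => coeff F T.2.2 T.2.1 T.1
  have hexp : ∀ (T : ℤ × ℤ × ℤ) (w τ : ℂ), T.2.2 * (symConj a b c d (w, 0, τ)).1 +
      T.2.1 * (symConj a b c d (w, 0, τ)).2.1 + T.1 * (symConj a b c d (w, 0, τ)).2.2 =
      ρ T * w + ℓ T * τ := by
    intro T w τ
    simp only [symConj, ρ, ℓ]
    push_cast
    ring
  have hmem : ∀ (t : ℝ) (τ : ℂ), 0 < t → 0 < τ.im → ((t * I, 0, τ) : ℂ × ℂ × ℂ) ∈ siegelDomain := by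
    intro t τ ht hτ
    rw [mem_siegelDomain]
    simpa using ⟨ht, mul_pos ht hτ⟩
  have hsum : ∀ (t : ℝ) (τ : ℂ), 0 < t → 0 < τ.im →
      HasSum (fun T => A T * e (ρ T * (t * I) + ℓ T * τ)) (F (symConj a b c d (t * I, 0, τ))) := by
    intro t τ ht hτ
    refine (hF.hasSum_term (symConj_mem a b c d hdet (hmem t τ ht hτ))).congr_fun fun T => ?_
    rw [← hexp]
    rfl
  let B : ℤ × ℤ × ℤ → ℂ := fun T => if ρ T = 0 then A T else 0
  have hzero : ∀ x : ℝ, HasSum (fun T => B T * e (ℓ T * (x + (1 : ℝ) * I))) 0 := by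
    intro x
    set τ : ℂ := x + (1 : ℝ) * I with hτd
    have hτ : 0 < τ.im := by simp [hτd]
    have hs1 := (hsum 1 τ one_pos hτ).summable.norm
    have hle : ∀ (t : ℝ), 1 ≤ t → ∀ T, ‖A T * e (ρ T * (t * I) + ℓ T * τ)‖ ≤
        ‖A T * e (ρ T * ((1 : ℝ) * I) + ℓ T * τ)‖ := by
      intro t ht T
      by_cases hA : A T = 0
      · simp [hA]
      · obtain ⟨h1, h2, h3⟩ := hF.coeff_posSemidef hp hA
        have hρ : (0 : ℝ) ≤ ρ T := by exact_mod_cast form_nonneg h1 h2 h3 a c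
        rw [norm_mul, norm_mul]
        refine mul_le_mul_of_nonneg_left ?_ (norm_nonneg _)
        rw [norm_e, norm_e, Real.exp_le_exp, neg_le_neg_iff]
        refine mul_le_mul_of_nonneg_left ?_ (by positivity)
        simp only [add_im, mul_im, intCast_re, intCast_im, zero_mul, add_zero, ofReal_re, I_im,
          mul_one, ofReal_im, I_re, mul_zero]
        nlinarith
    have hBs : Summable fun T => B T * e (ℓ T * τ) := by
      refine Summable.of_norm_bounded (g := fun T => ‖A T * e (ρ T * ((1 : ℝ) * I) + ℓ T * τ)‖)
        hs1 fun T => ?_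
      by_cases hρ : ρ T = 0
      · simp [B, hρ]
      · simp only [B, hρ, if_false, zero_mul, norm_zero]
        exact norm_nonneg _
    have hlim := tendsto_tsum_of_dominated_convergence (𝓕 := atTop)
      (f := fun (t : ℝ) T => A T * e (ρ T * (t * I) + ℓ T * τ)) (g := fun T => B T * e (ℓ T * τ))
      hs1 (fun T => ?_) (by
        filter_upwards [eventually_ge_atTop 1] with t ht T
        exact hle t ht T)
    · have hlim2 := (hF.cusp a b c d hdet τ hτ)
      have heq : (fun t : ℝ => ∑' T, A T * e (ρ T * (t * I) + ℓ T * τ)) =ᶠ[atTop]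
          fun t => F (symConj a b c d (t * I, 0, τ)) := by
        filter_upwards [eventually_gt_atTop 0] with t ht
        exact (hsum t τ ht hτ).tsum_eq
      have := tendsto_nhds_unique hlim (hlim2.congr' heq.symm)
      rw [← this]
      exact hBs.hasSum
    · by_cases hA : A T = 0
      · simp [hA, B]
      by_cases hρ : ρ T = 0
      · simp [B, hρ]
      · obtain ⟨h1, h2, h3⟩ := hF.coeff_posSemidef hp hA
        have hρ0 : (0 : ℝ) < ρ T := by
          exact_mod_cast lt_of_le_of_ne (form_nonneg h1 h2 h3 a c) (Ne.symm hρ)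
        simp only [B, hρ, if_false, zero_mul]
        refine tendsto_zero_iff_norm_tendsto_zero.2 ?_
        have h4 : ∀ t : ℝ, ‖A T * e (ρ T * (t * I) + ℓ T * τ)‖ =
            ‖A T * e (ℓ T * τ)‖ * Real.exp (-(2 * Real.pi * ρ T * t)) := by
          intro t
          rw [e_add, norm_mul, norm_mul, norm_mul, norm_e (ρ T * (t * I))]
          have : ((ρ T : ℂ) * (t * I)).im = ρ T * t := by simp
          rw [this]; ring_nf
        simp only [h4]
        rw [← mul_zero ‖A T * e (ℓ T * τ)‖]
        refine Tendsto.const_mul _ (Real.tendsto_exp_neg_atTop_nhds_zero.comp ?_)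
        exact tendsto_id.const_mul_atTop (by positivity)
  -- All surviving forms have (a, c) in their kernel, so each is determined by its value ℓ at the
  -- second column. The limit is thus a Fourier series in τ with distinct frequencies.
  have hinj : ∀ T T' : ℤ × ℤ × ℤ, B T ≠ 0 → B T' ≠ 0 → ℓ T = ℓ T' → T = T' := by
    have hB : ∀ T, B T ≠ 0 → 2 * T.2.2 * a + T.2.1 * c = 0 ∧ T.2.1 * a + 2 * T.1 * c = 0 := by
      intro T hT
      by_cases hρ : ρ T = 0
      · have hA : A T ≠ 0 := by simpa [B, hρ] using hT
        obtain ⟨-, -, h3⟩ := hF.coeff_posSemidef hp hA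
        exact isotropic_kernel h3 hρ
      · simp [B, hρ] at hT
    rintro ⟨M₁, r₁, n₁⟩ ⟨M₂, r₂, n₂⟩ h1 h2 h3
    obtain ⟨e1, e2⟩ := hB _ h1
    obtain ⟨e3, e4⟩ := hB _ h2
    simp only [ℓ] at e1 e2 e3 e4 h3
    obtain ⟨f1, f2, f3⟩ := binary_eq_zero (N := n₁ - n₂) (R := r₁ - r₂) (M := M₁ - M₂) hdet
      (by linear_combination e1 - e3) (by linear_combination e2 - e4) (by linear_combination h3)
    rw [sub_eq_zero.1 f1, sub_eq_zero.1 f2, sub_eq_zero.1 f3]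
  have hfin := eq_zero_of_hasSum_e B ℓ 1 hzero hinj (M, r, n)
  have : ρ (M, r, n) = 0 := hiso
  simpa [B, this, A] using hfin

end IsParamodularCusp

end

/-! ### Geometry of numbers: short vectors of the ternary form -/

section

open Set MeasureTheory

/-- Minkowski's theorem for ellipsoids in dimension three. -/
theorem exists_int_mulVec_sq_lt (A : Matrix (Fin 3) (Fin 3) ℝ) (hA : A.det ≠ 0) {R : ℝ} (hR : 0 < R)
    (h : 8 * |A.det| < 4 / 3 * Real.pi * R ^ 3) :
    ∃ n : Fin 3 → ℤ, n ≠ 0 ∧ ∑ i, (A *ᵥ fun j => (n j : ℝ)) i ^ 2 < R ^ 2 := by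
  let b := Pi.basisFun ℝ (Fin 3)
  let f : (Fin 3 → ℝ) →ₗ[ℝ] Fin 3 → ℝ := Matrix.toLin' A
  let S : Set (Fin 3 → ℝ) := WithLp.toLp 2 ⁻¹' Metric.ball (0 : EuclideanSpace ℝ (Fin 3)) R
  have hfdet : LinearMap.det f = A.det := LinearMap.det_toLin' A
  have hS : volume S = ENNReal.ofReal R ^ 3 * ENNReal.ofReal (Real.pi * 4 / 3) := by
    rw [(PiLp.volume_preserving_toLp (Fin 3)).measure_preimage
      measurableSet_ball.nullMeasurableSet, EuclideanSpace.volume_ball_fin_three]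
  have hmemS : ∀ v : Fin 3 → ℝ, v ∈ S ↔ ∑ i, v i ^ 2 < R ^ 2 := by
    intro v
    simp only [S, mem_preimage, mem_ball_zero_iff, EuclideanSpace.norm_eq, Real.norm_eq_abs, sq_abs]
    rw [Real.sqrt_lt' hR]
  have hvol : volume (f ⁻¹' S) = ENNReal.ofReal (|A.det|⁻¹ * (4 / 3 * Real.pi * R ^ 3)) := by
    rw [Measure.addHaar_preimage_linearMap volume (by rwa [hfdet]), hS, hfdet, abs_inv,
      ← ENNReal.ofReal_pow hR.le, ← ENNReal.ofReal_mul (by positivity),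
      ← ENNReal.ofReal_mul (by positivity)]
    congr 1; ring
  have hdom : volume (ZSpan.fundamentalDomain b) = 1 := by
    rw [ZSpan.volume_fundamentalDomain]
    have : (Matrix.of (fun i => b i) : Matrix (Fin 3) (Fin 3) ℝ) = 1 := by
      ext i j
      simp [b, Pi.single_apply, Matrix.one_apply, eq_comm]
    erw [this]
    simp
  have fund := ZSpan.isAddFundamentalDomain b volume
  have hS1 : Convex ℝ S :=
    (convex_ball (0 : EuclideanSpace ℝ (Fin 3)) R).linear_preimage
      (WithLp.linearEquiv 2 ℝ (Fin 3 → ℝ)).symm.toLinearMap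
  have hconv : Convex ℝ (f ⁻¹' S) := hS1.linear_preimage f
  have hsymm : ∀ x ∈ f ⁻¹' S, -x ∈ f ⁻¹' S := by
    intro x hx
    rw [mem_preimage, hmemS] at hx ⊢
    simpa using hx
  have : Countable (Submodule.span ℤ (range b)).toAddSubgroup :=
    inferInstanceAs (Countable (Submodule.span ℤ (range b)))
  obtain ⟨⟨x, hxL⟩, hx0, hx⟩ := exists_ne_zero_mem_lattice_of_measure_mul_two_pow_lt_measure
    (L := (Submodule.span ℤ (range b)).toAddSubgroup) fund hsymm hconv (by
      rw [hdom, hvol, one_mul]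
      have h8 : (2 : ENNReal) ^ Module.finrank ℝ (Fin 3 → ℝ) = ENNReal.ofReal 8 := by
        simp; norm_num
      rw [h8]
      refine (ENNReal.ofReal_lt_ofReal_iff_of_nonneg (by norm_num)).2 ?_
      rw [inv_mul_eq_div, lt_div_iff₀ (abs_pos.2 hA)]
      exact h)
  have hint : ∀ i, ∃ m : ℤ, (m : ℝ) = x i := by
    have := (b.mem_span_iff_repr_mem ℤ x).1 hxL
    intro i
    obtain ⟨m, hm⟩ := this i
    exact ⟨m, by simpa [b] using hm⟩
  choose n hn using hint
  have hxn : (fun j => (n j : ℝ)) = x := funext hn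
  refine ⟨n, ?_, ?_⟩
  · rintro rfl
    apply hx0
    ext j
    simp [← hn]
  · rw [hxn, ← hmemS]
    exact hx

/-- The lower bound for the height reached by reduction. -/
def heightBound (p : ℕ) : ℝ := 10 * (p + 1) / (12.56 * (p ^ 2 + 1))

theorem heightBound_pos (p : ℕ) : 0 < heightBound p := by unfold heightBound; positivity

/-- Minkowski's theorem for the ellipsoid of squared radius 0.99. A level strictly below 1 rules out
(c, d) = 0, where the form is p e², and gives every reduction step a fixed gain. -/
theorem exists_small_vector_of_five_le {p : ℕ} (hp : 5 ≤ p) (x y u s W : ℝ) (hy : 0 < y)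
    (hW : 0 < W) (hWp : W < heightBound p) :
    ∃ c d e : ℤ, (c ≠ 0 ∨ d ≠ 0) ∧
      p * (e - d * u + c * s) ^ 2 + W * (((c * x + d) ^ 2 + (c * y) ^ 2) / y) ≤ 0.99 := by
  have hp5 : (5 : ℝ) ≤ p := by exact_mod_cast hp
  have hp0 : (0 : ℝ) < p := by linarith
  set α := Real.sqrt (W / y) with hα
  set β := Real.sqrt p with hβ
  have hα2 : α ^ 2 = W / y := Real.sq_sqrt (by positivity)
  have hβ2 : β ^ 2 = p := Real.sq_sqrt hp0.le
  have hα0 : 0 < α := Real.sqrt_pos.2 (by positivity)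
  have hβ0 : 0 < β := Real.sqrt_pos.2 hp0
  -- The form is the sum of the squares of the rows applied to (c, d, e), and |det A| = W√p does not
  -- depend on x, y, u, s.
  let A : Matrix (Fin 3) (Fin 3) ℝ := !![β * s, -(β * u), β; α * x, α, 0; α * y, 0, 0]
  have hdet : A.det = -(β * W) := by
    simp only [A, Matrix.det_fin_three, Matrix.of_apply, Matrix.cons_val', Matrix.cons_val_zero,
      Matrix.cons_val_one, Matrix.cons_val]
    have : α ^ 2 * y = W := by rw [hα2]; field_simp
    linear_combination (-β) * this
  have habs : |A.det| = β * W := by rw [hdet, abs_neg, abs_of_pos (by positivity)]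
  have hR : (0.99 : ℝ) ≤ Real.sqrt 0.99 := by
    apply Real.le_sqrt_of_sq_le; norm_num
  have hR2 : Real.sqrt 0.99 ^ 2 = 0.99 := Real.sq_sqrt (by norm_num)
  obtain ⟨n, hn0, hn⟩ := exists_int_mulVec_sq_lt A (by
      rw [hdet]; exact neg_ne_zero.2 (by positivity))
    (R := Real.sqrt 0.99) (by positivity) (by
      rw [habs]
      -- The constant exceeds 1/√5, and p ≥ 5.
      have h1 : β ≤ 0.4473 * p := by
        rw [hβ, Real.sqrt_le_left (by positivity)]; nlinarith
      have h2 : W * (12.56 * (p ^ 2 + 1)) < 10 * (p + 1) := by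
        rwa [heightBound, lt_div_iff₀ (by positivity)] at hWp
      have h3 : β * W * (12.56 * (p ^ 2 + 1)) < 0.4473 * p * (10 * (p + 1)) := by
        calc β * W * (12.56 * (p ^ 2 + 1)) = β * (W * (12.56 * (p ^ 2 + 1))) := by ring
          _ < β * (10 * (p + 1)) := mul_lt_mul_of_pos_left h2 hβ0
          _ ≤ _ := mul_le_mul_of_nonneg_right h1 (by positivity)
      have h4 : 8 * (β * W) < 4.05 := by
        by_contra! hcon
        nlinarith
      have h5 : Real.sqrt 0.99 ^ 3 = 0.99 * Real.sqrt 0.99 := by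
        rw [pow_succ, hR2]
      rw [h5]
      have := Real.pi_gt_d2
      nlinarith)
  have hsum : ∑ i, (A *ᵥ fun j => (n j : ℝ)) i ^ 2 = p * (n 2 - n 1 * u + n 0 * s) ^ 2 +
      W * (((n 0 * x + n 1) ^ 2 + (n 0 * y) ^ 2) / y) := by
    simp only [A, Matrix.mulVec, dotProduct, Fin.sum_univ_three, Matrix.of_apply,
      Matrix.cons_val', Matrix.cons_val_zero, Matrix.cons_val_one, Matrix.cons_val]
    have h1 : W * (((n 0 * x + n 1) ^ 2 + (n 0 * y) ^ 2) / y) =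
        W / y * ((n 0 * x + n 1) ^ 2 + (n 0 * y) ^ 2) := by ring
    rw [h1, ← hα2, ← hβ2]
    ring
  rw [hsum, hR2] at hn
  refine ⟨n 0, n 1, n 2, ?_, hn.le⟩
  by_contra! hcd
  obtain ⟨hc, hd⟩ := hcd
  rw [hc, hd] at hn
  simp only [Int.cast_zero, zero_mul, sub_zero, add_zero, ne_eq, OfNat.ofNat_ne_zero,
    not_false_eq_true, zero_pow, zero_div, mul_zero] at hn
  have he : n 2 ≠ 0 := by
    intro h2
    apply hn0
    ext i; fin_cases i <;> assumption
  have : (1 : ℝ) ≤ (n 2 : ℝ) ^ 2 := by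
    have : (1 : ℤ) ≤ n 2 ^ 2 := by have := sq_pos_of_ne_zero he; omega
    exact_mod_cast this
  nlinarith

/-- If both numbers are near 1/2 in absolute value, their sum is near an integer. With equal signs
one shifts by ±1; with opposite signs no shift is needed. In the explicit cases p = 2, 3 this makes
(1, ±1) short when (0, 1) and (1, 0) are not. -/
theorem exists_int_add_abs_le {U S : ℝ} (hU : |U| ≤ 1 / 2) (hS : |S| ≤ 1 / 2) :
    ∃ e : ℤ, |e + U + S| ≤ 1 - |U| - |S| := by
  rcases le_total 0 U with h1 | h1 <;> rcases le_total 0 S with h2 | h2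
  · refine ⟨-1, ?_⟩
    rw [abs_of_nonneg h1] at *; rw [abs_of_nonneg h2] at *
    rw [abs_le]; push_cast; constructor <;> linarith
  · refine ⟨0, ?_⟩
    rw [abs_of_nonneg h1] at *; rw [abs_of_nonpos h2] at *
    rw [abs_le]; push_cast; constructor <;> linarith
  · refine ⟨0, ?_⟩
    rw [abs_of_nonpos h1] at *; rw [abs_of_nonneg h2] at *
    rw [abs_le]; push_cast; constructor <;> linarith
  · refine ⟨1, ?_⟩
    rw [abs_of_nonpos h1] at *; rw [abs_of_nonpos h2] at *
    rw [abs_le]; push_cast; constructor <;> linarith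

/-- The explicit vectors that rule out a small height for `p = 2, 3`: if none of the vectors
with `(c, d) = (0, 1), (1, 0), (1, ±1), (0, 2)` is short, the bounds below hold. -/
theorem small_vector_constraints {P x y u s W : ℝ} (hP : 0 ≤ P) (hy : 0 < y)
    (h : ∀ c d e : ℤ, (c ≠ 0 ∨ d ≠ 0) →
      0.99 < P * (e - d * u + c * s) ^ 2 + W * (((c * x + d) ^ 2 + (c * y) ^ 2) / y)) :
    ∃ U S : ℝ, 0 ≤ U ∧ U ≤ 1 / 2 ∧ 0 ≤ S ∧ S ≤ 1 / 2 ∧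
      0.99 * y < P * U ^ 2 * y + W ∧ 0.99 * y < P * (1 - 2 * U) ^ 2 * y + 4 * W ∧
      0.99 * y < P * S ^ 2 * y + W * (x ^ 2 + y ^ 2) ∧
      0.99 * y < P * (1 - U - S) ^ 2 * y + W * ((1 - |x|) ^ 2 + y ^ 2) := by
  have hmul : ∀ Q V : ℝ, 0.99 < Q + W * (V / y) → 0.99 * y < Q * y + W * V := by
    intro Q V hQ
    have h1 := mul_lt_mul_of_pos_right hQ hy
    have h2 : (Q + W * (V / y)) * y = Q * y + W * V := by field_simp
    rwa [h2] at h1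
  have hU : |round u - u| ≤ 1 / 2 := by rw [abs_sub_comm]; exact abs_sub_round u
  have hS : |s - round s| ≤ 1 / 2 := abs_sub_round s
  refine ⟨|round u - u|, |s - round s|, abs_nonneg _, hU, abs_nonneg _, hS, ?_, ?_, ?_, ?_⟩
  · have := hmul _ _ (h 0 1 (round u) (by simp))
    simpa using this
  · obtain ⟨e, he⟩ := exists_int_add_abs_le hU hU
    have h1 := hmul _ _ (h 0 2 (e + 2 * round u) (by simp))
    have h2 : ((e + 2 * round u : ℤ) - (2 : ℤ) * u + (0 : ℤ) * s : ℝ) ^ 2 ≤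
        (1 - 2 * |round u - u|) ^ 2 := by
      rw [← sq_abs]
      refine pow_le_pow_left₀ (abs_nonneg _) ?_ 2
      refine le_trans (le_of_eq ?_) (he.trans (by linarith))
      congr 1; push_cast; ring
    have h3 := mul_le_mul_of_nonneg_right (mul_le_mul_of_nonneg_left h2 hP) hy.le
    push_cast at h1 h3
    linarith
  · have := hmul _ _ (h 1 0 (-round s) (by simp))
    have h2 : ((-round s : ℤ) - (0 : ℤ) * u + (1 : ℤ) * s : ℝ) ^ 2 = |s - round s| ^ 2 := by
      rw [sq_abs]; push_cast; ring
    rw [h2] at this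
    simpa using this
  · obtain ⟨σ, hσ, hσx⟩ : ∃ σ : ℤ, (σ = 1 ∨ σ = -1) ∧ (x + σ) ^ 2 = (1 - |x|) ^ 2 := by
      rcases le_total 0 x with hx | hx
      · exact ⟨-1, Or.inr rfl, by rw [abs_of_nonneg hx]; push_cast; ring⟩
      · exact ⟨1, Or.inl rfl, by rw [abs_of_nonpos hx]; push_cast; ring⟩
    have hσU : |σ * (round u - u)| = |round u - u| := by
      rcases hσ with h | h <;> simp [h]
      exact abs_sub_comm _ _
    obtain ⟨e, he⟩ := exists_int_add_abs_le (hσU.trans_le hU) hS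
    have h1 := hmul _ _ (h 1 σ (e + σ * round u - round s) (by simp))
    have h2 : ((e + σ * round u - round s : ℤ) - (σ : ℤ) * u + (1 : ℤ) * s : ℝ) ^ 2 ≤
        (1 - |round u - u| - |s - round s|) ^ 2 := by
      rw [← sq_abs]
      refine pow_le_pow_left₀ (abs_nonneg _) ?_ 2
      rw [hσU] at he
      refine le_trans (le_of_eq ?_) he
      congr 1; push_cast; ring
    have h3 := mul_le_mul_of_nonneg_right (mul_le_mul_of_nonneg_left h2 hP) hy.le
    push_cast at h1 h3
    rw [one_mul, one_mul, hσx] at h1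
    linarith

theorem lt_add_of_scaled {a q w κ y : ℝ} (hy : 0 < y) (h : a * y < q * y + w) (hw : w ≤ κ * y) :
    a < q + κ := by
  have : a * y < (q + κ) * y := by rw [add_mul]; linarith
  exact lt_of_mul_lt_mul_right this hy.le

theorem le_of_sq_lt {b U : ℝ} (hU : 0 ≤ U) (h : b ^ 2 < U ^ 2) : b ≤ U := by
  by_contra! hlt
  exact absurd (pow_le_pow_left₀ hU hlt.le 2) (not_le.2 h)

theorem fundamental_domain_bounds {x y : ℝ} (hy : 0 < y) (hx : |x| ≤ 1 / 2)
    (hxy : 1 ≤ x ^ 2 + y ^ 2) : x ^ 2 ≤ 1 / 4 ∧ 0.866 ≤ y := by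
  have hx2 : x ^ 2 ≤ 1 / 4 := by
    rw [← sq_abs]
    calc |x| ^ 2 ≤ (1 / 2) ^ 2 := pow_le_pow_left₀ (abs_nonneg x) hx 2
      _ = 1 / 4 := by norm_num
  exact ⟨hx2, le_of_sq_lt hy.le (by norm_num; linarith)⟩

/-- For p = 2 and 3 the volume bound of Minkowski's theorem falls short of the required threshold.
Instead x + iy is taken in the fundamental domain: if (0, 1) and (1, 0) are not short, then u and s
are both almost half-integral, so one of (1, ±1) is short. -/
theorem exists_small_vector_two (x y u s W : ℝ) (hy : 0 < y) (hx : |x| ≤ 1 / 2)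
    (hxy : 1 ≤ x ^ 2 + y ^ 2) (hW : 0 < W) (hWp : W < 0.4778) :
    ∃ c d e : ℤ, (c ≠ 0 ∨ d ≠ 0) ∧
      2 * (e - d * u + c * s) ^ 2 + W * (((c * x + d) ^ 2 + (c * y) ^ 2) / y) ≤ 0.99 := by
  by_contra! hcon
  obtain ⟨U, S, hU0, hU, hS0, hS, h1, -, h3, h4⟩ :=
    small_vector_constraints (P := 2) (by norm_num) hy hcon
  obtain ⟨hx2, hy1⟩ := fundamental_domain_bounds hy hx hxy
  have hU2 : U ^ 2 ≤ (1 / 2) ^ 2 := pow_le_pow_left₀ hU0 hU 2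
  have hy2 : y ≤ 0.9752 := by
    have : 2 * U ^ 2 * y ≤ 2 * (1 / 2) ^ 2 * y := by gcongr
    norm_num at this
    linarith
  -- This bounds the convex y² by its chord on the interval, hence (x² + y²) / y by a constant.
  have hyy := mul_nonneg (sub_nonneg.2 hy1) (sub_nonneg.2 hy2)
  have hU3 : 0.468 ≤ U := by
    refine le_of_sq_lt hU0 ?_
    have := lt_add_of_scaled hy h1 (κ := 0.5518) (by linarith)
    norm_num; linarith
  have hx3 : 0.2212 ≤ |x| := by
    refine le_of_sq_lt (abs_nonneg x) ?_
    rw [sq_abs]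
    have : y ^ 2 ≤ 0.9752 ^ 2 := pow_le_pow_left₀ hy.le hy2 2
    norm_num at this ⊢; linarith
  have hS2 : 0.445 ≤ S := by
    refine le_of_sq_lt hS0 ?_
    have e1 : W * (x ^ 2 + y ^ 2) ≤ 0.4778 * (1.24 * y) :=
      mul_le_mul hWp.le (by nlinarith only [hyy, hx2, hy2]) (by positivity) (by norm_num)
    have := lt_add_of_scaled hy h3 (κ := 0.4778 * 1.24) (by linarith)
    norm_num at this ⊢; linarith
  have e3 : (1 - |x|) ^ 2 ≤ 0.7788 ^ 2 := pow_le_pow_left₀ (by linarith) (by linarith) 2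
  have e4 : (1 - U - S) ^ 2 ≤ 0.087 ^ 2 := pow_le_pow_left₀ (by linarith) (by linarith) 2
  have e5 : W * ((1 - |x|) ^ 2 + y ^ 2) ≤ 0.4778 * (1.6 * y) :=
    mul_le_mul hWp.le (by nlinarith only [hyy, e3, hy2, hy1]) (by positivity) (by norm_num)
  have := lt_add_of_scaled hy h4 (κ := 0.4778 * 1.6) (by linarith)
  norm_num at this e4; linarith

theorem exists_small_vector_three (x y u s W : ℝ) (hy : 0 < y) (hx : |x| ≤ 1 / 2)
    (hxy : 1 ≤ x ^ 2 + y ^ 2) (hW : 0 < W) (hWp : W < 0.3185) :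
    ∃ c d e : ℤ, (c ≠ 0 ∨ d ≠ 0) ∧
      3 * (e - d * u + c * s) ^ 2 + W * (((c * x + d) ^ 2 + (c * y) ^ 2) / y) ≤ 0.99 := by
  by_contra! hcon
  obtain ⟨U, S, hU0, hU, hS0, hS, h1, h2, h3, h4⟩ :=
    small_vector_constraints (P := 3) (by norm_num) hy hcon
  obtain ⟨hx2, hy1⟩ := fundamental_domain_bounds hy hx hxy
  have hU3 : 0.455 ≤ U := by
    refine le_of_sq_lt hU0 ?_
    have := lt_add_of_scaled hy h1 (κ := 0.368) (by linarith)
    norm_num; linarith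
  -- For p = 3 the upper bound on y comes from the vector (0, 2): 2u is close to an integer because
  -- U is close to 1/2.
  have hy2 : y ≤ 1.32 := by
    have e1 : (1 - 2 * U) ^ 2 ≤ 0.09 ^ 2 := pow_le_pow_left₀ (by linarith) (by linarith) 2
    have e2 : 3 * (1 - 2 * U) ^ 2 * y ≤ 3 * 0.09 ^ 2 * y := by gcongr
    norm_num at e2; linarith
  have hyy := mul_nonneg (sub_nonneg.2 hy1) (sub_nonneg.2 hy2)
  have hS2 : 0.41 ≤ S := by
    refine le_of_sq_lt hS0 ?_
    have e1 : W * (x ^ 2 + y ^ 2) ≤ 0.3185 * (1.52 * y) :=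
      mul_le_mul hWp.le (by nlinarith only [hyy, hx2, hy2]) (by positivity) (by norm_num)
    have := lt_add_of_scaled hy h3 (κ := 0.3185 * 1.52) (by linarith)
    norm_num at this ⊢; linarith
  have e3 : (1 - |x|) ^ 2 ≤ 1 ^ 2 := pow_le_pow_left₀ (by linarith) (by linarith [abs_nonneg x]) 2
  have e4 : (1 - U - S) ^ 2 ≤ 0.135 ^ 2 := pow_le_pow_left₀ (by linarith) (by linarith) 2
  have e5 : W * ((1 - |x|) ^ 2 + y ^ 2) ≤ 0.3185 * (2.08 * y) :=
    mul_le_mul hWp.le (by nlinarith only [hyy, e3, hy2, hy1]) (by positivity) (by norm_num)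
  have := lt_add_of_scaled hy h4 (κ := 0.3185 * 2.08) (by linarith)
  norm_num at this e4; linarith

theorem exists_small_vector {p : ℕ} (hp : p.Prime) (x y u s W : ℝ) (hy : 0 < y) (hx : |x| ≤ 1 / 2)
    (hxy : 1 ≤ x ^ 2 + y ^ 2) (hW : 0 < W) (hWp : W < heightBound p) :
    ∃ c d e : ℤ, (c ≠ 0 ∨ d ≠ 0) ∧
      p * (e - d * u + c * s) ^ 2 + W * (((c * x + d) ^ 2 + (c * y) ^ 2) / y) ≤ 0.99 := by
  rcases le_or_gt 5 p with h5 | h5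
  · exact exists_small_vector_of_five_le h5 x y u s W hy hW hWp
  · have h2 := hp.two_le
    interval_cases p
    · exact_mod_cast exists_small_vector_two x y u s W hy hx hxy hW
        (hWp.trans_le (by norm_num [heightBound]))
    · exact_mod_cast exists_small_vector_three x y u s W hy hx hxy hW
        (hWp.trans_le (by norm_num [heightBound]))
    · exact absurd hp (by norm_num)

end

/-! ### Reduction theory: every orbit reaches the height bound -/

section

open Complex Set Filter Topology

/-- `det (Im Ω)`. -/
def imDet (v : ℂ × ℂ × ℂ) : ℝ := v.1.im * v.2.2.im - v.2.1.im ^ 2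

/-- The height `det (Im Ω) / Im τ` of `Ω` with respect to the cusp `ω → i∞`. -/
def cuspHeight (v : ℂ × ℂ × ℂ) : ℝ := imDet v / v.1.im

theorem imDet_pos {v : ℂ × ℂ × ℂ} (hv : v ∈ siegelDomain) : 0 < imDet v := sub_pos.2 hv.2

theorem cuspHeight_pos {v : ℂ × ℂ × ℂ} (hv : v ∈ siegelDomain) : 0 < cuspHeight v :=
  div_pos (imDet_pos hv) hv.1

/-- The `SL₂`-action on `τ`, extended to the Siegel upper half space. -/
def slAct (a b c d : ℤ) (v : ℂ × ℂ × ℂ) : ℂ × ℂ × ℂ :=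
  ((a * v.1 + b) / (c * v.1 + d), v.2.1 / (c * v.1 + d),
    v.2.2 - c * v.2.1 ^ 2 / (c * v.1 + d))

/-- The Fricke involution. -/
def frickeAct (p : ℕ) (v : ℂ × ℂ × ℂ) : ℂ × ℂ × ℂ := (p * v.2.2, -v.2.1, v.1 / p)

/-- Functions on the Siegel upper half space that are invariant under the paramodular group and
the Fricke involution. -/
structure IsInvariant (p : ℕ) (h : ℂ × ℂ × ℂ → ℝ) : Prop where
  lin : ∀ a b c d : ℤ, (p : ℤ) ∣ b → a * d - b * c = 1 → ∀ v ∈ siegelDomain,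
    h (symConj a b c d v) = h v
  sl2 : ∀ a b c d : ℤ, a * d - b * c = 1 → ∀ v ∈ siegelDomain, h (slAct a b c d v) = h v
  fricke : ∀ v ∈ siegelDomain, h (frickeAct p v) = h v

theorem imDet_symConj {a b c d : ℤ} (hdet : a * d - b * c = 1) (v : ℂ × ℂ × ℂ) :
    imDet (symConj a b c d v) = imDet v := by
  obtain ⟨τ, z, ω⟩ := v
  obtain ⟨e1, e2, e3⟩ := IsParamodularCusp.symConj_im a b c d τ z ω
  rw [imDet, e1, e2, e3, imDet]
  have hd : ((a : ℝ) * d - b * c) ^ 2 = 1 := by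
    have : ((a : ℝ) * d - b * c) = 1 := by exact_mod_cast hdet
    rw [this, one_pow]
  linear_combination (τ.im * ω.im - z.im ^ 2) * hd

theorem frickeAct_mem {p : ℕ} (hp : 0 < p) {v : ℂ × ℂ × ℂ} (hv : v ∈ siegelDomain) :
    frickeAct p v ∈ siegelDomain := by
  obtain ⟨τ, z, ω⟩ := v
  have hω := im_pos_of_mem hv
  have hp' : (0 : ℝ) < p := by exact_mod_cast hp
  obtain ⟨h1, h2⟩ := mem_siegelDomain.1 hv
  refine ⟨?_, ?_⟩
  · simpa [frickeAct] using mul_pos hp' hω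
  · have : (p * ω.im) * (τ.im / p) = τ.im * ω.im := by field_simp
    simpa [frickeAct, this] using h2

theorem imDet_frickeAct {p : ℕ} (hp : 0 < p) (v : ℂ × ℂ × ℂ) :
    imDet (frickeAct p v) = imDet v := by
  have hp' : (p : ℝ) ≠ 0 := by exact_mod_cast hp.ne'
  have : (p * v.2.2.im) * (v.1.im / p) = v.1.im * v.2.2.im := by field_simp
  simp [imDet, frickeAct, this]

section SL2

variable {a b c d : ℤ} {v : ℂ × ℂ × ℂ}

theorem normSq_denom_pos (hdet : a * d - b * c = 1) (hv : 0 < v.1.im) :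
    0 < (c * v.1.re + d) ^ 2 + (c * v.1.im) ^ 2 := by
  rcases eq_or_ne c 0 with hc | hc
  · have hd : (d : ℝ) ≠ 0 := by
      rintro h
      have : d = 0 := by exact_mod_cast h
      simp [hc, this] at hdet
    rw [hc]; simp; positivity
  · have : (c : ℝ) ≠ 0 := by exact_mod_cast hc
    positivity

theorem slAct_im (a b c d : ℤ) (v : ℂ × ℂ × ℂ) (hdet : a * d - b * c = 1) :
    (slAct a b c d v).1.im = v.1.im / ((c * v.1.re + d) ^ 2 + (c * v.1.im) ^ 2) ∧
    (slAct a b c d v).2.1.im = (v.2.1.im * (c * v.1.re + d) - v.2.1.re * (c * v.1.im)) /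
      ((c * v.1.re + d) ^ 2 + (c * v.1.im) ^ 2) ∧
    (slAct a b c d v).2.2.im = v.2.2.im - c * (2 * v.2.1.re * v.2.1.im * (c * v.1.re + d) -
      (v.2.1.re ^ 2 - v.2.1.im ^ 2) * (c * v.1.im)) /
      ((c * v.1.re + d) ^ 2 + (c * v.1.im) ^ 2) := by
  have hn : Complex.normSq (c * v.1 + d) = (c * v.1.re + d) ^ 2 + (c * v.1.im) ^ 2 := by
    rw [Complex.normSq_apply]; simp; ring
  have hdetR : (a * d - b * c : ℝ) = 1 := by exact_mod_cast hdet
  refine ⟨?_, ?_, ?_⟩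
  · simp only [slAct]
    rw [Complex.div_im, hn, ← sub_div]
    congr 1
    simp
    linear_combination v.1.im * hdetR
  · simp only [slAct]
    rw [Complex.div_im, hn, ← sub_div]
    congr 1
    simp
  · simp only [slAct]
    rw [Complex.sub_im, Complex.div_im, hn, ← sub_div]
    congr 2
    simp [pow_two]
    ring

theorem imDet_slAct (hdet : a * d - b * c = 1) (hv : 0 < v.1.im) :
    imDet (slAct a b c d v) = imDet v / ((c * v.1.re + d) ^ 2 + (c * v.1.im) ^ 2) := by
  obtain ⟨e1, e2, e3⟩ := slAct_im a b c d v hdet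
  have hn := normSq_denom_pos hdet hv
  rw [imDet, e1, e2, e3, imDet]
  generalize hnd : (c * v.1.re + d) ^ 2 + (c * v.1.im) ^ 2 = n at hn ⊢
  field_simp
  rw [← hnd]
  ring

theorem slAct_mem (hdet : a * d - b * c = 1) (hv : v ∈ siegelDomain) :
    slAct a b c d v ∈ siegelDomain := by
  have hn := normSq_denom_pos hdet hv.1
  refine ⟨?_, sub_pos.1 ?_⟩
  · rw [(slAct_im a b c d v hdet).1]; exact div_pos hv.1 hn
  · have := imDet_slAct hdet hv.1
    rw [imDet] at this
    rw [this]
    exact div_pos (imDet_pos hv) hn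

theorem cuspHeight_slAct (hdet : a * d - b * c = 1) (hv : 0 < v.1.im) :
    cuspHeight (slAct a b c d v) = cuspHeight v := by
  have hn := normSq_denom_pos hdet hv
  rw [cuspHeight, imDet_slAct hdet hv, (slAct_im a b c d v hdet).1, cuspHeight]
  exact div_div_div_cancel_right₀ hn.ne' _ _

end SL2

namespace IsInvariant

variable {p : ℕ} {h : ℂ × ℂ × ℂ → ℝ}

/-- Let N be the value of Y at (e, -g). If p divides g, then (e, -g) is the first row of an
admissible U and N becomes the new Im τ. Otherwise it is the second row of one, N becomes Im ω, and
the Fricke involution turns this into Im τ = pN. Both maps preserve det(Y), so small N means large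
height. -/
theorem exists_im_le_of_coprime (hh : IsInvariant p h) (hp : p.Prime) {v : ℂ × ℂ × ℂ}
    (hv : v ∈ siegelDomain) {g e : ℤ} (hge : IsCoprime g e) :
    ∃ v' ∈ siegelDomain, h v' = h v ∧ imDet v' = imDet v ∧
      v'.1.im ≤ p * (v.1.im * e ^ 2 - 2 * v.2.1.im * e * g + v.2.2.im * g ^ 2) ∧
      v.1.im * e ^ 2 - 2 * v.2.1.im * e * g + v.2.2.im * g ^ 2 ≤ v'.1.im := by
  have hp1 : (1 : ℝ) ≤ p := by exact_mod_cast hp.one_le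
  obtain ⟨τ, z, ω⟩ := v
  by_cases hpg : (p : ℤ) ∣ g
  · obtain ⟨c, d, hcd⟩ := hge
    have hdet : e * d - (-g) * c = 1 := by linear_combination hcd
    have hmem := IsParamodularCusp.symConj_mem e (-g) c d hdet hv
    have him := (IsParamodularCusp.symConj_im e (-g) c d τ z ω).1
    have hN : (symConj e (-g) c d (τ, z, ω)).1.im =
        τ.im * e ^ 2 - 2 * z.im * e * g + ω.im * g ^ 2 := by
      rw [him]; push_cast; ring
    refine ⟨_, hmem, hh.lin e (-g) c d ((dvd_neg).2 hpg) hdet _ hv, imDet_symConj hdet _, ?_, hN.ge⟩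
    have := hmem.1
    rw [hN] at this ⊢
    simp only
    nlinarith
  · have hcop : IsCoprime g (p * e) :=
      IsCoprime.mul_right ((Nat.prime_iff_prime_int.1 hp).coprime_iff_not_dvd.2 hpg).symm hge
    obtain ⟨a, b, hab⟩ := hcop
    have hdet : (-a) * (-g) - (-(p * b)) * e = 1 := by linear_combination hab
    have hmem := IsParamodularCusp.symConj_mem (-a) (-(p * b)) e (-g) hdet hv
    have him := (IsParamodularCusp.symConj_im (-a) (-(p * b)) e (-g) τ z ω).2.2
    have hN : (symConj (-a) (-(p * b)) e (-g) (τ, z, ω)).2.2.im =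
        τ.im * e ^ 2 - 2 * z.im * e * g + ω.im * g ^ 2 := by
      rw [him]; push_cast; ring
    have hpos : 0 < (symConj (-a) (-(p * b)) e (-g) (τ, z, ω)).2.2.im := im_pos_of_mem hmem
    have hN2 : (frickeAct p (symConj (-a) (-(p * b)) e (-g) (τ, z, ω))).1.im =
        p * (τ.im * e ^ 2 - 2 * z.im * e * g + ω.im * g ^ 2) := by
      rw [← hN]; simp [frickeAct]
    refine ⟨_, frickeAct_mem hp.pos hmem, ?_, ?_, hN2.le, ?_⟩
    · rw [hh.fricke _ hmem, hh.lin _ _ _ _ ((dvd_neg).2 (dvd_mul_right _ _)) hdet _ hv]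
    · rw [imDet_frickeAct hp.pos, imDet_symConj hdet]
    · rw [hN] at hpos
      rw [hN2]
      simp only
      nlinarith

theorem form_eq {v : ℂ × ℂ × ℂ} (hv : v ∈ siegelDomain) (g e : ℝ) :
    v.1.im * e ^ 2 - 2 * v.2.1.im * e * g + v.2.2.im * g ^ 2 =
      v.1.im * (e - v.2.1.im / v.1.im * g) ^ 2 + cuspHeight v * g ^ 2 := by
  have := hv.1.ne'
  rw [cuspHeight, imDet]
  field_simp
  ring

/-- A reduction step inside the Levi subgroup. -/
theorem exists_im_le (hh : IsInvariant p h) (hp : p.Prime) {v : ℂ × ℂ × ℂ}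
    (hv : v ∈ siegelDomain) {g : ℤ} (e : ℤ) (hg : g ≠ 0) :
    ∃ v' ∈ siegelDomain, h v' = h v ∧ imDet v' = imDet v ∧
      v'.1.im ≤ p * (v.1.im * (e - v.2.1.im / v.1.im * g) ^ 2 + cuspHeight v * g ^ 2) ∧
      cuspHeight v ≤ v'.1.im := by
  have hG : 0 < Int.gcd g e := Int.gcd_pos_iff.2 (Or.inl hg)
  obtain ⟨g', e', hcop, hg', he'⟩ := Int.exists_gcd_one hG
  set G : ℤ := (Int.gcd g e : ℤ) with hGd
  have hG1 : (1 : ℝ) ≤ G := by rw [hGd]; exact_mod_cast hG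
  have hg0 : g' ≠ 0 := by rintro rfl; simp at hg'; exact hg hg'
  obtain ⟨v', hv', h1, h2, h3, h4⟩ :=
    hh.exists_im_le_of_coprime hp hv (Int.isCoprime_iff_gcd_eq_one.2 hcop)
  rw [form_eq hv] at h3 h4
  have hw := cuspHeight_pos hv
  have hp0 : (0 : ℝ) ≤ p := Nat.cast_nonneg p
  have hy := hv.1
  refine ⟨v', hv', h1, h2, h3.trans ?_, ?_⟩
  · refine mul_le_mul_of_nonneg_left ?_ hp0
    have e1 : v.1.im * ((e : ℝ) - v.2.1.im / v.1.im * g) ^ 2 + cuspHeight v * (g : ℝ) ^ 2 =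
        (G : ℝ) ^ 2 * (v.1.im * (e' - v.2.1.im / v.1.im * g') ^ 2 + cuspHeight v * g' ^ 2) := by
      rw [hg', he']; push_cast; ring
    rw [e1]
    exact le_mul_of_one_le_left (by positivity) (one_le_pow₀ hG1)
  · refine le_trans ?_ h4
    have : (1 : ℝ) ≤ (g' : ℝ) ^ 2 := by
      have : (1 : ℤ) ≤ g' ^ 2 := by have := sq_pos_of_ne_zero hg0; omega
      exact_mod_cast this
    have h5 : 0 ≤ v.1.im * (e' - v.2.1.im / v.1.im * g') ^ 2 := by positivity
    nlinarith

/-- A lattice vector of small norm yields a point of larger height. -/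
theorem exists_cuspHeight_ge (hh : IsInvariant p h) (hp : p.Prime) {v : ℂ × ℂ × ℂ}
    (hv : v ∈ siegelDomain) {c d e : ℤ} (hcd : c ≠ 0 ∨ d ≠ 0) {κ : ℝ} (hκ : 0 < κ)
    (hle : p * (e - d * (v.2.1.im / v.1.im) + c * (v.2.1.re - v.2.1.im / v.1.im * v.1.re)) ^ 2 +
      (p * cuspHeight v) * (((c * v.1.re + d) ^ 2 + (c * v.1.im) ^ 2) / v.1.im) ≤ κ) :
    ∃ v' ∈ siegelDomain, h v' = h v ∧ cuspHeight v / κ ≤ cuspHeight v' := by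
  have hG : 0 < Int.gcd c d := Int.gcd_pos_iff.2 hcd
  obtain ⟨c', d', hcop, hc', hd'⟩ := Int.exists_gcd_one hG
  set G : ℤ := (Int.gcd c d : ℤ) with hGd
  have hG0 : G ≠ 0 := by rw [hGd]; exact_mod_cast hG.ne'
  obtain ⟨b', a, hab⟩ := Int.isCoprime_iff_gcd_eq_one.2 hcop
  have hdet : a * d' - (-b') * c' = 1 := by linear_combination hab
  have hmem := slAct_mem hdet hv
  have hn := normSq_denom_pos hdet hv.1
  obtain ⟨e1, e2, -⟩ := slAct_im a (-b') c' d' v hdet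
  have hheight := cuspHeight_slAct hdet hv.1
  have hy := hv.1
  -- The vector (c, d, e) is split as G(c', d') and e. The primitive pair acts through SL₂,
  -- preserving the height and dividing det(Y) by n = |c'τ + d'|²; the pair (G, e) then acts through
  -- the Levi subgroup.
  obtain ⟨v', hv', h1, h2, h3, h4⟩ := hh.exists_im_le hp hmem e hG0
  refine ⟨v', hv', h1.trans (hh.sl2 _ _ _ _ hdet v hv), ?_⟩
  set n := (c' * v.1.re + d') ^ 2 + (c' * v.1.im) ^ 2 with hnd
  have hw := cuspHeight_pos hv
  -- With z = uτ + s, the SL₂ step changes u into d'u - c's.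
  have hu : (slAct a (-b') c' d' v).2.1.im / (slAct a (-b') c' d' v).1.im =
      d' * (v.2.1.im / v.1.im) - c' * (v.2.1.re - v.2.1.im / v.1.im * v.1.re) := by
    rw [e1, e2]
    field_simp
    ring
  rw [hheight, hu, e1] at h3
  have hle2 : v'.1.im ≤ κ * (v.1.im / n) := by
    refine h3.trans ?_
    have hmul := mul_le_mul_of_nonneg_right hle (by positivity : 0 ≤ v.1.im / n)
    refine le_trans (le_of_eq ?_) hmul
    have hns : (c * v.1.re + d) ^ 2 + (c * v.1.im) ^ 2 = (G : ℝ) ^ 2 * n := by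
      rw [hnd, hc', hd']; push_cast; ring
    rw [hns, hc', hd']
    push_cast
    field_simp
    ring
  rw [div_le_iff₀ hκ]
  have hv'0 := hv'.1
  rw [show cuspHeight v' = imDet v' / v'.1.im from rfl, h2, imDet_slAct hdet hv.1, ← hnd, div_mul_eq_mul_div, le_div_iff₀ hv'0]
  calc cuspHeight v * v'.1.im ≤ cuspHeight v * (κ * (v.1.im / n)) :=
        mul_le_mul_of_nonneg_left hle2 hw.le
    _ = imDet v / n * κ := by rw [cuspHeight]; field_simp

theorem exists_fundamental (hh : IsInvariant p h) {v : ℂ × ℂ × ℂ} (hv : v ∈ siegelDomain) :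
    ∃ v' ∈ siegelDomain, h v' = h v ∧ cuspHeight v' = cuspHeight v ∧ |v'.1.re| ≤ 1 / 2 ∧
      1 ≤ v'.1.re ^ 2 + v'.1.im ^ 2 := by
  obtain ⟨g, hg1, hg2⟩ := ModularGroup.exists_smul_mem_fd ⟨v.1, hv.1⟩
  have hdet : g 0 0 * g 1 1 - g 0 1 * g 1 0 = 1 := by
    have := g.det_coe
    rwa [Matrix.det_fin_two] at this
  have hcoe : ((g • (⟨v.1, hv.1⟩ : ℍ) : ℍ) : ℂ) = (slAct (g 0 0) (g 0 1) (g 1 0) (g 1 1) v).1 := by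
    rw [UpperHalfPlane.specialLinearGroup_apply]
    simp [slAct]
  refine ⟨slAct (g 0 0) (g 0 1) (g 1 0) (g 1 1) v, slAct_mem hdet hv, hh.sl2 _ _ _ _ hdet v hv,
    cuspHeight_slAct hdet hv.1, ?_, ?_⟩
  · rw [← hcoe]; exact hg2
  · rw [← hcoe]
    rw [Complex.normSq_apply] at hg1
    linarith

/-- No maximum of the height on the orbit is needed: below the threshold each step multiplies the
height by at least 1/0.99, so the threshold is passed after finitely many steps. -/
theorem exists_heightBound_le (hh : IsInvariant p h) (hp : p.Prime) {v : ℂ × ℂ × ℂ}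
    (hv : v ∈ siegelDomain) :
    ∃ v' ∈ siegelDomain, h v' = h v ∧ heightBound p ≤ p * cuspHeight v' := by
  have hp0 : (0 : ℝ) < p := by exact_mod_cast hp.pos
  have step : ∀ n : ℕ, ∃ v' ∈ siegelDomain, h v' = h v ∧
      (heightBound p ≤ p * cuspHeight v' ∨ cuspHeight v * ((0.99 : ℝ)⁻¹) ^ n ≤ cuspHeight v') := by
    intro n
    induction n with
    | zero => exact ⟨v, hv, rfl, Or.inr (by simp)⟩
    | succ n ih =>
      obtain ⟨v₁, hv₁, h1, h2⟩ := ih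
      by_cases hb : heightBound p ≤ p * cuspHeight v₁
      · exact ⟨v₁, hv₁, h1, Or.inl hb⟩
      have h2 := h2.resolve_left hb
      obtain ⟨v₂, hv₂, h3, h4, h5, h6⟩ := hh.exists_fundamental hv₁
      rw [← h4] at hb h2
      obtain ⟨c, d, e, hcd, hle⟩ := exists_small_vector hp v₂.1.re v₂.1.im
        (v₂.2.1.im / v₂.1.im) (v₂.2.1.re - v₂.2.1.im / v₂.1.im * v₂.1.re) (p * cuspHeight v₂)
        hv₂.1 h5 h6 (mul_pos hp0 (cuspHeight_pos hv₂)) (not_le.1 hb)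
      obtain ⟨v₃, hv₃, h7, h8⟩ := hh.exists_cuspHeight_ge hp hv₂ hcd (by norm_num) hle
      refine ⟨v₃, hv₃, h7.trans (h3.trans h1), Or.inr (le_trans ?_ h8)⟩
      rw [pow_succ, ← mul_assoc, div_eq_mul_inv]
      exact mul_le_mul_of_nonneg_right h2 (by norm_num)
  obtain ⟨n, hn⟩ := pow_unbounded_of_one_lt (heightBound p / (p * cuspHeight v))
    (by norm_num : (1 : ℝ) < 0.99⁻¹)
  obtain ⟨v', hv', h1, h2⟩ := step n
  refine ⟨v', hv', h1, ?_⟩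
  rcases h2 with h2 | h2
  · exact h2
  · have hw := cuspHeight_pos hv
    rw [div_lt_iff₀ (by positivity)] at hn
    have := mul_le_mul_of_nonneg_left h2 hp0.le
    linarith

end IsInvariant

end

/-! ### Boundedness of the Petersson function -/

section

open Complex Set Filter Topology

theorem quadratic_nonneg {A B r u : ℝ} (hA : 0 ≤ A) (hB : 0 ≤ B) (hr : r ^ 2 ≤ 4 * A * B) :
    0 ≤ A + r * u + B * u ^ 2 := by
  rcases hB.eq_or_lt with rfl | hB
  · have : r = 0 := by
      have : r ^ 2 ≤ 0 := by simpa using hr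
      exact pow_eq_zero_iff two_ne_zero |>.1 (le_antisymm this (sq_nonneg r))
    simpa [this] using hA
  · have h1 : 4 * B * (A + r * u + B * u ^ 2) = (2 * B * u + r) ^ 2 + (4 * A * B - r ^ 2) := by ring
    have h2 : 0 ≤ 4 * B * (A + r * u + B * u ^ 2) := by
      rw [h1]; have := sub_nonneg.2 hr; positivity
    exact nonneg_of_mul_nonneg_right h2 (by positivity)

/-- On a Siegel set the trace form `tr(TY)` is bounded below by its diagonal part. -/
theorem trace_lower_bound {y u w C n r M : ℝ} (hy : 0 < y) (hw : 0 < w) (hC : 0 ≤ C)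
    (hyw : y ≤ C * w) (hu : |u| ≤ 1 / 2) (hn : 0 ≤ n) (hM : 0 ≤ M) (hr : r ^ 2 ≤ 4 * n * M) :
    1 / (2 * (1 + C)) * (n * y + M * w) ≤ n * y + r * (u * y) + M * (w + u ^ 2 * y) := by
  have hu2 : u ^ 2 ≤ 1 / 4 := by
    rw [← sq_abs]
    calc |u| ^ 2 ≤ (1 / 2) ^ 2 := pow_le_pow_left₀ (abs_nonneg u) hu 2
      _ = 1 / 4 := by norm_num
  have hq0 := quadratic_nonneg (u := u) hn hM hr
  -- The form (n/2, r, 2M) has the same discriminant, so it is semidefinite too. This gives q ≥ n/2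
  -- - M/4, and y ≤ Cw lets the Mw term absorb the loss My/4.
  have hq1 := quadratic_nonneg (A := n / 2) (B := 2 * M) (r := r) (u := u) (by positivity) (by positivity)
    (by linarith)
  have hq2 : n / 2 - M / 4 ≤ n + r * u + M * u ^ 2 := by
    have := mul_le_mul_of_nonneg_left hu2 hM
    linarith
  set q := n + r * u + M * u ^ 2 with hq
  have hE : n * y + r * (u * y) + M * (w + u ^ 2 * y) = q * y + M * w := by rw [hq]; ring
  have hC1 : 0 < 1 + C := by positivity
  have hMw : 0 ≤ M * w := by positivity
  have hMy : M * y ≤ C * (M * w) := by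
    calc M * y ≤ M * (C * w) := mul_le_mul_of_nonneg_left hyw hM
      _ = _ := by ring
  have h1 : n * y / 2 - M * y / 4 ≤ q * y := by
    have := mul_le_mul_of_nonneg_right hq2 hy.le
    linarith
  have h0 : 0 ≤ q * y := by positivity
  rw [hE, div_mul_eq_mul_div, one_mul, div_le_iff₀ (by positivity)]
  have h2 : 0 ≤ C * (q * y) := by positivity
  have h3 : 0 ≤ C * (M * w) := by positivity
  linarith

namespace IsParamodularCusp

variable {p k : ℕ} {F : ℂ × ℂ × ℂ → ℂ}

/-- The invariant function `|F|² det(Y)^k`. -/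
def petersson (k : ℕ) (F : ℂ × ℂ × ℂ → ℂ) (v : ℂ × ℂ × ℂ) : ℝ := ‖F v‖ ^ 2 * imDet v ^ k

theorem isInvariant_petersson (hF : IsParamodularCusp p k F) (hp : 0 < p) :
    IsInvariant p (petersson k F) where
  lin a b c d hb hdet v hv := by
    rw [petersson, hF.lin a b c d hb hdet v hv, imDet_symConj hdet, petersson]
  sl2 a b c d hdet v hv := by
    have hn := normSq_denom_pos hdet hv.1
    have hnorm : ‖(c * v.1 + d : ℂ)‖ ^ 2 = (c * v.1.re + d) ^ 2 + (c * v.1.im) ^ 2 := by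
      rw [← Complex.normSq_eq_norm_sq, Complex.normSq_apply]; simp; ring
    rw [petersson, slAct, hF.sl2 a b c d hdet v.1 v.2.1 v.2.2 hv]
    have := imDet_slAct hdet hv.1
    rw [slAct] at this
    rw [this, norm_mul, norm_pow, mul_pow, ← pow_mul, mul_comm k 2, pow_mul, hnorm, petersson,
      div_pow]
    generalize (c * v.1.re + d) ^ 2 + (c * v.1.im) ^ 2 = n at hn
    change n ^ k * ‖F v‖ ^ 2 * (imDet v ^ k / n ^ k) = _
    field_simp
  fricke v hv := by
    rw [petersson, imDet_frickeAct hp, petersson, frickeAct, hF.fricke v.1 v.2.1 v.2.2 hv]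

/-- On a Siegel set tr(TY) dominates ny + Mw. Since n, M ≥ 1, half of it gives the decay e^{-b(y +
w)/2}, and the other half leaves a convergent series at the fixed point Y = η·1. The decay beats
(yw)^k. -/
theorem petersson_le_of_siegel_set (hF : IsParamodularCusp p k F) (hp : p.Prime) {c C : ℝ}
    (hc : 0 < c) (hC : 0 ≤ C) :
    ∃ B, ∀ v ∈ siegelDomain, c ≤ v.1.im → c ≤ cuspHeight v → v.1.im ≤ C * cuspHeight v →
      |v.2.1.im / v.1.im| ≤ 1 / 2 → petersson k F v ≤ B := by
  set ε : ℝ := 1 / (2 * (1 + C)) with hε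
  have hε0 : 0 < ε := by positivity
  set η : ℝ := ε * c / 2 with hη
  have hη0 : 0 < η := by positivity
  have hsum := hF.summable_norm_coeff (y₁ := η) (v := 0) (y₂ := η) hη0 (by simp; positivity)
  set K : ℝ := ∑' T : ℤ × ℤ × ℤ, ‖coeff F T.2.2 T.2.1 T.1‖ *
      Real.exp (-(2 * Real.pi * (T.2.2 * η + T.2.1 * 0 + T.1 * η))) with hK
  set b : ℝ := 2 * Real.pi * ε with hb
  have hb0 : 0 < b := by positivity
  refine ⟨K ^ 2 * ((2 * k).factorial / b ^ (2 * k)), fun v hv h1 h2 h3 h4 => ?_⟩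
  obtain ⟨τ, z, ω⟩ := v
  have hy := hv.1
  have hw := cuspHeight_pos hv
  have hdet : imDet (τ, z, ω) = τ.im * cuspHeight (τ, z, ω) := by
    rw [cuspHeight]; exact (mul_div_cancel₀ _ hv.1.ne').symm
  have hv2 : z.im = z.im / τ.im * τ.im := (div_mul_cancel₀ _ hv.1.ne').symm
  have hω : ω.im = cuspHeight (τ, z, ω) + (z.im / τ.im) ^ 2 * τ.im := by
    have := hv.1.ne'
    simp only at this
    rw [cuspHeight, imDet]; field_simp; ring
  simp only at h1 h3 h4 hy
  set y := τ.im
  set w := cuspHeight (τ, z, ω)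
  set u := z.im / y
  have hterm : ∀ T : ℤ × ℤ × ℤ, ‖coeff F T.2.2 T.2.1 T.1 * e (T.2.2 * τ + T.2.1 * z + T.1 * ω)‖ ≤
      ‖coeff F T.2.2 T.2.1 T.1‖ * Real.exp (-(2 * Real.pi * (T.2.2 * η + T.2.1 * 0 + T.1 * η))) *
        Real.exp (-(b / 2 * (y + w))) := by
    rintro ⟨M, r, n⟩
    by_cases h0 : coeff F n r M = 0
    · simp [h0]
    obtain ⟨hn, hM, hr⟩ := hF.coeff_posDef hp h0
    have hn' : (1 : ℝ) ≤ n := by exact_mod_cast hn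
    have hM' : (1 : ℝ) ≤ M := by exact_mod_cast hM
    have hr' : (r : ℝ) ^ 2 ≤ 4 * n * M := by exact_mod_cast hr.le
    have htr := trace_lower_bound hy hw hC h3 h4 (by linarith) (by linarith) hr'
    rw [IsPeriodicHolomorphic.norm_term, mul_assoc ‖_‖ (Real.exp _) (Real.exp _), ← Real.exp_add]
    refine mul_le_mul_of_nonneg_left (Real.exp_le_exp.2 ?_) (norm_nonneg _)
    simp only
    rw [hω, hv2]
    have e1 : y + n * c ≤ 2 * (n * y) := by nlinarith
    have e2 : w + M * c ≤ 2 * (M * w) := by nlinarith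
    have e3 := mul_le_mul_of_nonneg_left (add_le_add e1 e2) hε0.le
    have e4 := mul_le_mul_of_nonneg_left (a := Real.pi) (htr.trans' (b := ε * (n * y + M * w)) le_rfl)
      Real.pi_pos.le
    have e5 := mul_le_mul_of_nonneg_left e3 Real.pi_pos.le
    rw [hb, hη]
    linarith
  have hFle : ‖F (τ, z, ω)‖ ≤ K * Real.exp (-(b / 2 * (y + w))) := by
    have hs := (hF.summable_term hv).norm
    rw [← (hF.hasSum_term hv).tsum_eq]
    refine (norm_tsum_le_tsum_norm hs).trans ?_
    rw [hK, ← tsum_mul_right]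
    exact hs.tsum_le_tsum hterm (hsum.mul_right _)
  rw [petersson, hdet]
  have hexp : (y * w) ^ k * Real.exp (-(b * (y + w))) ≤ (2 * k).factorial / b ^ (2 * k) := by
    have h5 : y * w ≤ (y + w) ^ 2 := by nlinarith
    have h6 : (b * (y + w)) ^ (2 * k) / (2 * k).factorial ≤ Real.exp (b * (y + w)) :=
      Real.pow_div_factorial_le_exp _ (by positivity) _
    rw [Real.exp_neg, ← div_eq_mul_inv, div_le_div_iff₀ (Real.exp_pos _) (by positivity)]
    rw [div_le_iff₀ (by positivity), mul_pow] at h6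
    calc (y * w) ^ k * b ^ (2 * k) ≤ ((y + w) ^ 2) ^ k * b ^ (2 * k) := by gcongr
      _ = b ^ (2 * k) * (y + w) ^ (2 * k) := by rw [← pow_mul]; ring
      _ ≤ _ := h6
      _ = _ := mul_comm _ _
  calc ‖F (τ, z, ω)‖ ^ 2 * (y * w) ^ k ≤ (K * Real.exp (-(b / 2 * (y + w)))) ^ 2 * (y * w) ^ k := by
        gcongr
    _ = K ^ 2 * ((y * w) ^ k * Real.exp (-(b * (y + w)))) := by
        rw [mul_pow, ← Real.exp_nat_mul]
        have : ((2 : ℕ) : ℝ) * -(b / 2 * (y + w)) = -(b * (y + w)) := by push_cast; ring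
        rw [this]; ring
    _ ≤ _ := mul_le_mul_of_nonneg_left hexp (sq_nonneg _)

theorem exists_sq_between {t : ℝ} (ht : 1 ≤ t) : ∃ N : ℕ, 0 < N ∧ t ≤ N ^ 2 ∧ (N : ℝ) ^ 2 ≤ 4 * t := by
  have h1 : 1 ≤ Real.sqrt t := Real.one_le_sqrt.2 ht
  have h2 : Real.sqrt t ^ 2 = t := Real.sq_sqrt (by linarith)
  have h3 := Nat.le_ceil (Real.sqrt t)
  have h4 := Nat.ceil_lt_add_one (Real.sqrt_nonneg t)
  refine ⟨⌈Real.sqrt t⌉₊, Nat.ceil_pos.2 (by linarith), ?_, ?_⟩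
  · calc t = Real.sqrt t ^ 2 := h2.symm
      _ ≤ _ := pow_le_pow_left₀ (by linarith) h3 2
  · calc (⌈Real.sqrt t⌉₊ : ℝ) ^ 2 ≤ (2 * Real.sqrt t) ^ 2 :=
          pow_le_pow_left₀ (by positivity) (by linarith) 2
      _ = 4 * t := by rw [mul_pow, h2]; norm_num

/-- The Petersson function of a cusp form is bounded. -/
theorem exists_petersson_le (hF : IsParamodularCusp p k F) (hp : p.Prime) :
    ∃ B, ∀ v ∈ siegelDomain, petersson k F v ≤ B := by
  have hinv := hF.isInvariant_petersson hp.pos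
  have hp1 : (1 : ℝ) ≤ p := by exact_mod_cast hp.one_le
  have hp0 : (0 : ℝ) < p := by linarith
  set c₀ : ℝ := heightBound p / p with hc₀
  have hc₀0 : 0 < c₀ := div_pos (heightBound_pos p) hp0
  set C : ℝ := 25 * p ^ 2 with hC
  have hC1 : 1 ≤ C := by rw [hC]; nlinarith
  set c : ℝ := min 0.866 (c₀ / C) with hcd
  have hc0 : 0 < c := lt_min (by norm_num) (by positivity)
  have hcc : c ≤ c₀ := (min_le_right _ _).trans (div_le_self hc₀0.le hC1)
  obtain ⟨B, hB⟩ := hF.petersson_le_of_siegel_set hp hc0 (by linarith : 0 ≤ C)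
  refine ⟨B, fun v hv => ?_⟩
  obtain ⟨v₁, hv₁, h1, h2⟩ := hinv.exists_heightBound_le hp hv
  obtain ⟨v₂, hv₂, h3, h4, h5, h6⟩ := hinv.exists_fundamental hv₁
  have hw₂ : c₀ ≤ cuspHeight v₂ := by
    rw [h4, hc₀, div_le_iff₀ hp0]; linarith
  have hy₂ := (fundamental_domain_bounds hv₂.1 h5 h6).2
  obtain ⟨v₃, hv₃, h7, h8, h9, h10⟩ : ∃ v₃ ∈ siegelDomain, petersson k F v₃ = petersson k F v₂ ∧
      c ≤ v₃.1.im ∧ c ≤ cuspHeight v₃ ∧ v₃.1.im ≤ C * cuspHeight v₃ := by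
    have hw0 := cuspHeight_pos hv₂
    rcases le_total v₂.1.im (cuspHeight v₂) with hle | hle
    · refine ⟨v₂, hv₂, rfl, (min_le_left _ _).trans hy₂, hcc.trans hw₂, hle.trans ?_⟩
      exact le_mul_of_one_le_left hw0.le hC1
    -- When y exceeds w, Dirichlet approximation of u = Im z / Im τ finds a Levi step that balances
    -- them. With t² = y/w and a denominator bound N of size √t, both y(j - ug)² and w g² are O(tw).
    -- The new Im τ is then O(p tw), while the product of the new Im τ and height is still yw =
    -- (tw)².
    · set w := cuspHeight v₂ with hw
      set t := Real.sqrt (v₂.1.im / w) with ht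
      have hyw : 1 ≤ v₂.1.im / w := (one_le_div₀ hw0).2 hle
      have ht1 : 1 ≤ t := Real.one_le_sqrt.2 hyw
      have ht2 : t ^ 2 = v₂.1.im / w := Real.sq_sqrt (by linarith)
      have hyt : v₂.1.im = t ^ 2 * w := by rw [ht2]; field_simp
      obtain ⟨N, hN0, hN1, hN2⟩ := exists_sq_between ht1
      obtain ⟨j, g, hg0, hgN, hjg⟩ := Real.exists_int_int_abs_mul_sub_le
        (v₂.2.1.im / v₂.1.im) hN0
      obtain ⟨v₃, hv₃, e1, e2, e3, e4⟩ := hinv.exists_im_le hp hv₂ j hg0.ne'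
      have hN0' : (0 : ℝ) < N := by exact_mod_cast hN0
      have f1 : ((j : ℝ) - v₂.2.1.im / v₂.1.im * g) ^ 2 ≤ 1 / t := by
        have : ((j : ℝ) - v₂.2.1.im / v₂.1.im * g) ^ 2 ≤ (1 / (N + 1)) ^ 2 := by
          rw [← sq_abs]
          refine pow_le_pow_left₀ (abs_nonneg _) ?_ 2
          rw [abs_sub_comm, mul_comm]
          exact hjg
        refine this.trans ?_
        rw [one_div_pow]
        refine one_div_le_one_div_of_le (by linarith) (hN1.trans ?_)
        exact pow_le_pow_left₀ hN0'.le (by linarith) 2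
      have f2 : (g : ℝ) ^ 2 ≤ 4 * t := by
        refine le_trans ?_ hN2
        refine pow_le_pow_left₀ (by exact_mod_cast hg0.le) (by exact_mod_cast hgN) 2
      have f3 : v₃.1.im ≤ 5 * p * (t * w) := by
        refine e3.trans ?_
        have g1 : v₂.1.im * ((j : ℝ) - v₂.2.1.im / v₂.1.im * g) ^ 2 ≤ t * w := by
          refine (mul_le_mul_of_nonneg_left f1 hv₂.1.le).trans_eq ?_
          rw [hyt]; field_simp
        have g2 := mul_le_mul_of_nonneg_left f2 hw0.le
        have g3 : v₂.1.im * ((j : ℝ) - v₂.2.1.im / v₂.1.im * g) ^ 2 + w * (g : ℝ) ^ 2 ≤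
            5 * (t * w) := by linarith
        refine (mul_le_mul_of_nonneg_left g3 hp0.le).trans_eq (by ring)
      have f4 : v₃.1.im * cuspHeight v₃ = (t * w) ^ 2 := by
        have : v₃.1.im * cuspHeight v₃ = imDet v₃ := mul_div_cancel₀ _ hv₃.1.ne'
        rw [this, e2]
        have : imDet v₂ = v₂.1.im * w := (mul_div_cancel₀ _ hv₂.1.ne').symm
        rw [this, hyt]; ring
      have hy3 := hv₃.1
      have f5 : v₃.1.im ≤ C * cuspHeight v₃ := by
        have g1 : v₃.1.im ^ 2 ≤ (5 * p * (t * w)) ^ 2 := pow_le_pow_left₀ hy3.le f3 2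
        have g2 : v₃.1.im * v₃.1.im ≤ v₃.1.im * (C * cuspHeight v₃) := by
          calc v₃.1.im * v₃.1.im = v₃.1.im ^ 2 := by ring
            _ ≤ (5 * p * (t * w)) ^ 2 := g1
            _ = C * (v₃.1.im * cuspHeight v₃) := by rw [f4, hC]; ring
            _ = _ := by ring
        exact le_of_mul_le_mul_left g2 hy3
      refine ⟨v₃, hv₃, e1, hcc.trans (hw₂.trans e4), ?_, f5⟩
      refine (min_le_right _ _).trans ?_
      rw [div_le_iff₀ (by linarith)]
      linarith [hw₂.trans e4]
  obtain ⟨τ, z, ω⟩ := v₃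
  -- A last unipotent Levi step brings u into [-1/2, 1/2] without changing Im τ or the height.
  set l : ℤ := -round (z.im / τ.im) with hl
  have hdet : (1 : ℤ) * 1 - 0 * l = 1 := by ring
  have hmem := symConj_mem 1 0 l 1 hdet hv₃
  obtain ⟨i1, i2, -⟩ := symConj_im 1 0 l 1 τ z ω
  have hh := hinv.lin 1 0 l 1 (dvd_zero _) hdet _ hv₃
  have hτ : τ.im ≠ 0 := hv₃.1.ne'
  have i1' : (symConj 1 0 l 1 (τ, z, ω)).1.im = τ.im := by rw [i1]; simp
  have hheight : cuspHeight (symConj 1 0 l 1 (τ, z, ω)) = cuspHeight (τ, z, ω) := by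
    rw [cuspHeight, imDet_symConj hdet, i1']; rfl
  rw [← h1, ← h3, ← h7, ← hh]
  refine hB _ hmem (by rwa [i1']) (by rwa [hheight]) (by rwa [i1', hheight]) ?_
  rw [i1', i2]
  have : (((1 : ℤ) : ℝ) * l * τ.im + ((1 : ℤ) * (1 : ℤ) + (0 : ℤ) * l) * z.im +
      (0 : ℤ) * (1 : ℤ) * ω.im) / τ.im = z.im / τ.im - round (z.im / τ.im) := by
    rw [hl]; push_cast; field_simp; ring
  rw [this]
  exact abs_sub_round _

/-! ### Maximum principle in ω and the vanishing theorem -/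

theorem exists_e_eq {q : ℂ} (hq : q ≠ 0) : ∃ ω : ℂ, e ω = q := by
  refine ⟨Complex.log q / (2 * Real.pi * I), ?_⟩
  have : (2 * Real.pi * I : ℂ) ≠ 0 := by simp [Real.pi_ne_zero]
  rw [e, mul_div_cancel₀ _ this, Complex.exp_log hq]

/-- The maximum principle in the variable `ω` for a form vanishing to order `c` at `ω = i∞`. -/
theorem exists_norm_mul_exp_le (hF : IsPeriodicHolomorphic F) {c : ℕ}
    (hc : ∀ M : ℤ, M < c → ∀ τ z : ℂ, 0 < τ.im → jacobiCoeff F M (τ, z) = 0)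
    {τ z ω : ℂ} (hv : (τ, z, ω) ∈ siegelDomain) {t : ℝ} (ht0 : 0 < t)
    (ht : t < cuspHeight (τ, z, ω)) :
    ∃ ω₁ : ℂ, ω₁.im = ω.im - t ∧ ‖F (τ, z, ω)‖ * Real.exp (2 * Real.pi * c * t) ≤ ‖F (τ, z, ω₁)‖ := by
  have hτ : 0 < τ.im := hv.1
  have hmem : ∀ ω' : ℂ, ω.im - cuspHeight (τ, z, ω) < ω'.im → (τ, z, ω') ∈ siegelDomain := by
    intro ω' h
    refine ⟨hτ, ?_⟩
    have : ω.im - cuspHeight (τ, z, ω) = z.im ^ 2 / τ.im := by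
      rw [cuspHeight, imDet]; field_simp; ring
    rw [this, div_lt_iff₀' hτ] at h
    exact h
  set b : ℕ → ℂ := fun j => jacobiCoeff F (c + j) (τ, z) with hb
  have hsum : ∀ ω' : ℂ, ω.im - cuspHeight (τ, z, ω) < ω'.im →
      HasSum (fun j => b j * e ω' ^ j) (F (τ, z, ω') / e ω' ^ c) := by
    intro ω' h
    have h1 := hF.hasSum_jacobiCoeff (hmem ω' h)
    have hinj : Function.Injective fun j : ℕ => ((c + j : ℕ) : ℤ) := fun i j hij => by
      simp only at hij
      omega
    rw [← hinj.hasSum_iff] at h1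
    · refine (h1.div_const (e ω' ^ c)).congr_fun fun j => ?_
      simp only [Function.comp, hb]
      rw [eq_div_iff (pow_ne_zero _ (e_ne_zero _)), mul_assoc, ← pow_add, ← e_nat_mul]
      push_cast
      congr 3
      ring
    · intro M hM
      rw [hc M ?_ τ z hτ, zero_mul]
      by_contra! hle
      apply hM
      refine ⟨(M - c).toNat, ?_⟩
      simp only
      push_cast
      rw [Int.toNat_of_nonneg (by linarith)]
      ring
  -- F / q^c as a power series in q = e(ω). It is holomorphic also at q = 0, so the maximum
  -- principle applies on a full disc.
  let G : ℂ → ℂ := fun q => ∑' j, b j * q ^ j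
  have hG : ∀ ω' : ℂ, ω.im - cuspHeight (τ, z, ω) < ω'.im → F (τ, z, ω') = G (e ω') * e ω' ^ c := by
    intro ω' h
    have := (hsum ω' h).tsum_eq
    rw [show G (e ω') = ∑' j, b j * e ω' ^ j from rfl, this,
      div_mul_cancel₀ _ (pow_ne_zero _ (e_ne_zero _))]
  -- The series converges absolutely on the circle belonging to t', slightly larger than the one
  -- belonging to t, so G is continuous up to the latter.
  obtain ⟨t', ht1, ht2⟩ := exists_between ht
  set ω₂ : ℂ := ω - t' * I with hω₂
  have hω₂im : ω₂.im = ω.im - t' := by simp [hω₂]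
  have hs2 := (hsum ω₂ (by rw [hω₂im]; linarith)).summable.norm
  have hdiff : DifferentiableOn ℂ G (Metric.ball 0 ‖e ω₂‖) := by
    refine differentiableOn_tsum_of_summable_norm hs2 (fun j => by fun_prop) Metric.isOpen_ball
      fun j q hq => ?_
    rw [norm_mul, norm_mul, norm_pow, norm_pow]
    rw [mem_ball_zero_iff] at hq
    gcongr
  set R : ℝ := Real.exp (-(2 * Real.pi * (ω.im - t))) with hR
  have hR0 : 0 < R := Real.exp_pos _
  have hRlt : R < ‖e ω₂‖ := by
    rw [norm_e, hR, hω₂im, Real.exp_lt_exp]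
    have := Real.pi_pos
    nlinarith
  have hdc : DiffContOnCl ℂ G (Metric.ball 0 R) := by
    refine DifferentiableOn.diffContOnCl ?_
    rw [closure_ball _ hR0.ne']
    exact hdiff.mono (Metric.closedBall_subset_ball hRlt)
  obtain ⟨q, hq, hmax⟩ := Complex.exists_mem_frontier_isMaxOn_norm (Metric.isBounded_ball)
    ⟨0, Metric.mem_ball_self hR0⟩ hdc
  rw [frontier_ball _ hR0.ne', mem_sphere_zero_iff_norm] at hq
  obtain ⟨ω₁, hω₁⟩ := exists_e_eq (q := q) (by
    rintro rfl; simp at hq; linarith)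
  have him : ω₁.im = ω.im - t := by
    have h1 := norm_e ω₁
    rw [hω₁, hq, hR, Real.exp_eq_exp] at h1
    have := Real.pi_pos
    have h2 : 2 * Real.pi * ω₁.im = 2 * Real.pi * (ω.im - t) := by linarith
    exact mul_left_cancel₀ (by positivity) h2
  refine ⟨ω₁, him, ?_⟩
  have hle : ‖G (e ω)‖ ≤ ‖G (e ω₁)‖ := by
    rw [hω₁]
    refine hmax ?_
    rw [closure_ball _ hR0.ne', mem_closedBall_zero_iff, norm_e, hR, Real.exp_le_exp]
    have := Real.pi_pos
    nlinarith
  have hw := cuspHeight_pos hv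
  rw [hG ω (by linarith), hG ω₁ (by rw [him]; linarith), norm_mul, norm_mul, norm_pow, norm_pow,
    norm_e, norm_e, him, ← Real.exp_nat_mul, ← Real.exp_nat_mul, mul_assoc, ← Real.exp_add]
  have : (c : ℝ) * -(2 * Real.pi * ω.im) + 2 * Real.pi * c * t =
      c * -(2 * Real.pi * (ω.im - t)) := by ring
  rw [this]
  exact mul_le_mul_of_nonneg_right hle (Real.exp_nonneg _)

/-- A cusp form vanishing to high order at `ω = i∞` is zero. -/
theorem eq_zero_of_vanishing_order (hF : IsParamodularCusp p k F) (hp : p.Prime) {c : ℕ}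
    (hc : ∀ M : ℤ, M < c → ∀ τ z : ℂ, 0 < τ.im → jacobiCoeff F M (τ, z) = 0)
    (hkc : k < 4 * Real.pi * c * (heightBound p / p)) : ∀ v ∈ siegelDomain, F v = 0 := by
  have hp0 : (0 : ℝ) < p := by exact_mod_cast hp.pos
  set c₀ : ℝ := heightBound p / p with hc₀
  set β : ℝ := 4 * Real.pi * c * c₀ with hβ
  have hk0 : (0 : ℝ) ≤ k := Nat.cast_nonneg k
  have hβ0 : 0 < β := by linarith
  obtain ⟨B, hB⟩ := hF.exists_petersson_le hp
  have hinv := hF.isInvariant_petersson hp.pos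
  by_contra! hne
  obtain ⟨v₀, hv₀, hFv₀⟩ := hne
  set A : Set ℝ := petersson k F '' siegelDomain with hA
  have hbdd : BddAbove A := ⟨B, by rintro _ ⟨v, hv, rfl⟩; exact hB v hv⟩
  have hnonempty : A.Nonempty := ⟨_, v₀, hv₀, rfl⟩
  set S := sSup A with hS
  have hS0 : 0 < S := by
    refine lt_of_lt_of_le ?_ (le_csSup hbdd ⟨v₀, hv₀, rfl⟩)
    have := imDet_pos hv₀
    have := norm_pos_iff.2 hFv₀
    rw [petersson]; positivity
  -- By -log(1 - s) ≤ s / (1 - s), κ < 1 holds once k / (1 - s) < β. This choice makes 1 - s = (β +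
  -- k) / (2β), so the condition becomes 2k < β + k.
  set s : ℝ := (β - k) / (2 * β) with hs
  have hs0 : 0 < s := div_pos (by linarith) (by linarith)
  have hs1 : 1 - s = (β + k) / (2 * β) := by rw [hs]; field_simp; ring
  have h1s : 0 < 1 - s := by rw [hs1]; positivity
  set κ : ℝ := Real.exp (-(β * s)) / (1 - s) ^ k with hκ
  have hκ1 : κ < 1 := by
    rw [hκ, div_lt_one (by positivity), Real.exp_neg, inv_lt_comm₀ (Real.exp_pos _) (by positivity)]
    have h1 : (1 - s)⁻¹ ≤ Real.exp (s / (1 - s)) := by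
      have := Real.add_one_le_exp (s / (1 - s))
      refine le_trans (le_of_eq ?_) this
      field_simp; ring
    have h2 : ((1 - s) ^ k)⁻¹ ≤ Real.exp (k * (s / (1 - s))) := by
      rw [← inv_pow, Real.exp_nat_mul]
      exact pow_le_pow_left₀ (by positivity) h1 k
    refine h2.trans_lt (Real.exp_lt_exp.2 ?_)
    rw [mul_div_assoc', div_lt_iff₀ h1s, hs1]
    have h3 : β * s * ((β + k) / (2 * β)) = s * ((β + k) / 2) := by field_simp
    rw [h3]
    nlinarith
  have hle : ∀ v ∈ siegelDomain, petersson k F v ≤ κ * S := by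
    intro v hv
    -- By invariance the value may be estimated at a point of the orbit with height at least c₀.
    obtain ⟨⟨τ, z, ω⟩, hv', hpet, hheight⟩ := hinv.exists_heightBound_le hp hv
    rw [← hpet]
    set w := cuspHeight (τ, z, ω) with hw
    have hw0 : 0 < w := cuspHeight_pos hv'
    have hwc : c₀ ≤ w := by rw [hc₀, div_le_iff₀ hp0]; linarith
    have hτ : 0 < τ.im := hv'.1
    obtain ⟨ω₁, him, hF1⟩ := exists_norm_mul_exp_le hF.toIsPeriodicHolomorphic hc hv' (t := s * w)
      (by positivity) (by nlinarith)
    have hdet : imDet (τ, z, ω) = τ.im * w := (mul_div_cancel₀ _ hτ.ne').symm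
    have hdet1 : imDet (τ, z, ω₁) = (1 - s) * imDet (τ, z, ω) := by
      have : imDet (τ, z, ω₁) = imDet (τ, z, ω) - τ.im * (s * w) := by
        simp only [imDet, him]; ring
      rw [this, hdet]; ring
    have hD := imDet_pos hv'
    have hmem1 : (τ, z, ω₁) ∈ siegelDomain := by
      refine ⟨hτ, sub_pos.1 ?_⟩
      have : 0 < imDet (τ, z, ω₁) := by rw [hdet1]; positivity
      exact this
    have hS1 : petersson k F (τ, z, ω₁) ≤ S := le_csSup hbdd ⟨_, hmem1, rfl⟩
    have hsq := pow_le_pow_left₀ (by positivity) hF1 2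
    rw [mul_pow, ← Real.exp_nat_mul] at hsq
    have hexp : Real.exp (β * s) ≤ Real.exp (((2 : ℕ) : ℝ) * (2 * Real.pi * c * (s * w))) := by
      rw [Real.exp_le_exp, hβ]
      have h1 : 4 * Real.pi * c * c₀ * s ≤ 4 * Real.pi * c * w * s := by gcongr
      push_cast
      linarith
    have hfin : petersson k F (τ, z, ω) * (Real.exp (β * s) * (1 - s) ^ k) ≤ S := by
      calc petersson k F (τ, z, ω) * (Real.exp (β * s) * (1 - s) ^ k)
          = ‖F (τ, z, ω)‖ ^ 2 * Real.exp (β * s) * ((1 - s) * imDet (τ, z, ω)) ^ k := by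
            rw [petersson, mul_pow]; ring
        _ ≤ ‖F (τ, z, ω₁)‖ ^ 2 * ((1 - s) * imDet (τ, z, ω)) ^ k := by
            refine mul_le_mul_of_nonneg_right (le_trans ?_ hsq) (by positivity)
            exact mul_le_mul_of_nonneg_left hexp (by positivity)
        _ = petersson k F (τ, z, ω₁) := by rw [petersson, hdet1]
        _ ≤ S := hS1
    rw [← le_div_iff₀ (by positivity)] at hfin
    refine hfin.trans_eq ?_
    rw [hκ, Real.exp_neg]
    field_simp
  have : S ≤ κ * S := csSup_le hnonempty (by rintro _ ⟨v, hv, rfl⟩; exact hle v hv)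
  nlinarith

end IsParamodularCusp

end

/-! ### From slash invariance on Siegel space to identities in coordinates -/

section

open Complex Set Filter Topology

theorem posDef_two_iff {a b c : ℝ} : (!![a, b; b, c]).PosDef ↔ 0 < a ∧ b ^ 2 < a * c := by
  constructor
  · intro h
    have h1 := h.diag_pos (i := 0)
    have h2 := h.det_pos
    rw [Matrix.det_fin_two_of] at h2
    exact ⟨by simpa using h1, by linarith⟩
  · rintro ⟨ha, hb⟩
    refine Matrix.PosDef.of_dotProduct_mulVec_pos ?_ fun x hx => ?_
    · ext i j; fin_cases i <;> fin_cases j <;> simp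
    have hq : star x ⬝ᵥ (!![a, b; b, c] *ᵥ x) = a * x 0 ^ 2 + 2 * b * x 0 * x 1 + c * x 1 ^ 2 := by
      simp [dotProduct, Matrix.mulVec, Fin.sum_univ_two]; ring
    rw [hq]
    have h1 : a * (a * x 0 ^ 2 + 2 * b * x 0 * x 1 + c * x 1 ^ 2) =
        (a * x 0 + b * x 1) ^ 2 + (a * c - b ^ 2) * x 1 ^ 2 := by ring
    refine pos_of_mul_pos_right (a := a) ?_ ha.le
    rw [h1]
    have hd : 0 < a * c - b ^ 2 := by linarith
    by_cases h0 : x 1 = 0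
    · have : x 0 ≠ 0 := fun h => hx (by ext i; fin_cases i <;> simp [h, h0])
      rw [h0]; simp; positivity
    · positivity

theorem setOf_posDef_eq :
    {v : ℂ × ℂ × ℂ | (!![v.1.im, v.2.1.im; v.2.1.im, v.2.2.im]).PosDef} = siegelDomain := by
  ext v; exact posDef_two_iff

/-- The coordinates `(τ, z, ω)` of `Ω = (τ z; z ω)`. -/
def coords (Ω : SiegelUpperHalf) : ℂ × ℂ × ℂ := (Ω.1 0 0, Ω.1 0 1, Ω.1 1 1)

theorem symm_apply (Ω : SiegelUpperHalf) : Ω.1 1 0 = Ω.1 0 1 := congrFun (congrFun Ω.2.1 0) 1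

theorem coords_mem (Ω : SiegelUpperHalf) : coords Ω ∈ siegelDomain := by
  rw [← setOf_posDef_eq, mem_ofPred_eq]
  convert Ω.2.2 using 1
  ext i j; fin_cases i <;> fin_cases j <;> simp [coords, symm_apply]

/-- The point of the Siegel upper half space with given coordinates. -/
def point (v : ℂ × ℂ × ℂ) (hv : v ∈ siegelDomain) : SiegelUpperHalf :=
  ⟨!![v.1, v.2.1; v.2.1, v.2.2], by ext i j; fin_cases i <;> fin_cases j <;> simp, by
    rw [← setOf_posDef_eq, mem_ofPred_eq] at hv
    convert hv using 1
    ext i j; fin_cases i <;> fin_cases j <;> simp⟩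

theorem coords_point {v : ℂ × ℂ × ℂ} (hv : v ∈ siegelDomain) : coords (point v hv) = v := by
  simp [coords, point]

theorem point_eq {Ω : SiegelUpperHalf} {v : ℂ × ℂ × ℂ} (hv : v ∈ siegelDomain)
    (h : coords Ω = v) : point v hv = Ω := by
  subst h
  apply Subtype.ext
  ext i j; fin_cases i <;> fin_cases j <;> simp [coords, point, symm_apply]

open Classical in
/-- A function on the Siegel upper half space as a function of the coordinates, extended by zero. -/
def inCoords (f : SiegelUpperHalf → ℂ) (v : ℂ × ℂ × ℂ) : ℂ :=
  if hv : v ∈ siegelDomain then f (point v hv) else 0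

theorem inCoords_of_mem (f : SiegelUpperHalf → ℂ) {v : ℂ × ℂ × ℂ} (hv : v ∈ siegelDomain) :
    inCoords f v = f (point v hv) := dif_pos hv

theorem inCoords_of_notMem (f : SiegelUpperHalf → ℂ) {v : ℂ × ℂ × ℂ} (hv : v ∉ siegelDomain) :
    inCoords f v = 0 := dif_neg hv

theorem inCoords_coords (f : SiegelUpperHalf → ℂ) (Ω : SiegelUpperHalf) :
    inCoords f (coords Ω) = f Ω := by
  rw [inCoords_of_mem f (coords_mem Ω), point_eq _ rfl]

theorem IsHolomorphic.differentiableOn_inCoords {f : SiegelUpperHalf → ℂ} (hf : IsHolomorphic f) :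
    DifferentiableOn ℂ (inCoords f) siegelDomain := by
  obtain ⟨F, hF, hfF⟩ := hf
  rw [setOf_posDef_eq] at hF
  refine hF.congr fun v hv => ?_
  rw [inCoords_of_mem f hv, hfF]
  exact congrArg F (coords_point hv)

theorem act_eq {M : Sp2R} {Ω Ω' : SiegelUpperHalf} (h : numer M Ω = Ω'.1 * denom M Ω) :
    act M Ω = Ω' := by
  apply Subtype.ext
  have hu : IsUnit (denom M Ω).det := isUnit_iff_ne_zero.2 (denom_det_ne_zero M Ω)
  show numer M Ω * (denom M Ω)⁻¹ = Ω'.1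
  rw [h, Matrix.mul_nonsing_inv_cancel_right _ _ hu]

/-- The symplectic matrix with given blocks. -/
def ofBlocks (A B C D : Matrix (Fin 2) (Fin 2) ℝ)
    (h : Aᵀ * C = Cᵀ * A ∧ Bᵀ * D = Dᵀ * B ∧ Aᵀ * D - Cᵀ * B = 1) : Sp2R :=
  ⟨Matrix.fromBlocks A B C D, SymplecticGroup.fromBlocks_mem_iff.2 h⟩

theorem numer_ofBlocks {A B C D : Matrix (Fin 2) (Fin 2) ℝ} (h) (Ω : SiegelUpperHalf) :
    numer (ofBlocks A B C D h) Ω = A.map ofReal * Ω.1 + B.map ofReal := by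
  simp [numer, blockA, blockB, ofBlocks]

theorem denom_ofBlocks {A B C D : Matrix (Fin 2) (Fin 2) ℝ} (h) (Ω : SiegelUpperHalf) :
    denom (ofBlocks A B C D h) Ω = C.map ofReal * Ω.1 + D.map ofReal := by
  simp [denom, blockC, blockD, ofBlocks]

/-- The unipotent matrix `Ω ↦ Ω + B` with `B = (x y; y w)`. -/
def transl (x y w : ℝ) : Sp2R :=
  ofBlocks 1 !![x, y; y, w] 0 1 (by
    refine ⟨by simp, ?_, by simp⟩
    ext i j; fin_cases i <;> fin_cases j <;> simp)

/-- The matrix `Ω ↦ UΩUᵀ` with `U = (a b; c d)` unimodular. -/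
def levi (a b c d : ℤ) (h : a * d - b * c = 1) : Sp2R :=
  ofBlocks !![(a : ℝ), b; c, d] 0 0 !![(d : ℝ), -c; -b, a] (by
    have h' : (a : ℝ) * d - b * c = 1 := by exact_mod_cast h
    refine ⟨by simp, by simp, ?_⟩
    ext i j; fin_cases i <;> fin_cases j <;> simp [Matrix.mul_apply, Fin.sum_univ_two] <;> linarith)

/-- `SL₂` embedded as acting on the variable `τ`. -/
def slEmbed (a b c d : ℤ) (h : a * d - b * c = 1) : Sp2R :=
  ofBlocks !![(a : ℝ), 0; 0, 1] !![(b : ℝ), 0; 0, 0] !![(c : ℝ), 0; 0, 0] !![(d : ℝ), 0; 0, 1] (by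
    have h' : (a : ℝ) * d - b * c = 1 := by exact_mod_cast h
    refine ⟨?_, ?_, ?_⟩ <;> ext i j <;> fin_cases i <;> fin_cases j <;>
      simp [Matrix.mul_apply, Fin.sum_univ_two] <;> linarith)

theorem finSumFinEquiv_two : (finSumFinEquiv (Sum.inl (0 : Fin 2)) : Fin (2 + 2)) = (0 : Fin 4) ∧
    (finSumFinEquiv (Sum.inl (1 : Fin 2)) : Fin (2 + 2)) = (1 : Fin 4) ∧
    (finSumFinEquiv (Sum.inr (0 : Fin 2)) : Fin (2 + 2)) = (2 : Fin 4) ∧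
    (finSumFinEquiv (Sum.inr (1 : Fin 2)) : Fin (2 + 2)) = (3 : Fin 4) := ⟨rfl, rfl, rfl, rfl⟩

theorem transl_mem (p : ℕ) (x y w : ℤ) : transl x y (w / p) ∈ paramodularGroup p := by
  intro i j
  refine ⟨(!![1, 0, x, y; 0, 1, y, w; 0, 0, 1, 0; 0, 0, 0, 1] : Matrix (Fin 4) (Fin 4) ℤ)
    (finSumFinEquiv i) (finSumFinEquiv j), ?_⟩
  rcases i with i | i <;> rcases j with j | j <;> fin_cases i <;> fin_cases j <;>
    simp [finSumFinEquiv_two, transl, ofBlocks, div_eq_mul_inv]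

theorem levi_mem {p : ℕ} {a b c d : ℤ} (h : a * d - b * c = 1) (hb : (p : ℤ) ∣ b) :
    levi a b c d h ∈ paramodularGroup p := by
  obtain ⟨b', rfl⟩ := hb
  intro i j
  refine ⟨(!![a, b', 0, 0; c, d, 0, 0; 0, 0, d, -c; 0, 0, -b', a] : Matrix (Fin 4) (Fin 4) ℤ)
    (finSumFinEquiv i) (finSumFinEquiv j), ?_⟩
  rcases i with i | i <;> rcases j with j | j <;> fin_cases i <;> fin_cases j <;>
    simp [finSumFinEquiv_two, levi, ofBlocks, mul_comm]

theorem levi_mem_Sp2Z {a b c d : ℤ} (h : a * d - b * c = 1) : levi a b c d h ∈ Sp2Z := by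
  intro i j
  refine ⟨(!![a, b, 0, 0; c, d, 0, 0; 0, 0, d, -c; 0, 0, -b, a] : Matrix (Fin 4) (Fin 4) ℤ)
    (finSumFinEquiv i) (finSumFinEquiv j), ?_⟩
  rcases i with i | i <;> rcases j with j | j <;> fin_cases i <;> fin_cases j <;>
    simp [finSumFinEquiv_two, levi, ofBlocks]

theorem slEmbed_mem {p : ℕ} {a b c d : ℤ} (h : a * d - b * c = 1) :
    slEmbed a b c d h ∈ paramodularGroup p := by
  intro i j
  refine ⟨(!![a, 0, b, 0; 0, 1, 0, 0; c, 0, d, 0; 0, 0, 0, 1] : Matrix (Fin 4) (Fin 4) ℤ)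
    (finSumFinEquiv i) (finSumFinEquiv j), ?_⟩
  rcases i with i | i <;> rcases j with j | j <;> fin_cases i <;> fin_cases j <;>
    simp [finSumFinEquiv_two, slEmbed, ofBlocks]

theorem add_mem_siegelDomain {v : ℂ × ℂ × ℂ} (x y w : ℝ) :
    (v.1 + x, v.2.1 + y, v.2.2 + w) ∈ siegelDomain ↔ v ∈ siegelDomain := by
  simp [siegelDomain]

theorem slash_transl (k : ℤ) (f : SiegelUpperHalf → ℂ) (x y w : ℝ) {v : ℂ × ℂ × ℂ}
    (hv : v ∈ siegelDomain) :
    slash k f (transl x y w) (point v hv) =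
      f (point (v.1 + x, v.2.1 + y, v.2.2 + w) ((add_mem_siegelDomain x y w).2 hv)) := by
  have hden : denom (transl x y w) (point v hv) = 1 := by
    rw [transl, denom_ofBlocks]; simp
  rw [slash, hden, Matrix.det_one, one_zpow, one_mul, act_eq]
  rw [hden, transl, numer_ofBlocks]
  ext i j; fin_cases i <;> fin_cases j <;> simp [point]

theorem slash_levi (k : ℤ) (f : SiegelUpperHalf → ℂ) {a b c d : ℤ} (h : a * d - b * c = 1)
    {v : ℂ × ℂ × ℂ} (hv : v ∈ siegelDomain) :
    slash k f (levi a b c d h) (point v hv) =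
      f (point (symConj a b c d v) (IsParamodularCusp.symConj_mem a b c d h hv)) := by
  have h' : (a : ℂ) * d - b * c = 1 := by exact_mod_cast h
  have hden : denom (levi a b c d h) (point v hv) = !![(d : ℂ), -c; -b, a] := by
    rw [levi, denom_ofBlocks]
    ext i j; fin_cases i <;> fin_cases j <;> simp
  have hdet : (!![(d : ℂ), -c; -b, a]).det = 1 := by rw [Matrix.det_fin_two_of, ← h']; ring
  rw [slash, hden, hdet, one_zpow, one_mul, act_eq]
  rw [hden, levi, numer_ofBlocks]
  ext i j; fin_cases i <;> fin_cases j <;>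
    simp [point, symConj, Matrix.mul_apply, Fin.sum_univ_two]
  · linear_combination (-(a * v.1 + b * v.2.1)) * h'
  · linear_combination (-(a * v.2.1 + b * v.2.2)) * h'
  · linear_combination (-(c * v.1 + d * v.2.1)) * h'
  · linear_combination (-(c * v.2.1 + d * v.2.2)) * h'

theorem int_mul_add_ne_zero {a b c d : ℤ} (h : a * d - b * c = 1) {τ : ℂ} (hτ : 0 < τ.im) :
    (c * τ + d : ℂ) ≠ 0 := by
  intro h0
  have h1 := normSq_denom_pos (v := (τ, 0, 0)) h hτ
  have h2 : (c * τ.re + d : ℝ) = 0 := by simpa using congrArg Complex.re h0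
  have h3 : (c * τ.im : ℝ) = 0 := by simpa using congrArg Complex.im h0
  simp only [h2, h3] at h1
  simp at h1

theorem slash_slEmbed (k : ℤ) (f : SiegelUpperHalf → ℂ) {a b c d : ℤ} (h : a * d - b * c = 1)
    {v : ℂ × ℂ × ℂ} (hv : v ∈ siegelDomain) :
    slash k f (slEmbed a b c d h) (point v hv) =
      (c * v.1 + d : ℂ) ^ (-k) * f (point (slAct a b c d v) (slAct_mem h hv)) := by
  have h' : (a : ℂ) * d - b * c = 1 := by exact_mod_cast h
  have hden : denom (slEmbed a b c d h) (point v hv) = !![c * v.1 + d, c * v.2.1; 0, 1] := by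
    rw [slEmbed, denom_ofBlocks]
    ext i j; fin_cases i <;> fin_cases j <;> simp [point, Matrix.mul_apply, Fin.sum_univ_two]
  have hdet : (!![c * v.1 + d, c * v.2.1; 0, 1] : Matrix (Fin 2) (Fin 2) ℂ).det = c * v.1 + d := by
    rw [Matrix.det_fin_two_of]; ring
  have hne := int_mul_add_ne_zero h hv.1
  rw [slash, hden, hdet, act_eq]
  rw [hden, slEmbed, numer_ofBlocks]
  ext i j; fin_cases i <;> fin_cases j <;>
    simp [point, slAct, Matrix.mul_apply, Fin.sum_univ_two]
  · rw [div_mul_cancel₀ _ hne]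
  · rw [div_mul_eq_mul_div, ← add_div, eq_div_iff hne]
    linear_combination v.2.1 * h'
  · rw [div_mul_cancel₀ _ hne]
  · field_simp
    ring

theorem mu_relations (p : ℕ) [NeZero p] :
    (-(frickeF p)ᵀ)ᵀ * 0 = 0ᵀ * -(frickeF p)ᵀ ∧ (0 : Matrix (Fin 2) (Fin 2) ℝ)ᵀ * frickeF p =
      (frickeF p)ᵀ * 0 ∧ (-(frickeF p)ᵀ)ᵀ * frickeF p - 0ᵀ * 0 = 1 :=
  SymplecticGroup.fromBlocks_mem_iff.1 (mu p).2

theorem slash_mu (p : ℕ) [NeZero p] (k : ℤ) (f : SiegelUpperHalf → ℂ)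
    {v : ℂ × ℂ × ℂ} (hv : v ∈ siegelDomain) :
    slash k f (mu p) (point v hv) =
      f (point (frickeAct p v) (frickeAct_mem (NeZero.pos p) hv)) := by
  set s : ℂ := (((Real.sqrt p)⁻¹ : ℝ) : ℂ) with hs
  have hp : (p : ℂ) ≠ 0 := Nat.cast_ne_zero.2 (NeZero.ne p)
  have hss : s * s * p = 1 := by
    have : (Real.sqrt p)⁻¹ * (Real.sqrt p)⁻¹ * (p : ℝ) = 1 := by
      rw [← mul_inv, Real.mul_self_sqrt (Nat.cast_nonneg p)]
      exact inv_mul_cancel₀ (Nat.cast_ne_zero.2 (NeZero.ne p))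
    rw [hs]; exact_mod_cast this
  have hden : denom (mu p) (point v hv) = !![0, s; -(s * p), 0] := by
    refine (denom_ofBlocks (mu_relations p) _).trans ?_
    ext i j; fin_cases i <;> fin_cases j <;> simp [frickeF, hs]
  have hdet : (!![0, s; -(s * p), 0]).det = 1 := by
    rw [Matrix.det_fin_two_of]; linear_combination hss
  rw [slash, hden, hdet, one_zpow, one_mul, act_eq]
  rw [hden]
  refine (numer_ofBlocks (mu_relations p) _).trans ?_
  ext i j; fin_cases i <;> fin_cases j <;>
    simp [frickeF, point, frickeAct, Matrix.mul_apply, Fin.sum_univ_two, ← hs] <;>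
    field_simp

/-- The domain is stable under real translations, so extension by zero preserves periodicity and the
periods hold at all points. -/
theorem inCoords_add_ofReal {f : SiegelUpperHalf → ℂ} {v : ℂ × ℂ × ℂ} {x y w : ℝ}
    (h : ∀ hv : v ∈ siegelDomain,
      f (point (v.1 + x, v.2.1 + y, v.2.2 + w) ((add_mem_siegelDomain x y w).2 hv)) =
        f (point v hv)) :
    inCoords f (v.1 + x, v.2.1 + y, v.2.2 + w) = inCoords f v := by
  by_cases hv : v ∈ siegelDomain
  · rw [inCoords_of_mem f hv, ← h hv, inCoords_of_mem]
  · rw [inCoords_of_notMem f hv, inCoords_of_notMem]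
    rwa [add_mem_siegelDomain]

theorem inCoords_transl {p : ℕ} {k : ℤ} {f : SiegelUpperHalf → ℂ} (hf : f ∈ paramodularForms p k)
    (x y w : ℤ) (v : ℂ × ℂ × ℂ) :
    inCoords f (v.1 + x, v.2.1 + y, v.2.2 + w / p) = inCoords f v := by
  have := inCoords_add_ofReal (f := f) (v := v) (x := x) (y := y) (w := w / p) fun hv => by
    rw [← slash_transl k f x y (w / p) hv, hf.2 _ (transl_mem p x y w)]
  simpa using this

theorem isParamodularCusp_inCoords {p k : ℕ} [NeZero p] {ε : ℤˣ} {f : SiegelUpperHalf → ℂ}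
    (hf : f ∈ paramodularCuspEigenspace p k ε) : IsParamodularCusp p k (inCoords f) where
  diff := hf.1.1.1.differentiableOn_inCoords
  per₁ τ z ω := by simpa using inCoords_transl hf.1.1 1 0 0 (τ, z, ω)
  per₂ τ z ω := by simpa using inCoords_transl hf.1.1 0 1 0 (τ, z, ω)
  per₃ τ z ω := by
    have hp : (p : ℂ) ≠ 0 := Nat.cast_ne_zero.2 (NeZero.ne p)
    simpa [hp] using inCoords_transl hf.1.1 0 0 p (τ, z, ω)
  per τ z ω := by simpa using inCoords_transl hf.1.1 0 0 1 (τ, z, ω)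
  lin a b c d hb h v hv := by
    rw [inCoords_of_mem f hv, inCoords_of_mem f (IsParamodularCusp.symConj_mem a b c d h hv),
      ← slash_levi k f h hv, hf.1.1.2 _ (levi_mem h hb)]
  sl2 a b c d h τ z ω hv := by
    have hne := int_mul_add_ne_zero h hv.1
    have h1 := slash_slEmbed k f h hv
    rw [hf.1.1.2 _ (slEmbed_mem h)] at h1
    rw [inCoords_of_mem f hv, h1, zpow_neg, zpow_natCast, mul_inv_cancel_left₀ (pow_ne_zero k hne)]
    exact inCoords_of_mem f (slAct_mem h hv)
  -- Only the absolute value is invariant: the eigenvalue ε = ±1 disappears.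
  fricke τ z ω hv := by
    have h1 := slash_mu p k f hv
    rw [hf.2] at h1
    rw [inCoords_of_mem f hv]
    refine (congrArg norm (inCoords_of_mem f (frickeAct_mem (NeZero.pos p) hv))).trans ?_
    rw [← h1, Pi.smul_apply, norm_smul]
    rcases Int.units_eq_one_or ε with rfl | rfl <;> simp
  cusp a b c d h τ hτ := by
    -- Of the cusp conditions only those at Levi elements of Sp₂(ℤ) are needed.
    have h1 := hf.1.2 _ (levi_mem_Sp2Z h) ⟨τ, hτ⟩
    rw [← tendsto_comp_val_Ioi_atTop (a := 0)]
    refine h1.congr fun t => ?_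
    have ht : (0 : ℝ) < t := t.2
    have hmem : ((t : ℝ) * I, 0, τ) ∈ siegelDomain := by
      rw [mem_siegelDomain]
      simp [ht, hτ]
    have hpt : diagPoint (imagPoint t) ⟨τ, hτ⟩ = point ((t : ℝ) * I, 0, τ) hmem := by
      refine (point_eq hmem ?_).symm
      simp [coords, diagPoint, imagPoint, mul_comm]
    rw [hpt, slash_levi k f h hmem]
    exact (inCoords_of_mem f _).symm

end

/-! ### Fourier–Jacobi coefficients and injectivity -/

section

open Complex Set Filter Topology

theorem jacobiGroup_subset_paramodularGroup (p : ℕ) [NeZero p] :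
    jacobiGroup ⊆ paramodularGroup p := by
  intro σ hσ i j
  obtain ⟨a, ha⟩ := hσ i j
  have hp : (p : ℝ) ≠ 0 := Nat.cast_ne_zero.2 (NeZero.ne p)
  refine ⟨a * (!![1, 0, 1, 1; 1, 1, 1, (p : ℤ); 1, 0, 1, 1; 0, 0, 0, 1] : Matrix (Fin 4) (Fin 4) ℤ)
    (finSumFinEquiv i) (finSumFinEquiv j), ?_⟩
  rw [ha]
  rcases i with i | i <;> rcases j with j | j <;> fin_cases i <;> fin_cases j <;>
    simp [finSumFinEquiv_two, hp]

section Jacobi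

variable {σ : Sp2R}

theorem jacobiGroup_zero_entries (hσ : σ ∈ jacobiGroup) : blockA σ 0 1 = 0 ∧ blockC σ 0 1 = 0 ∧
    blockC σ 1 0 = 0 ∧ blockC σ 1 1 = 0 ∧ blockD σ 1 0 = 0 := by
  refine ⟨?_, ?_, ?_, ?_, ?_⟩
  · obtain ⟨a, ha⟩ := hσ (.inl 0) (.inl 1)
    simpa [finSumFinEquiv_two, blockA, Matrix.toBlocks₁₁] using ha
  · obtain ⟨a, ha⟩ := hσ (.inr 0) (.inl 1)
    simpa [finSumFinEquiv_two, blockC, Matrix.toBlocks₂₁] using ha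
  · obtain ⟨a, ha⟩ := hσ (.inr 1) (.inl 0)
    simpa [finSumFinEquiv_two, blockC, Matrix.toBlocks₂₁] using ha
  · obtain ⟨a, ha⟩ := hσ (.inr 1) (.inl 1)
    simpa [finSumFinEquiv_two, blockC, Matrix.toBlocks₂₁] using ha
  · obtain ⟨a, ha⟩ := hσ (.inr 1) (.inr 0)
    simpa [finSumFinEquiv_two, blockD, Matrix.toBlocks₂₂] using ha

/-- A symplectic relation makes the product of these two integers 1, so both are 1 or both are -1.
This is why the Jacobi group commutes with translations of ω. -/
theorem jacobiGroup_unit_entries (hσ : σ ∈ jacobiGroup) : blockA σ 1 1 = blockD σ 1 1 := by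
  obtain ⟨h1, h2, h3, h4, h5⟩ := jacobiGroup_zero_entries hσ
  have hrel := congrFun (congrFun (block_relations σ).2.2 1) 1
  obtain ⟨a, ha⟩ := hσ (.inl 1) (.inl 1)
  obtain ⟨d, hd⟩ := hσ (.inr 1) (.inr 1)
  have ha' : blockA σ 1 1 = a := by
    simpa [finSumFinEquiv_two, blockA, Matrix.toBlocks₁₁] using congrArg ofReal ha
  have hd' : blockD σ 1 1 = d := by
    simpa [finSumFinEquiv_two, blockD, Matrix.toBlocks₂₂] using congrArg ofReal hd
  simp only [Matrix.sub_apply, Matrix.mul_apply, Fin.sum_univ_two, Matrix.transpose_apply, h1, h2,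
    h4, ha', hd', Matrix.one_apply_eq] at hrel
  have had : a * d = 1 := by
    have : (a * d : ℂ) = 1 := by linear_combination hrel
    exact_mod_cast this
  rw [ha', hd']
  rcases Int.mul_eq_one_iff_eq_one_or_neg_one.1 had with ⟨rfl, rfl⟩ | ⟨rfl, rfl⟩ <;> rfl

end Jacobi

/-- The translation `ω ↦ ω + x` for real `x`. -/
def shift (x : ℝ) (Ω : SiegelUpperHalf) : SiegelUpperHalf :=
  point ((coords Ω).1 + (0 : ℝ), (coords Ω).2.1 + (0 : ℝ), (coords Ω).2.2 + x)
    ((add_mem_siegelDomain 0 0 x).2 (coords_mem Ω))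

theorem shift_val (x : ℝ) (Ω : SiegelUpperHalf) : (shift x Ω).1 = Ω.1 + !![0, 0; 0, (x : ℂ)] := by
  ext i j; fin_cases i <;> fin_cases j <;> simp [shift, point, coords, symm_apply]

theorem tilde_shift (m : ℕ) (φ : ℍ × ℂ → ℂ) (x : ℝ) (Ω : SiegelUpperHalf) :
    tilde m φ (shift x Ω) = tilde m φ Ω * e (m * x) := by
  have h : tau (shift x Ω) = tau Ω := by
    apply UpperHalfPlane.ext
    show (shift x Ω).1 0 0 = Ω.1 0 0
    simp [shift_val]
  rw [tilde, tilde, h, mul_assoc, ← e_add, ← mul_add, shift_val]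
  simp

theorem denom_shift {σ : Sp2R} (hσ : σ ∈ jacobiGroup) (x : ℝ) (Ω : SiegelUpperHalf) :
    denom σ (shift x Ω) = denom σ Ω := by
  obtain ⟨h1, h2, h3, h4, h5⟩ := jacobiGroup_zero_entries hσ
  rw [denom, denom, shift_val, Matrix.mul_add]
  have : blockC σ * !![0, 0; 0, (x : ℂ)] = 0 := by
    ext i j; fin_cases i <;> fin_cases j <;> simp [Matrix.mul_apply, Fin.sum_univ_two, h2, h4]
  rw [this, add_zero]

theorem act_shift {σ : Sp2R} (hσ : σ ∈ jacobiGroup) (x : ℝ) (Ω : SiegelUpperHalf) :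
    act σ (shift x Ω) = shift x (act σ Ω) := by
  obtain ⟨h1, h2, h3, h4, h5⟩ := jacobiGroup_zero_entries hσ
  have hu : IsUnit (denom σ Ω).det := isUnit_iff_ne_zero.2 (denom_det_ne_zero σ Ω)
  have hact : (act σ Ω).1 * denom σ Ω = numer σ Ω := Matrix.nonsing_inv_mul_cancel_right _ _ hu
  have hX : !![0, 0; 0, (x : ℂ)] * denom σ Ω = blockA σ * !![0, 0; 0, (x : ℂ)] := by
    ext i j; fin_cases i <;> fin_cases j <;>
      simp [denom, Matrix.mul_apply, Fin.sum_univ_two, h1, h3, h4, h5,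
        jacobiGroup_unit_entries hσ, mul_comm]
  refine act_eq ?_
  rw [denom_shift hσ, shift_val, Matrix.add_mul, hact, hX, numer, numer, shift_val, Matrix.mul_add]
  abel

/-- Restricting an expansion to the real translates ω + x turns it into a Fourier series in x, where
coefficients can be compared. -/
theorem coeff_unique {p : ℕ} (hp : 0 < p) {a b : ℕ → ℂ} {g : ℝ → ℂ}
    (ha : ∀ x : ℝ, HasSum (fun j : ℕ => a j * e ((p * j : ℕ) * x)) (g x))
    (hb : ∀ x : ℝ, HasSum (fun j : ℕ => b j * e ((p * j : ℕ) * x)) (g x)) : a = b := by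
  funext j
  refine sub_eq_zero.1 (eq_zero_of_hasSum_e (fun j => a j - b j) (fun j => ((p * j : ℕ) : ℤ)) 0
    (fun x => ?_) (fun i j _ _ h => ?_) j)
  · have := (ha x).sub (hb x)
    rw [sub_self] at this
    refine this.congr_fun fun j => ?_
    simp [sub_mul]
  · exact Nat.eq_of_mul_eq_mul_left hp (Int.ofNat.inj h)

/-- Fourier-Jacobi coefficients inherit the invariance under the Jacobi group. -/
theorem HasFourierJacobiExpansion.slash_tilde {p : ℕ} (hp : 0 < p) {k : ℤ}
    {f : SiegelUpperHalf → ℂ} {φ : ℕ → ℍ × ℂ → ℂ} (h : HasFourierJacobiExpansion p f φ)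
    {σ : Sp2R} (hσ : σ ∈ jacobiGroup) (hf : slash k f σ = f) (j : ℕ) :
    slash k (tilde (p * j) (φ j)) σ = tilde (p * j) (φ j) := by
  funext Ω
  refine congrFun (coeff_unique hp (g := fun x => f (shift x Ω))
    (a := fun j => slash k (tilde (p * j) (φ j)) σ Ω) (b := fun j => tilde (p * j) (φ j) Ω)
    (fun x => ?_) fun x => ?_) j
  · rw [← congrFun hf (shift x Ω), slash, denom_shift hσ, act_shift hσ]
    refine ((h (shift x (act σ Ω))).mul_left _).congr_fun fun j => ?_
    rw [tilde_shift, slash, mul_assoc]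
  · exact (h (shift x Ω)).congr_fun fun j => (tilde_shift _ _ _ _).symm

theorem exists_tau_eq (τ : ℍ) (z : ℂ) : ∃ Ω : SiegelUpperHalf, tau Ω = τ ∧ Ω.1 0 1 = z := by
  have hτ := τ.im_pos
  have hv : ((τ : ℂ), z, ((z.im ^ 2 / τ.im + 1 : ℝ) * I : ℂ)) ∈ siegelDomain := by
    refine ⟨hτ, ?_⟩
    rw [← div_lt_iff₀' (by exact hτ)]
    simp only [im_ofReal_mul, I_im, mul_one]
    exact lt_add_one _
  refine ⟨point _ hv, ?_, by simp [point]⟩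
  apply UpperHalfPlane.ext
  show (point _ hv).1 0 0 = τ
  simp [point]

theorem HasFourierJacobiExpansion.unique {p : ℕ} (hp : 0 < p) {f : SiegelUpperHalf → ℂ}
    {φ ψ : ℕ → ℍ × ℂ → ℂ} (hφ : HasFourierJacobiExpansion p f φ)
    (hψ : HasFourierJacobiExpansion p f ψ) : φ = ψ := by
  funext j ⟨τ, z⟩
  obtain ⟨Ω, rfl, rfl⟩ := exists_tau_eq τ z
  have := congrFun (coeff_unique hp (g := fun x => f (shift x Ω))
    (a := fun j => tilde (p * j) (φ j) Ω) (b := fun j => tilde (p * j) (ψ j) Ω)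
    (fun x => (hφ (shift x Ω)).congr_fun fun j => (tilde_shift _ _ _ _).symm)
    fun x => (hψ (shift x Ω)).congr_fun fun j => (tilde_shift _ _ _ _).symm) j
  exact mul_right_cancel₀ (e_ne_zero _) this

theorem HasFourierJacobiExpansion.add {p : ℕ} {f g : SiegelUpperHalf → ℂ}
    {φ ψ : ℕ → ℍ × ℂ → ℂ} (hφ : HasFourierJacobiExpansion p f φ)
    (hψ : HasFourierJacobiExpansion p g ψ) : HasFourierJacobiExpansion p (f + g) (φ + ψ) :=
  fun Ω => ((hφ Ω).add (hψ Ω)).congr_fun fun j => by simp [tilde, add_mul]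

theorem HasFourierJacobiExpansion.smul {p : ℕ} {f : SiegelUpperHalf → ℂ} {φ : ℕ → ℍ × ℂ → ℂ}
    (hφ : HasFourierJacobiExpansion p f φ) (c : ℂ) :
    HasFourierJacobiExpansion p (c • f) (c • φ) :=
  fun Ω => ((hφ Ω).mul_left c).congr_fun fun j => by simp [tilde, mul_assoc]

/-- The Fourier-Jacobi coefficient of index `pj`. -/
def fourierJacobi (p : ℕ) (f : SiegelUpperHalf → ℂ) (j : ℕ) (q : ℍ × ℂ) : ℂ :=
  jacobiCoeff (inCoords f) ((p * j : ℕ) : ℤ) (q.1, q.2)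

/-- The support on definite forms requires M > 0. In particular the coefficient of index 0 vanishes,
so leaving j = 0 out of the injectivity statement loses nothing. -/
theorem IsParamodularCusp.jacobiCoeff_eq_zero_of_nonpos {p k : ℕ} {F : ℂ × ℂ × ℂ → ℂ}
    (hF : IsParamodularCusp p k F) (hp : p.Prime) {M : ℤ} (hM : M ≤ 0) {τ : ℂ} (hτ : 0 < τ.im)
    (z : ℂ) : jacobiCoeff F M (τ, z) = 0 := by
  refine (hF.hasSum_jacobiCoeff_eq M hτ z).unique (hasSum_zero.congr_fun fun q => ?_)
  have : coeff F q.2 q.1 M = 0 := by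
    by_contra h
    exact absurd (hF.coeff_posDef hp h).2.1 hM.not_gt
  rw [this, zero_mul]

section Eigenspace

variable {p k : ℕ} [NeZero p] {ε : ℤˣ} {f : SiegelUpperHalf → ℂ}

theorem hasFourierJacobiExpansion (hp : p.Prime) (hf : f ∈ paramodularCuspEigenspace p k ε) :
    HasFourierJacobiExpansion p f (fourierJacobi p f) := by
  intro Ω
  have hF := isParamodularCusp_inCoords hf
  have hmem := coords_mem Ω
  have h := hF.hasSum_jacobiCoeff hmem
  have hinj : Function.Injective fun j : ℕ => ((p * j : ℕ) : ℤ) := fun i j hij =>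
    Nat.eq_of_mul_eq_mul_left hp.pos (Int.ofNat.inj hij)
  rw [← hinj.hasSum_iff] at h
  · have hval : inCoords f ((coords Ω).1, (coords Ω).2.1, (coords Ω).2.2) = f Ω :=
      inCoords_coords f Ω
    rw [← hval]
    refine h.congr_fun fun j => ?_
    simp only [Function.comp, Int.cast_natCast]
    rfl
  · intro M hM
    by_cases h0 : M ≤ 0
    · exact mul_eq_zero_of_left (hF.jacobiCoeff_eq_zero_of_nonpos hp h0 hmem.1 _) _
    rw [hF.jacobiCoeff_eq_zero hp.pos, zero_mul]
    rintro ⟨j, rfl⟩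
    have hj : 0 < j := pos_of_mul_pos_right (not_le.1 h0) (Int.natCast_nonneg p)
    refine hM ⟨j.toNat, ?_⟩
    simp only
    push_cast
    rw [Int.toNat_of_nonneg hj.le]

theorem fourierJacobi_mem (hp : p.Prime) (hf : f ∈ paramodularCuspEigenspace p k ε) (j : ℕ) :
    fourierJacobi p f j ∈ jacobiCuspForms k (p * j) := by
  have hF := isParamodularCusp_inCoords hf
  refine ⟨⟨jacobiCoeff (inCoords f) ((p * j : ℕ) : ℤ), fun q hq =>
    (hF.differentiableAt_jacobiCoeff _ hq).differentiableWithinAt, fun _ _ => rfl⟩, fun σ hσ => ?_,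
    fun x => coeff (inCoords f) x.1 x.2 ((p * j : ℕ) : ℤ), fun n r h => ?_, fun τ z => ?_⟩
  · exact (hasFourierJacobiExpansion hp hf).slash_tilde hp.pos hσ
      (hf.1.1.2 σ (jacobiGroup_subset_paramodularGroup p hσ)) j
  · obtain ⟨h1, -, h3⟩ := hF.coeff_posDef hp h
    exact ⟨h1.le, h3.trans_eq (by ring)⟩
  · exact (Equiv.prodComm ℤ ℤ).hasSum_iff.1 (hF.hasSum_jacobiCoeff_eq _ τ.im_pos z)

/-- The Fourier-Jacobi expansion as a linear map. -/
def fourierJacobiMap (hp : p.Prime) :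
    paramodularCuspEigenspace p k ε →ₗ[ℂ] ((j : ℕ) → jacobiCuspForms k (p * j)) where
  toFun f j := ⟨fourierJacobi p f.1 j, fourierJacobi_mem hp f.2 j⟩
  map_add' f g := by
    -- Linearity comes from uniqueness of the expansion, which avoids integrability questions for
    -- the defining integrals.
    have := (hasFourierJacobiExpansion hp (f + g).2).unique hp.pos
      ((hasFourierJacobiExpansion hp f.2).add (hasFourierJacobiExpansion hp g.2))
    funext j
    exact Subtype.ext (congrFun this j)
  map_smul' c f := by
    have := (hasFourierJacobiExpansion hp (c • f).2).unique hp.pos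
      ((hasFourierJacobiExpansion hp f.2).smul c)
    funext j
    exact Subtype.ext (congrFun this j)

theorem eq_zero_of_fourierJacobi_eq_zero (hp : p.Prime)
    (hf : f ∈ paramodularCuspEigenspace p k ε) {J : ℕ}
    (hJ : ⌊(k : ℚ) / 10 * (((p : ℚ) ^ 2 + 1) / ((p : ℚ) + 1))⌋ ≤ (J : ℤ))
    (h : ∀ j ∈ Finset.Icc 1 J, fourierJacobi p f j = 0) : f = 0 := by
  have hF := isParamodularCusp_inCoords hf
  -- The multiples of p strictly between 0 and p(J + 1) are exactly the indices p, 2p, …, Jp assumed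
  -- to vanish.
  have hvan := hF.eq_zero_of_vanishing_order hp (c := p * (J + 1)) (fun M hM τ z hτ => ?_) ?_
  · funext Ω
    rw [← inCoords_coords f Ω]
    exact hvan _ (coords_mem Ω)
  · by_cases h0 : M ≤ 0
    · exact hF.jacobiCoeff_eq_zero_of_nonpos hp h0 hτ z
    by_cases hd : (p : ℤ) ∣ M
    · obtain ⟨j, rfl⟩ := hd
      have hp0 : (0 : ℤ) < p := by exact_mod_cast hp.pos
      have hj : 0 < j := pos_of_mul_pos_right (not_le.1 h0) hp0.le
      push_cast at hM
      have hjJ : j < J + 1 := lt_of_mul_lt_mul_left hM hp0.le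
      lift j to ℕ using hj.le
      have := congrFun (h j (Finset.mem_Icc.2 ⟨by omega, by omega⟩)) (⟨τ, hτ⟩, z)
      rw [fourierJacobi] at this
      push_cast at this
      exact this
    · exact hF.jacobiCoeff_eq_zero hp.pos hd _
  · have h1 : (k : ℚ) / 10 * (((p : ℚ) ^ 2 + 1) / ((p : ℚ) + 1)) < J + 1 := by
      refine (Int.lt_floor_add_one _).trans_le ?_
      exact_mod_cast add_le_add_left hJ 1
    have h2 : (k : ℝ) / 10 * (((p : ℝ) ^ 2 + 1) / ((p : ℝ) + 1)) < J + 1 := by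
      have := (Rat.cast_lt (K := ℝ)).2 h1
      push_cast at this
      exact this
    have hp0 : (0 : ℝ) < p := by exact_mod_cast hp.pos
    rw [div_mul_div_comm, div_lt_iff₀ (by positivity)] at h2
    -- The constant 12.56 in `heightBound` is 4 · 3.14, so the 4π of the vanishing criterion leaves
    -- a factor π / 3.14 ≥ 1.
    have h3 : 4 * Real.pi * ((p * (J + 1) : ℕ) : ℝ) * (heightBound p / p) =
        Real.pi / 3.14 * ((J + 1) * (10 * (p + 1)) / (p ^ 2 + 1)) := by
      rw [heightBound]; push_cast; field_simp; norm_num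
    have h4 : 1 ≤ Real.pi / 3.14 := by
      rw [one_le_div (by norm_num)]; exact Real.pi_gt_d2.le
    rw [h3]
    refine lt_of_lt_of_le ?_ (le_mul_of_one_le_left (by positivity) h4)
    rwa [lt_div_iff₀ (by positivity)]

end Eigenspace

end

end Paramodular

end

theorem lemma5p1 (p : ℕ) [NeZero p] (hp : p.Prime) (k : ℕ) (ε : ℤˣ) :
    ∃ FJ : Paramodular.paramodularCuspEigenspace p k ε →ₗ[ℂ]
        ((j : ℕ) → Paramodular.jacobiCuspForms k (p * j)),
      (∀ (f : Paramodular.paramodularCuspEigenspace p k ε) (φ : ℕ → UpperHalfPlane × ℂ → ℂ),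
        Paramodular.HasFourierJacobiExpansion p f.1 φ ↔ ∀ j, φ j = (FJ f j).1) ∧
      ∀ J : ℕ, ⌊(k : ℚ) / 10 * (((p : ℚ) ^ 2 + 1) / ((p : ℚ) + 1))⌋ ≤ (J : ℤ) →
        Function.Injective fun (f : Paramodular.paramodularCuspEigenspace p k ε)
          (j : Finset.Icc 1 J) => FJ f j := by
  have hexp := fun f : Paramodular.paramodularCuspEigenspace p k ε =>
    Paramodular.hasFourierJacobiExpansion hp f.2
  refine ⟨Paramodular.fourierJacobiMap hp, fun f φ => ⟨fun h j => ?_, fun h => ?_⟩,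
    fun J hJ f g hfg => ?_⟩
  · exact congrFun (h.unique hp.pos (hexp f)) j
  · rw [show φ = Paramodular.fourierJacobi p f.1 from funext h]
    exact hexp f
  · refine sub_eq_zero.1 (Subtype.ext ?_)
    refine Paramodular.eq_zero_of_fourierJacobi_eq_zero hp (f - g).2 hJ fun j hj => ?_
    have h1 : Paramodular.fourierJacobiMap hp f j = Paramodular.fourierJacobiMap hp g j :=
      congrFun hfg ⟨j, hj⟩
    have h2 : Paramodular.fourierJacobiMap hp (f - g) j = 0 := by
      rw [map_sub, Pi.sub_apply, h1, sub_self]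
    exact congrArg Subtype.val h2
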